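/- **Conventions.** For $s,h>0$ let $\mathcal S_{s,h}(\mathbf R^d)$ be the set of $f\in C^\infty(\mathbf R^d)$ with $\|f\|_{\mathcal S_{s,h}}=\sup_{\alpha,\beta\in\mathbf N^d,\,x\in\mathbf R^d}\frac{|x^\beta\partial^\alpha f(x)|}{h^{|\alpha|+|\beta|}(\alpha!\,\beta!)^s}<\infty$; put $\mathcal S_s=\bigcup_{h>0}\mathcal S_{s,h}$, and let $\mathcal S_s'=\bigcap_{h>0}\mathcal S_{s,h}'$ be the space of linear forms on $\mathcal S_s$ whose restriction to each $\mathcal S_{s,h}$ is continuous. For $s\ge 1/2$, $\mathcal S_s$ is regarded as a subset of $\mathcal S_{1/2}'$ through $\langle f,\varphi\rangle=\int f\varphi\,dx$, and $\mathcal S_s'$ is regarded as a subset of $\mathcal S_{1/2}'$ by restriction of its elements to $\mathcal S_{1/2}\subseteq\mathcal S_s$. Let $\phi(x)=\pi^{-d/4}e^{-|x|^2/2}$, and for $f\in\mathcal S_{1/2}'(\mathbf R^d)$ let $$V_\phi f(x,\xi)=(2\pi)^{-d/2}\big\langle f,\overline{\phi(\,\cdot\,-x)}\,e^{-i\langle\,\cdot\,,\xi\rangle}\big\rangle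 ,\qquad (x,\xi)\in\mathbf R^{2d}.$$ Let $\Upsilon(\mathbf R^d)$ be the set of all $f\in\mathcal S_{1/2}'(\mathbf R^d)$ such that for every $\varepsilon>0$ there is a constant $C_\varepsilon$ with $|V_\phi f(x,\xi)|\le C_\varepsilon e^{\varepsilon(|x|^2+|\xi|^2)}$ for all $x,\xi\in\mathbf R^d$. A weight on $\mathbf R^m$ is a (measurable) function $\omega>0$ in $L^\infty_{loc}(\mathbf R^m)$ which is bounded from below by a positive constant on each compact set. The class $\mathscr P_Q^0(\mathbf R^m)$ consists of the weights $\omega$ such that * there are $c,C>0$ with $C^{-1}\omega(x)^2\le\omega(x+y)\,\omega(x-y)\le C\omega(x)^2$ whenever $Rc\le|x|\le c/|y|$ for some $R\ge2$ (with $c/0=\infty$), and * for every $c>0$ there is $C>0$ with $C^{-1}e^{-c|x|^2}\le\omega(x)\le Ce^{c|x|^2}$ for all $x$. A mixed quasi-norm space $\mathscr B=L^p(V)$ on $\mathbf R^{2d}$ is given by subspaces $V_1,\dots,V_n$ with $V_1\oplus\cdots\oplus V_n=\mathbf R^{2d}$ and exponents $p_1,\dots,p_n\in(0,\infty]$; its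 quasi-norm $\|F\|_{\mathscr B}$ is obtained by taking the $L^{p_1}(V_1)$ quasi-norm of $F$, then the $L^{p_2}(V_2)$ quasi-norm of the result, and so on up to $L^{p_n}(V_n)$. The modulation space $M(\omega,\mathscr B)$ consists of all $f\in\mathcal S_{1/2}'(\mathbf R^d)$ with $\|V_\phi f\cdot\omega\|_{\mathscr B}<\infty$. **Proposition.** Let $\mathscr B$ be a mixed quasi-norm space on $\mathbf R^{2d}$. Then $$\bigcup M(\omega,\mathscr B)=\Upsilon(\mathbf R^d),$$ where the union is taken over all rotation invariant $\omega\in\mathscr P_Q^0(\mathbf R^{2d})$. Furthermore, if $0<\gamma<2$, $0<\varepsilon<\min(\gamma,2-\gamma)$ and $\omega(x,\xi)=Ce^{c(|x|^\gamma+|\xi|^\gamma)}$ for some constants $C>0$ and $c\in\mathbf R$, then: 1. if $c>0$, then $\mathcal S_{1/(\gamma+\varepsilon)}(\mathbf R^d)\subseteq M(\omega,\mathscr B)\subseteq\mathcal S_{1/(\gamma-\varepsilon)}(\mathbf R^d)$; 2. if $c<0$, then $\mathcal S_{1/(\gamma-\varepsilon)}'(\mathbf R^d)\subseteq M(\omega,\mathscr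 B)\subseteq\mathcal S_{1/(\gamma+\varepsilon)}'(\mathbf R^d)$. -/

import Mathlib

open MeasureTheory
open scoped ENNReal

noncomputable section

namespace GelfandShilov

/-- `ℝ^d` with its Euclidean norm. -/
abbrev Rd (d : ℕ) : Type := EuclideanSpace ℝ (Fin d)

/-- The phase space `ℝ^{2d} = ℝ^d × ℝ^d` with its Euclidean norm; a point is `X = (x, ξ)`,
`x = X.fst`, `ξ = X.snd`. -/
abbrev R2d (d : ℕ) : Type := WithLp 2 (Rd d × Rd d)

/-! ### Weights -/

section Weights

variable {E : Type*} [NormedAddCommGroup E] [InnerProductSpace ℝ E] [FiniteDimensional ℝ E]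
  [MeasurableSpace E] [BorelSpace E]

/-- A weight: a positive function in `L^∞_loc` which is bounded from below by a positive constant
on each compact set. -/
structure IsWeight (ω : E → ℝ) : Prop where
  pos : ∀ x, 0 < ω x
  aemeasurable : AEMeasurable ω volume
  locallyBounded : ∀ K : Set E, IsCompact K → ∃ C : ℝ, ∀ᵐ x ∂(volume.restrict K), ω x ≤ C
  locallyBelow : ∀ K : Set E, IsCompact K → ∃ c : ℝ, 0 < c ∧ ∀ x ∈ K, c ≤ ω x

/-- The class `𝒫_Q^0` of weakly subgaussian weights. In `secondDifference` the condition
`|x| ≤ c / |y|` is written `|x| * |y| ≤ c`, so that it also makes sense for `y = 0`. -/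
structure IsWeaklySubgaussian (ω : E → ℝ) : Prop extends IsWeight ω where
  secondDifference : ∃ c C : ℝ, 0 < c ∧ 0 < C ∧ ∀ R : ℝ, 2 ≤ R → ∀ x y : E,
    R * c ≤ ‖x‖ → ‖x‖ * ‖y‖ ≤ c →
      C⁻¹ * ω x ^ 2 ≤ ω (x + y) * ω (x - y) ∧ ω (x + y) * ω (x - y) ≤ C * ω x ^ 2
  subgaussian : ∀ c : ℝ, 0 < c → ∃ C : ℝ, 0 < C ∧ ∀ x : E,
    C⁻¹ * Real.exp (-c * ‖x‖ ^ 2) ≤ ω x ∧ ω x ≤ C * Real.exp (c * ‖x‖ ^ 2)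

/-- Invariance under all linear isometries, i.e. `ω x` depends only on `|x|`. -/
def IsRotationInvariant (ω : E → ℝ) : Prop :=
  ∀ (T : E ≃ₗᵢ[ℝ] E) (x : E), ω (T x) = ω x

/-! ### Mixed quasi-norms -/

/-- The function `x ↦ ‖F (x + ·)‖_{L^p(V)}`, where `V` carries its Lebesgue measure. -/
def lpAlong (V : Submodule ℝ E) (p : ℝ≥0∞) (F : E → ℝ≥0∞) : E → ℝ≥0∞ :=
  fun x => eLpNorm (fun t : V => F (x + (t : E))) p volume

/-- The mixed (quasi-)norm `‖F‖_{L^p(V)}`, `V = (V_1, …, V_n)`, `p = (p_1, …, p_n)`, of a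
`[0, ∞]`-valued function on `E = V_1 ⊕ ⋯ ⊕ V_n`: first the `L^{p_1}(V_1)` quasi-norm is taken,
then the `L^{p_2}(V_2)` quasi-norm of the result, and so on. -/
def mixedNorm {n : ℕ} (V : Fin n → Submodule ℝ E) (p : Fin n → ℝ≥0∞) (F : E → ℝ≥0∞) : ℝ≥0∞ :=
  Fin.foldl n (fun G j => lpAlong (V j) (p j) G) F 0

end Weights

/-! ### Gelfand-Shilov spaces of functions -/

variable {d : ℕ}

/-- The partial derivative `∂_i f`. -/
def partialD (i : Fin d) (f : Rd d → ℂ) : Rd d → ℂ :=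
  fun x => fderiv ℝ f x (EuclideanSpace.single i 1)

/-- The partial derivatives `∂_i^{α_i}`, `i ∈ l`, applied one after the other. -/
def listPartial (α : Fin d → ℕ) (l : List (Fin d)) (f : Rd d → ℂ) : Rd d → ℂ :=
  l.foldr (fun i g => (partialD i)^[α i] g) f

/-- `∂^α f = ∂_1^{α_1} ⋯ ∂_d^{α_d} f`. -/
def iterPartial (α : Fin d → ℕ) (f : Rd d → ℂ) : Rd d → ℂ :=
  listPartial α (List.finRange d) f

/-- `|x^β ∂^α f(x)|`. -/
def monoDeriv (f : Rd d → ℂ) (α β : Fin d → ℕ) (x : Rd d) : ℝ :=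
  ‖∏ i, x i ^ β i‖ * ‖iterPartial α f x‖

/-- `h^{|α|+|β|} (α! β!)^s`. -/
def gsFactor (s h : ℝ) (α β : Fin d → ℕ) : ℝ :=
  h ^ (∑ i, α i + ∑ i, β i) * (((∏ i, (α i).factorial) * ∏ i, (β i).factorial : ℕ) : ℝ) ^ s

/-- The norm of `S_{s,h}`, with value `∞` outside of that space. -/
def gsNorm (s h : ℝ) (f : Rd d → ℂ) : ℝ≥0∞ :=
  ⨆ (α : Fin d → ℕ) (β : Fin d → ℕ) (x : Rd d),
    ENNReal.ofReal (monoDeriv f α β x / gsFactor s h α β)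

theorem gsFactor_pos {s h : ℝ} (hh : 0 < h) (α β : Fin d → ℕ) : 0 < gsFactor s h α β := by
  unfold gsFactor
  have : 0 < (∏ i, (α i).factorial) * ∏ i, (β i).factorial :=
    Nat.mul_pos (Finset.prod_pos fun i _ => Nat.factorial_pos _)
      (Finset.prod_pos fun i _ => Nat.factorial_pos _)
  have h2 : (0 : ℝ) < (((∏ i, (α i).factorial) * ∏ i, (β i).factorial : ℕ) : ℝ) := by
    exact_mod_cast this
  positivity

theorem gsFactor_mono {s t h k : ℝ} (hh : 0 < h) (hk : h ≤ k) (hst : s ≤ t) (α β : Fin d → ℕ) :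
    gsFactor s h α β ≤ gsFactor t k α β := by
  unfold gsFactor
  have : 0 < (∏ i, (α i).factorial) * ∏ i, (β i).factorial :=
    Nat.mul_pos (Finset.prod_pos fun i _ => Nat.factorial_pos _)
      (Finset.prod_pos fun i _ => Nat.factorial_pos _)
  have h2 : (1 : ℝ) ≤ (((∏ i, (α i).factorial) * ∏ i, (β i).factorial : ℕ) : ℝ) := by
    exact_mod_cast this
  have h3 := Real.rpow_le_rpow_of_exponent_le h2 hst
  have hk0 : 0 < k := hh.trans_le hk
  gcongr

theorem gsNorm_lt_top_iff {s h : ℝ} (hh : 0 < h) (f : Rd d → ℂ) :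
    gsNorm s h f < ∞ ↔ ∃ B : ℝ, ∀ α β x, monoDeriv f α β x ≤ B * gsFactor s h α β := by
  constructor
  · intro hf
    refine ⟨(gsNorm s h f).toReal, fun α β x => ?_⟩
    have h1 : ENNReal.ofReal (monoDeriv f α β x / gsFactor s h α β) ≤ gsNorm s h f :=
      le_iSup_of_le α (le_iSup_of_le β (le_iSup_of_le x le_rfl))
    have h2 := (ENNReal.ofReal_le_iff_le_toReal hf.ne).1 h1
    exact (div_le_iff₀ (gsFactor_pos hh α β)).1 h2
  · rintro ⟨B, hB⟩
    refine lt_of_le_of_lt (?_ : _ ≤ ENNReal.ofReal B) ENNReal.ofReal_lt_top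
    refine iSup_le fun α => iSup_le fun β => iSup_le fun x => ENNReal.ofReal_le_ofReal ?_
    exact (div_le_iff₀ (gsFactor_pos hh α β)).2 (hB α β x)

theorem contDiff_partialD {f : Rd d → ℂ} (hf : ContDiff ℝ (⊤ : ℕ∞) f) (i : Fin d) :
    ContDiff ℝ (⊤ : ℕ∞) (partialD i f) :=
  (hf.fderiv_right (m := ((⊤ : ℕ∞) : WithTop ℕ∞)) (by simp)).clm_apply contDiff_const

theorem contDiff_partialD_iterate {f : Rd d → ℂ} (hf : ContDiff ℝ (⊤ : ℕ∞) f) (i : Fin d) (k : ℕ) :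
    ContDiff ℝ (⊤ : ℕ∞) ((partialD i)^[k] f) := by
  induction k with
  | zero => exact hf
  | succ k ih => rw [Function.iterate_succ_apply']; exact contDiff_partialD ih i

theorem contDiff_listPartial {f : Rd d → ℂ} (hf : ContDiff ℝ (⊤ : ℕ∞) f) (α : Fin d → ℕ)
    (l : List (Fin d)) : ContDiff ℝ (⊤ : ℕ∞) (listPartial α l f) := by
  induction l with
  | nil => exact hf
  | cons i l ih => exact contDiff_partialD_iterate ih i _

theorem partialD_add {f g : Rd d → ℂ} (hf : ContDiff ℝ (⊤ : ℕ∞) f) (hg : ContDiff ℝ (⊤ : ℕ∞) g) (i : Fin d) :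
    partialD i (f + g) = partialD i f + partialD i g := by
  funext x
  simp [partialD, fderiv_add (hf.differentiable (by simp) x) (hg.differentiable (by simp) x)]

theorem partialD_smul {f : Rd d → ℂ} (c : ℂ) (hf : ContDiff ℝ (⊤ : ℕ∞) f) (i : Fin d) :
    partialD i (c • f) = c • partialD i f := by
  funext x
  simp [partialD, fderiv_const_smul (hf.differentiable (by simp) x)]

theorem listPartial_add {f g : Rd d → ℂ} (hf : ContDiff ℝ (⊤ : ℕ∞) f) (hg : ContDiff ℝ (⊤ : ℕ∞) g)
    (α : Fin d → ℕ) (l : List (Fin d)) :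
    listPartial α l (f + g) = listPartial α l f + listPartial α l g := by
  induction l with
  | nil => rfl
  | cons i l ih =>
    change (partialD i)^[α i] (listPartial α l (f + g)) =
      (partialD i)^[α i] (listPartial α l f) + (partialD i)^[α i] (listPartial α l g)
    rw [ih]
    induction α i with
    | zero => rfl
    | succ k ihk =>
      rw [Function.iterate_succ_apply', ihk, partialD_add
        (contDiff_partialD_iterate (contDiff_listPartial hf α l) i k)
        (contDiff_partialD_iterate (contDiff_listPartial hg α l) i k)]
      simp only [Function.iterate_succ_apply']

theorem listPartial_smul {f : Rd d → ℂ} (c : ℂ) (hf : ContDiff ℝ (⊤ : ℕ∞) f)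
    (α : Fin d → ℕ) (l : List (Fin d)) :
    listPartial α l (c • f) = c • listPartial α l f := by
  induction l with
  | nil => rfl
  | cons i l ih =>
    change (partialD i)^[α i] (listPartial α l (c • f)) =
      c • (partialD i)^[α i] (listPartial α l f)
    rw [ih]
    induction α i with
    | zero => rfl
    | succ k ihk =>
      rw [Function.iterate_succ_apply', ihk, partialD_smul c
        (contDiff_partialD_iterate (contDiff_listPartial hf α l) i k)]
      simp only [Function.iterate_succ_apply']

/-- The Gelfand-Shilov space `S_s(ℝ^d) = ⋃_{h > 0} S_{s,h}(ℝ^d)`. -/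
def GS (d : ℕ) (s : ℝ) : Submodule ℂ (Rd d → ℂ) where
  carrier := {f | ContDiff ℝ (⊤ : ℕ∞) f ∧ ∃ h : ℝ, 0 < h ∧ gsNorm s h f < ∞}
  zero_mem' := by
    have h0 : ContDiff ℝ (⊤ : ℕ∞) (0 : Rd d → ℂ) := contDiff_const
    refine ⟨h0, 1, one_pos, (gsNorm_lt_top_iff one_pos _).2 ⟨0, fun α β x => ?_⟩⟩
    have h1 : iterPartial α (0 : Rd d → ℂ) = 0 := by
      have := listPartial_smul (0 : ℂ) h0 α (List.finRange d)
      simpa [iterPartial] using this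
    simp [monoDeriv, h1]
  add_mem' := by
    rintro f g ⟨hf, h, hh, hfn⟩ ⟨hg, k, hk, hgn⟩
    obtain ⟨A, hA⟩ := (gsNorm_lt_top_iff hh _).1 hfn
    obtain ⟨B, hB⟩ := (gsNorm_lt_top_iff hk _).1 hgn
    have hm : 0 < max h k := lt_max_of_lt_left hh
    refine ⟨hf.add hg, max h k, hm, (gsNorm_lt_top_iff hm _).2 ⟨|A| + |B|, fun α β x => ?_⟩⟩
    have h1 : monoDeriv (f + g) α β x ≤ monoDeriv f α β x + monoDeriv g α β x := by
      unfold monoDeriv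
      rw [← mul_add]
      refine mul_le_mul_of_nonneg_left ?_ (norm_nonneg _)
      rw [iterPartial, listPartial_add hf hg]
      exact norm_add_le _ _
    have h2 : A * gsFactor s h α β ≤ |A| * gsFactor s (max h k) α β :=
      mul_le_mul (le_abs_self A) (gsFactor_mono hh (le_max_left _ _) le_rfl α β)
        (gsFactor_pos hh α β).le (abs_nonneg A)
    have h3 : B * gsFactor s k α β ≤ |B| * gsFactor s (max h k) α β :=
      mul_le_mul (le_abs_self B) (gsFactor_mono hk (le_max_right _ _) le_rfl α β)
        (gsFactor_pos hk α β).le (abs_nonneg B)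
    have := hA α β x
    have := hB α β x
    linarith [add_mul |A| |B| (gsFactor s (max h k) α β)]
  smul_mem' := by
    rintro c f ⟨hf, h, hh, hfn⟩
    obtain ⟨A, hA⟩ := (gsNorm_lt_top_iff hh _).1 hfn
    refine ⟨contDiff_const.smul hf, h, hh, (gsNorm_lt_top_iff hh _).2 ⟨‖c‖ * A, fun α β x => ?_⟩⟩
    have h1 : monoDeriv (c • f) α β x = ‖c‖ * monoDeriv f α β x := by
      unfold monoDeriv
      rw [iterPartial, listPartial_smul c hf]
      simp only [Pi.smul_apply, norm_smul]
      rw [iterPartial]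
      ring
    rw [h1, mul_assoc]
    exact mul_le_mul_of_nonneg_left (hA α β x) (norm_nonneg c)

theorem mem_GS_iff {s : ℝ} {f : Rd d → ℂ} :
    f ∈ GS d s ↔ ContDiff ℝ (⊤ : ℕ∞) f ∧ ∃ h : ℝ, 0 < h ∧ gsNorm s h f < ∞ := Iff.rfl

/-- `S_s ⊆ S_t` when `s ≤ t`. -/
theorem GS_mono {s t : ℝ} (hst : s ≤ t) : GS d s ≤ GS d t := by
  rintro f ⟨hf, h, hh, hfn⟩
  obtain ⟨A, hA⟩ := (gsNorm_lt_top_iff hh _).1 hfn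
  refine ⟨hf, h, hh, (gsNorm_lt_top_iff hh _).2 ⟨|A|, fun α β x => (hA α β x).trans ?_⟩⟩
  exact mul_le_mul (le_abs_self A) (gsFactor_mono hh le_rfl hst α β)
        (gsFactor_pos hh α β).le (abs_nonneg A)

/-! ### Gelfand-Shilov distributions -/

/-- The distribution space `S_s'(ℝ^d) = ⋂_{h > 0} S_{s,h}'(ℝ^d)`: the linear forms on `S_s` whose
restriction to each Banach space `S_{s,h}` is continuous. -/
structure GSDual (d : ℕ) (s : ℝ) where
  toLin : GS d s →ₗ[ℂ] ℂ
  bound : ∀ h : ℝ, 0 < h → ∃ C : ℝ, ∀ φ : GS d s, gsNorm s h (φ : Rd d → ℂ) < ∞ →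
    ‖toLin φ‖ ≤ C * (gsNorm s h (φ : Rd d → ℂ)).toReal

/-- `S_s(ℝ^d)` as a subset of `S_{1/2}'(ℝ^d)`: the distributions
`φ ↦ ∫ f(x) φ(x) dx` with `f ∈ S_s`. -/
def functionsInDual (d : ℕ) (s : ℝ) : Set (GSDual d (1 / 2)) :=
  {u | ∃ f ∈ GS d s, ∀ φ : GS d (1 / 2), u.toLin φ = ∫ x, f x * (φ : Rd d → ℂ) x}

/-- `S_s'(ℝ^d)`, `s ≥ 1/2`, as a subset of `S_{1/2}'(ℝ^d)`: the restrictions to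
`S_{1/2} ⊆ S_s` of the elements of `S_s'`. -/
def distributionsInDual (d : ℕ) (s : ℝ) : Set (GSDual d (1 / 2)) :=
  {u | ∃ v : GSDual d s, ∀ (φ : Rd d → ℂ) (h₁ : φ ∈ GS d (1 / 2)) (h₂ : φ ∈ GS d s),
    u.toLin ⟨φ, h₁⟩ = v.toLin ⟨φ, h₂⟩}

/-! ### The short-time Fourier transform with Gaussian window -/

/-- The window `φ(x) = π^{-d/4} e^{-|x|²/2}`. -/
def gaussWindow (d : ℕ) (x : Rd d) : ℂ :=
  ((Real.pi ^ (-(d : ℝ) / 4) * Real.exp (-‖x‖ ^ 2 / 2) : ℝ) : ℂ)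

/-- The function `y ↦ conj (φ(y - x)) e^{-i⟨y, ξ⟩}`, with `φ` the Gaussian window. -/
def windowShift (x ξ : Rd d) (y : Rd d) : ℂ :=
  (starRingEnd ℂ) (gaussWindow d (y - x)) * Complex.exp (-Complex.I * ((inner ℝ y ξ : ℝ) : ℂ))

/-- The one-dimensional complex Gaussian `z ↦ e^{-z²/2 + az}`. -/
def gauss1 (a z : ℂ) : ℂ := Complex.exp (-z ^ 2 / 2 + a * z)

theorem differentiable_gauss1 (a : ℂ) : Differentiable ℂ (gauss1 a) := by
  unfold gauss1
  fun_prop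

theorem norm_gauss1_le (a : ℂ) (t r : ℝ) (_hr : 0 ≤ r) (z : ℂ) (hz : ‖z - t‖ = r) :
    ‖gauss1 a z‖ ≤ Real.exp (-t ^ 2 / 4 + 3 * r ^ 2 + 3 * ‖a‖ ^ 2) := by
  unfold gauss1
  rw [Complex.norm_exp]
  apply Real.exp_le_exp.2
  obtain ⟨w, rfl⟩ : ∃ w, z = t + w := ⟨z - t, by ring⟩
  have hw : ‖w‖ = r := by simpa using hz
  have e1 : (-((t : ℂ) + w) ^ 2 / 2 + a * (t + w)).re
      = -t ^ 2 / 2 - t * w.re - (w.re ^ 2 - w.im ^ 2) / 2 + (a * (t + w)).re := by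
    have : -((t : ℂ) + w) ^ 2 / 2 + a * (t + w)
      = ((1 / 2 : ℝ) : ℂ) * (-((t : ℂ) + w) ^ 2) + a * (t + w) := by push_cast; ring
    rw [this, Complex.add_re, Complex.re_ofReal_mul]
    simp [pow_two]
    ring
  have hr2 : w.re ^ 2 + w.im ^ 2 = r ^ 2 := by
    rw [← hw, ← Complex.normSq_eq_norm_sq, Complex.normSq_apply]; ring
  have h3 : (a * (t + w)).re ≤ ‖a‖ * (|t| + r) := by
    refine (Complex.re_le_norm _).trans ?_
    rw [norm_mul]
    refine mul_le_mul_of_nonneg_left ?_ (norm_nonneg a)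
    refine (norm_add_le _ _).trans ?_
    simp [hw]
  have ht : |t| ^ 2 = t ^ 2 := sq_abs t
  rw [e1]
  nlinarith [sq_nonneg (t / 2 + 2 * w.re), sq_nonneg (|t| - 4 * ‖a‖), sq_nonneg (‖a‖ - r),
    sq_nonneg w.re, sq_nonneg w.im, sq_nonneg (t + 4 * w.re)]

/-- The restriction of `gauss1` to the real line. -/
def gaussR (a : ℂ) (t : ℝ) : ℂ := gauss1 a t

theorem contDiff_gaussR (a : ℂ) : ContDiff ℝ (⊤ : ℕ∞) (gaussR a) := by
  unfold gaussR gauss1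
  have : ContDiff ℝ (⊤ : ℕ∞) (fun t : ℝ => (t : ℂ)) := Complex.ofRealCLM.contDiff
  exact (((this.pow 2).neg.div_const 2).add (contDiff_const.mul this)).cexp

theorem iteratedDeriv_gaussR (a : ℂ) (n : ℕ) (t : ℝ) :
    iteratedDeriv n (gaussR a) t = iteratedDeriv n (gauss1 a) (t : ℂ) := by
  induction n generalizing t with
  | zero => simp [gaussR]
  | succ n ih =>
    rw [iteratedDeriv_succ, iteratedDeriv_succ, funext ih]
    have hd : Differentiable ℂ (iteratedDeriv n (gauss1 a)) :=
      ((differentiable_gauss1 a).contDiff (n := ⊤)).differentiable_iteratedDeriv n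
        (WithTop.coe_lt_top _)
    exact (hd t).hasDerivAt.comp_ofReal.deriv

theorem gaussR_bound (a : ℂ) (n k : ℕ) (t : ℝ) :
    |t| ^ k * ‖iteratedDeriv n (gaussR a) t‖ ≤
      Real.exp (3 + 3 * ‖a‖ ^ 2) *
        (Real.exp 3 ^ (n + k) * ((n.factorial : ℝ) * k.factorial) ^ (1 / 2 : ℝ)) := by
  set r : ℝ := Real.sqrt (n + 1) with hr
  have hr0 : 0 < r := Real.sqrt_pos.2 (by positivity)
  have hr2 : r ^ 2 = n + 1 := Real.sq_sqrt (by positivity)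
  set M : ℝ := Real.exp (-t ^ 2 / 4 + 3 * r ^ 2 + 3 * ‖a‖ ^ 2) with hM
  have hc : ‖iteratedDeriv n (gaussR a) t‖ ≤ n.factorial * M / r ^ n := by
    rw [iteratedDeriv_gaussR]
    refine Complex.norm_iteratedDeriv_le_of_forall_mem_sphere_norm_le n hr0
      (differentiable_gauss1 a).diffContOnCl fun z hz => ?_
    exact norm_gauss1_le a t r hr0.le z (by simpa [dist_eq_norm] using hz)
  have hfac : (n.factorial : ℝ) / r ^ n ≤ Real.sqrt n.factorial := by
    have hf0 : (0 : ℝ) < n.factorial := by exact_mod_cast Nat.factorial_pos n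
    rw [div_le_iff₀ (by positivity)]
    have h1 : Real.sqrt n.factorial ≤ r ^ n := by
      apply Real.sqrt_le_iff.2
      refine ⟨by positivity, ?_⟩
      rw [← pow_mul, mul_comm, pow_mul, hr2]
      have : (n.factorial : ℝ) ≤ (n : ℝ) ^ n := by exact_mod_cast Nat.factorial_le_pow n
      refine this.trans ?_
      gcongr
      linarith
    calc (n.factorial : ℝ) = Real.sqrt n.factorial * Real.sqrt n.factorial :=
          (Real.mul_self_sqrt hf0.le).symm
      _ ≤ _ := by gcongr
  have hk : |t| ^ k * Real.exp (-t ^ 2 / 4) ≤ 2 ^ k * Real.sqrt k.factorial := by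
    have h1 := Real.pow_div_factorial_le_exp (t ^ 2 / 2) (by positivity) k
    have hf0 : (0 : ℝ) < k.factorial := by exact_mod_cast Nat.factorial_pos k
    rw [div_le_iff₀ hf0] at h1
    refine abs_le_of_sq_le_sq' ?_ (by positivity) |>.2
    rw [mul_pow, mul_pow, Real.sq_sqrt hf0.le, ← Real.exp_nat_mul]
    have e1 : (|t| ^ k) ^ 2 = 2 ^ k * (t ^ 2 / 2) ^ k := by
      rw [← mul_pow, ← pow_mul, mul_comm k 2, pow_mul, sq_abs]; congr 1; ring
    have e2 : Real.exp (((2 : ℕ) : ℝ) * (-t ^ 2 / 4)) = (Real.exp (t ^ 2 / 2))⁻¹ := by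
      rw [← Real.exp_neg]; congr 1; push_cast; ring
    rw [e1, e2, ← div_eq_mul_inv, div_le_iff₀ (Real.exp_pos _)]
    have h4 : (2 : ℝ) ^ k ≤ (2 ^ k) ^ 2 := by
      have : (1 : ℝ) ≤ 2 ^ k := one_le_pow₀ (by norm_num)
      nlinarith
    calc (2 : ℝ) ^ k * (t ^ 2 / 2) ^ k ≤ (2 ^ k) ^ 2 * (Real.exp (t ^ 2 / 2) * k.factorial) := by
          gcongr
      _ = _ := by ring
  have hMe : M = Real.exp (-t ^ 2 / 4) * (Real.exp 3 ^ n * Real.exp (3 + 3 * ‖a‖ ^ 2)) := by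
    rw [hM, hr2, ← Real.exp_nat_mul, ← Real.exp_add, ← Real.exp_add]
    congr 1; ring
  have h2e : (2 : ℝ) ^ k ≤ Real.exp 3 ^ k := by
    gcongr
    linarith [Real.add_one_le_exp (3 : ℝ)]
  calc |t| ^ k * ‖iteratedDeriv n (gaussR a) t‖
      ≤ |t| ^ k * (n.factorial * M / r ^ n) := by gcongr
    _ = (n.factorial / r ^ n) * (|t| ^ k * Real.exp (-t ^ 2 / 4)) *
          (Real.exp 3 ^ n * Real.exp (3 + 3 * ‖a‖ ^ 2)) := by rw [hMe]; ring
    _ ≤ Real.sqrt n.factorial * (Real.exp 3 ^ k * Real.sqrt k.factorial) *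
          (Real.exp 3 ^ n * Real.exp (3 + 3 * ‖a‖ ^ 2)) := by
        have hk' : |t| ^ k * Real.exp (-t ^ 2 / 4) ≤ Real.exp 3 ^ k * Real.sqrt k.factorial :=
          hk.trans (by gcongr)
        gcongr ?_ * ?_ * _
    _ = _ := by
        rw [← Real.sqrt_eq_rpow, Real.sqrt_mul (by positivity), pow_add]
        ring

/-- The function `x ↦ ∏ i, g i (x i)`. -/
def prodFun (g : Fin d → ℝ → ℂ) (x : Rd d) : ℂ := ∏ i, g i (x i)

theorem contDiff_prodFun {g : Fin d → ℝ → ℂ} (hg : ∀ i, ContDiff ℝ (⊤ : ℕ∞) (g i)) :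
    ContDiff ℝ (⊤ : ℕ∞) (prodFun g) := by
  unfold prodFun
  exact contDiff_prod fun i _ => (hg i).comp (EuclideanSpace.proj i : Rd d →L[ℝ] ℝ).contDiff

theorem partialD_prodFun {g : Fin d → ℝ → ℂ} (hg : ∀ i, ContDiff ℝ (⊤ : ℕ∞) (g i)) (i : Fin d) :
    partialD i (prodFun g) = prodFun (Function.update g i (deriv (g i))) := by
  funext x
  have hdiff : DifferentiableAt ℝ (prodFun g) x :=
    (contDiff_prodFun hg).differentiable (by simp) x
  rw [partialD, ← hdiff.lineDeriv_eq_fderiv, lineDeriv]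
  have e1 : (fun t : ℝ => prodFun g (x + t • EuclideanSpace.single i (1 : ℝ))) =
      fun t : ℝ => g i (x i + t) * ∏ j ∈ Finset.univ.erase i, g j (x j) := by
    funext t
    rw [prodFun, ← Finset.mul_prod_erase Finset.univ _ (Finset.mem_univ i)]
    congr 1
    · simp
    · refine Finset.prod_congr rfl fun j hj => ?_
      have : j ≠ i := Finset.ne_of_mem_erase hj
      simp [this]
  have h2 : HasDerivAt (fun t : ℝ => g i (x i + t)) (deriv (g i) (x i)) 0 := by
    have h3 : HasDerivAt (g i) (deriv (g i) (x i)) (x i + 0) := by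
      rw [add_zero]
      exact ((hg i).differentiable (by simp) _).hasDerivAt
    exact h3.comp_const_add (x i) 0
  rw [e1, (h2.mul_const _).deriv, prodFun,
    ← Finset.mul_prod_erase Finset.univ _ (Finset.mem_univ i)]
  congr 1
  · simp
  · refine Finset.prod_congr rfl fun j hj => ?_
    have : j ≠ i := Finset.ne_of_mem_erase hj
    simp [this]

theorem contDiff_iteratedDeriv {g : ℝ → ℂ} (hg : ContDiff ℝ (⊤ : ℕ∞) g) (k : ℕ) :
    ContDiff ℝ (⊤ : ℕ∞) (iteratedDeriv k g) := by
  rw [iteratedDeriv_eq_iterate]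
  exact hg.iterate_deriv k

theorem contDiff_update {g : Fin d → ℝ → ℂ} (hg : ∀ i, ContDiff ℝ (⊤ : ℕ∞) (g i)) (i : Fin d) (k : ℕ) :
    ∀ j, ContDiff ℝ (⊤ : ℕ∞) (Function.update g i (iteratedDeriv k (g i)) j) := by
  intro j
  by_cases h : j = i
  · subst h; simpa using contDiff_iteratedDeriv (hg j) k
  · simpa [h] using hg j

theorem partialD_iterate_prodFun {g : Fin d → ℝ → ℂ} (hg : ∀ i, ContDiff ℝ (⊤ : ℕ∞) (g i)) (i : Fin d)
    (k : ℕ) : (partialD i)^[k] (prodFun g) =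
      prodFun (Function.update g i (iteratedDeriv k (g i))) := by
  induction k with
  | zero => simp
  | succ k ih =>
    rw [Function.iterate_succ_apply', ih, partialD_prodFun (contDiff_update hg i k)]
    simp [iteratedDeriv_succ]

theorem listPartial_prodFun {g : Fin d → ℝ → ℂ} (hg : ∀ i, ContDiff ℝ (⊤ : ℕ∞) (g i)) (α : Fin d → ℕ)
    (l : List (Fin d)) (hl : l.Nodup) : listPartial α l (prodFun g) =
      prodFun (fun i => if i ∈ l then iteratedDeriv (α i) (g i) else g i) := by
  induction l with
  | nil => simp [listPartial]
  | cons i l ih =>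
    obtain ⟨hi, hl'⟩ := List.nodup_cons.1 hl
    change (partialD i)^[α i] (listPartial α l (prodFun g)) = _
    rw [ih hl', partialD_iterate_prodFun]
    · congr 1
      funext j
      by_cases h : j = i
      · subst h; simp [hi]
      · simp [h]
    · intro j
      by_cases h : j ∈ l
      · simpa [h] using contDiff_iteratedDeriv (hg j) _
      · simpa [h] using hg j

theorem iterPartial_prodFun {g : Fin d → ℝ → ℂ} (hg : ∀ i, ContDiff ℝ (⊤ : ℕ∞) (g i)) (α : Fin d → ℕ) :
    iterPartial α (prodFun g) = prodFun (fun i => iteratedDeriv (α i) (g i)) := by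
  rw [iterPartial, listPartial_prodFun hg α _ (List.nodup_finRange d)]
  simp

theorem prodFun_gaussR_mem (a : Fin d → ℂ) : prodFun (fun i => gaussR (a i)) ∈ GS d (1 / 2) := by
  have hg : ∀ i, ContDiff ℝ (⊤ : ℕ∞) (gaussR (a i)) := fun i => contDiff_gaussR (a i)
  refine ⟨contDiff_prodFun hg, Real.exp 3, Real.exp_pos 3,
    (gsNorm_lt_top_iff (Real.exp_pos 3) _).2 ⟨∏ i, Real.exp (3 + 3 * ‖a i‖ ^ 2), ?_⟩⟩
  intro α β x
  have e1 : gsFactor (1 / 2) (Real.exp 3) α β = ∏ i, (Real.exp 3 ^ (α i + β i) *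
      (((α i).factorial : ℝ) * (β i).factorial) ^ (1 / 2 : ℝ)) := by
    rw [gsFactor, Finset.prod_mul_distrib, Finset.prod_pow_eq_pow_sum, Finset.sum_add_distrib,
      Real.finsetProd_rpow _ _ (fun i _ => by positivity), Finset.prod_mul_distrib]
    push_cast
    rfl
  rw [monoDeriv, iterPartial_prodFun hg, prodFun, e1, ← Finset.prod_mul_distrib, norm_prod,
    norm_prod, ← Finset.prod_mul_distrib]
  refine Finset.prod_le_prod (fun i _ => by positivity) fun i _ => ?_
  have := gaussR_bound (a i) (α i) (β i) (x i)
  simpa [norm_pow] using this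

theorem windowShift_mem (x ξ : Rd d) : windowShift x ξ ∈ GS d (1 / 2) := by
  have e : windowShift x ξ = (((Real.pi ^ (-(d : ℝ) / 4) * Real.exp (-‖x‖ ^ 2 / 2) : ℝ)) : ℂ) •
      prodFun (fun i => gaussR ((x i : ℂ) - Complex.I * (ξ i : ℂ))) := by
    funext y
    simp only [windowShift, gaussWindow, Complex.conj_ofReal, Pi.smul_apply, smul_eq_mul, prodFun,
      gaussR, gauss1, ← Complex.exp_sum]
    push_cast
    rw [mul_assoc, mul_assoc, ← Complex.exp_add, ← Complex.exp_add]
    congr 2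
    have h1 : ((‖y - x‖ : ℝ) : ℂ) ^ 2 = ∑ i, ((y i : ℂ) - x i) ^ 2 := by
      rw [← Complex.ofReal_pow, EuclideanSpace.real_norm_sq_eq]
      push_cast
      refine Finset.sum_congr rfl fun i _ => ?_
      simp
    have h2 : ((‖x‖ : ℝ) : ℂ) ^ 2 = ∑ i, (x i : ℂ) ^ 2 := by
      rw [← Complex.ofReal_pow, EuclideanSpace.real_norm_sq_eq]
      push_cast
      rfl
    have h3 : ((inner ℝ y ξ : ℝ) : ℂ) = ∑ i, (y i : ℂ) * ξ i := by
      rw [PiLp.inner_apply]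
      push_cast
      refine Finset.sum_congr rfl fun i _ => ?_
      simp [mul_comm]
    rw [h1, h2, h3, Finset.mul_sum, ← Finset.sum_neg_distrib, ← Finset.sum_neg_distrib,
      Finset.sum_div, Finset.sum_div, ← Finset.sum_add_distrib, ← Finset.sum_add_distrib]
    refine Finset.sum_congr rfl fun i _ => ?_
    ring
  rw [e]
  exact (GS d (1 / 2)).smul_mem _ (prodFun_gaussR_mem _)

/-- The short-time Fourier transform of `f ∈ S_{1/2}'` with Gaussian window `φ`,
`V_φ f (x, ξ) = (2π)^{-d/2} ⟨f, conj (φ(· - x)) e^{-i⟨·, ξ⟩}⟩`. -/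
def stft (f : GSDual d (1 / 2)) (X : R2d d) : ℂ :=
  (((2 * Real.pi) ^ (-(d : ℝ) / 2) : ℝ) : ℂ) *
    f.toLin ⟨windowShift X.fst X.snd, windowShift_mem X.fst X.snd⟩

/-! ### The spaces `Υ` and `M(ω, ℬ)` -/

/-- The space `Υ(ℝ^d)`. -/
def Upsilon (d : ℕ) : Set (GSDual d (1 / 2)) :=
  {f | ∀ ε : ℝ, 0 < ε → ∃ C : ℝ, ∀ X : R2d d,
    ‖stft f X‖ ≤ C * Real.exp (ε * (‖X.fst‖ ^ 2 + ‖X.snd‖ ^ 2))}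

/-- The modulation space `M(ω, ℬ)` with `ℬ = L^p(V)` a mixed quasi-norm space on `ℝ^{2d}`. -/
def modulationSpace (ω : R2d d → ℝ) {n : ℕ} (V : Fin n → Submodule ℝ (R2d d))
    (p : Fin n → ℝ≥0∞) : Set (GSDual d (1 / 2)) :=
  {f | mixedNorm V p (fun X => ‖stft f X * (ω X : ℂ)‖ₑ) < ∞}

end GelfandShilov

end

/-! The growth condition defining Υ is empty. The S_{s,h} norm of the Gaussian window shifted to X =
(x, ξ) is at most C exp(κ(|x|^{1/s} + |ξ|^{1/s})), and κ can be made as small as desired by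
enlarging h (`exists_monoDeriv_windowShift_le`). An element of S_{1/2}' is continuous on S_{1/2,h}
for every h, so its short-time Fourier transform is O(e^{ε|X|²}) for every ε, and Υ is all of
S_{1/2}' (`Upsilon_eq_univ`). It remains to find a weight for each single f. If |V_φ f(X)| ≤ exp(A_k
+ |X|²/(k+1)) for all k, let θ be the infimum of the lines A_k + t/(k+1). The weight exp(-θ(|X|²) -
|X|) is rotation invariant, tames f, and lies in P_Q^0, because θ is 1-Lipschitz and has arbitrarily
small slope at infinity.

For the exponential weights, everything is compared with pointwise bounds of V_φ f. From pointwise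
decay to a finite mixed quasi-norm, polynomial decay of high order suffices
(`mixedNorm_lt_top_of_decay`). In the other direction, V_φ f is, up to an explicit Gaussian factor,
a holomorphic function of x - iξ, as in the Bargmann transform. A maximum argument together with the
Schwarz lemma gives a small ball on which |V_φ f| is bounded below, with control of the radius
(`exists_ball_le_of_line_holomorphic`). Hence the mixed quasi-norm bounds every value of V_φ f
(`exists_norm_stft_mul_le_mixedNorm`), for all exponents p_j > 0 and every order of integration.

Pointwise bounds are translated into Gelfand-Shilov regularity by an analysis-synthesis pair. The
transform of a function in S_s decays like exp(-r(|x|^{1/s} + |ξ|^{1/s}))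
(`exists_norm_analysis_le`). Superpositions of shifted windows with such decay lie in S_s
(`synthesis_mem_GS`), and Fourier inversion shows that synthesis inverts analysis
(`synthesis_analysis`). Distributions pass under the integral once S_{1/2,h} is embedded in a space
of bounded families and the functional is extended by Hahn-Banach (`GSDual.apply_synthesis`). The
loss ε in the exponents absorbs all constants: a strictly larger power dominates any multiple of a
smaller one. -/

noncomputable section

namespace GelfandShilov

/-! ### Scaling and monotonicity of mixed quasi-norms -/

section MixedNorms

/-- No measurability of `G` is available in iterated norms; finiteness of `c` is what allows the
constant out of the integral without it. -/
theorem eLpNorm_ennreal_const_mul {α : Type*} [MeasurableSpace α] {μ : Measure α} {c p : ℝ≥0∞}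
    (hc : c ≠ ∞) (hp : p ≠ 0) (G : α → ℝ≥0∞) :
    eLpNorm (fun t => c * G t) p μ = c * eLpNorm G p μ := by
  by_cases hpt : p = ∞
  · subst hpt
    simp only [eLpNorm_exponent_top, eLpNormEssSup, enorm_eq_self]
    exact ENNReal.essSup_const_mul
  · have hp0 : 0 < p.toReal := ENNReal.toReal_pos hp hpt
    rw [eLpNorm_eq_lintegral_rpow_enorm_toReal hp hpt, eLpNorm_eq_lintegral_rpow_enorm_toReal hp hpt]
    simp only [enorm_eq_self]
    simp_rw [ENNReal.mul_rpow_of_nonneg _ _ hp0.le]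
    rw [lintegral_const_mul' _ _ (ENNReal.rpow_ne_top_of_nonneg hp0.le hc),
      ENNReal.mul_rpow_of_nonneg _ _ (by positivity), ← ENNReal.rpow_mul]
    rw [mul_one_div_cancel hp0.ne', ENNReal.rpow_one]

variable {E : Type*} [NormedAddCommGroup E] [InnerProductSpace ℝ E] [FiniteDimensional ℝ E]
  [MeasurableSpace E] [BorelSpace E]

theorem lpAlong_mono (V : Submodule ℝ E) (p : ℝ≥0∞) {F G : E → ℝ≥0∞} (h : F ≤ G) :
    lpAlong V p F ≤ lpAlong V p G := fun x =>
  eLpNorm_mono_enorm fun t => by simpa using h (x + t)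

theorem mixedNorm_mono {n : ℕ} (V : Fin n → Submodule ℝ E) (p : Fin n → ℝ≥0∞) {F G : E → ℝ≥0∞}
    (h : F ≤ G) : mixedNorm V p F ≤ mixedNorm V p G := by
  unfold mixedNorm
  -- The number of folds is freed from `n` through a reindexing `σ`, so that the last integration
  -- can be peeled off by induction.
  suffices H : ∀ (m : ℕ) (σ : Fin m → Fin n),
      Fin.foldl m (fun G j => lpAlong (V (σ j)) (p (σ j)) G) F ≤
      Fin.foldl m (fun G j => lpAlong (V (σ j)) (p (σ j)) G) G from H n id 0
  intro m
  induction m with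
  | zero => intro σ; simpa using h
  | succ m ih =>
    intro σ
    rw [Fin.foldl_succ_last, Fin.foldl_succ_last]
    exact lpAlong_mono _ _ (ih fun j => σ j.castSucc)

end MixedNorms

/-! ### Components with respect to a direct sum decomposition -/

section Components

variable {E : Type*} [NormedAddCommGroup E] [InnerProductSpace ℝ E] {n : ℕ}
  {V : Fin n → Submodule ℝ E}

/-- The component in `V j` of a vector of `E = V_1 ⊕ ⋯ ⊕ V_n`. -/
def component (hV : DirectSum.IsInternal V) (j : Fin n) : E →ₗ[ℝ] V j :=
  (DirectSum.component ℝ (Fin n) (fun j => V j) j).comp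
    (LinearEquiv.ofBijective (DirectSum.coeLinearMap V) hV).symm.toLinearMap

theorem component_coe_same (hV : DirectSum.IsInternal V) (j : Fin n) (t : V j) :
    component hV j (t : E) = t := hV.ofBijective_coeLinearMap_same t

theorem component_coe_ne (hV : DirectSum.IsInternal V) {i j : Fin n} (hij : i ≠ j) (t : V i) :
    component hV j (t : E) = 0 := hV.ofBijective_coeLinearMap_of_ne hij t

theorem exists_norm_component_le [FiniteDimensional ℝ E] (hV : DirectSum.IsInternal V) :
    ∃ κ : ℝ, 1 ≤ κ ∧ ∀ j x, ‖component hV j x‖ ≤ κ * ‖x‖ := by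
  have h : ∀ j, ∃ κ : ℝ, 0 ≤ κ ∧ ∀ x, ‖component hV j x‖ ≤ κ * ‖x‖ := fun j =>
    ⟨_, norm_nonneg (LinearMap.toContinuousLinearMap (component hV j)),
      (LinearMap.toContinuousLinearMap (component hV j)).le_opNorm⟩
  choose κ h0 h1 using h
  refine ⟨1 + ∑ j, κ j, ?_, fun j x => (h1 j x).trans ?_⟩
  · linarith [Finset.sum_nonneg fun j (_ : j ∈ Finset.univ) => h0 j]
  · have := Finset.single_le_sum (f := κ) (fun i _ => h0 i) (Finset.mem_univ j)
    gcongr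
    linarith

theorem sum_component (hV : DirectSum.IsInternal V) (x : E) :
    ∑ j, (component hV j x : E) = x := by
  classical
  have h := (LinearEquiv.ofBijective (DirectSum.coeLinearMap V) hV).apply_symm_apply x
  replace h : DirectSum.coeLinearMap V
      ((LinearEquiv.ofBijective (DirectSum.coeLinearMap V) hV).symm x) = x := h
  rw [DirectSum.coeLinearMap_eq_dfinsuppSum] at h
  erw [DFinsupp.sum_eq_sum_fintype _ (by simp)] at h
  exact h

end Components

/-! ### Mixed quasi-norms of tensor products, decaying functions and balls -/

section MixedNorms

variable {E : Type*} [NormedAddCommGroup E] [InnerProductSpace ℝ E] [FiniteDimensional ℝ E]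
  [MeasurableSpace E] [BorelSpace E] {n : ℕ} {V : Fin n → Submodule ℝ E}

/-- Moving along V_k changes only the k-th component, and translation invariance on V_k removes the
base point, so each integration turns one factor into a constant. This is the only exact evaluation
of a mixed quasi-norm; the upper and lower estimates below follow from it by monotonicity. -/
theorem mixedNorm_const_mul_prod (hV : DirectSum.IsInternal V) {A : ℝ≥0∞} (hA : A ≠ ∞) {p : Fin n → ℝ≥0∞} (hp : ∀ j, 0 < p j)
    {g : ∀ j, V j → ℝ≥0∞} (hg : ∀ j, Measurable (g j)) (hfin : ∀ j t, g j t ≠ ∞)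
    (hnorm : ∀ j, eLpNorm (g j) (p j) volume ≠ ∞) :
    mixedNorm V p (fun x => A * ∏ j, g j (component hV j x)) =
      A * ∏ j, eLpNorm (g j) (p j) volume := by
  classical
  unfold mixedNorm
  -- After integrating along the subspaces in the image of `σ`, their factors are norms while the
  -- other factors are still functions of the base point. Injectivity ensures that no subspace is
  -- used twice.
  suffices H : ∀ (m : ℕ) (σ : Fin m → Fin n), Function.Injective σ → ∀ x,
      Fin.foldl m (fun G j => lpAlong (V (σ j)) (p (σ j)) G)
        (fun x => A * ∏ j, g j (component hV j x)) x =
      A * (∏ i, eLpNorm (g (σ i)) (p (σ i)) volume) *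
        ∏ j ∈ Finset.univ \ Finset.univ.image σ, g j (component hV j x) by
    have := H n id Function.injective_id 0
    simpa using this
  intro m
  induction m with
  | zero => intro σ _ x; simp
  | succ m ih =>
    intro σ hσ x
    rw [Fin.foldl_succ_last, Fin.prod_univ_castSucc, lpAlong]
    have hσ' : Function.Injective fun j : Fin m => σ j.castSucc :=
      hσ.comp (Fin.castSucc_injective m)
    set k := σ (Fin.last m) with hk
    have hmem : k ∈ Finset.univ \ Finset.univ.image fun j : Fin m => σ j.castSucc := by
      simp only [Finset.mem_sdiff, Finset.mem_univ, true_and, Finset.mem_image, not_exists]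
      intro j hj
      exact (Fin.castSucc_lt_last j).ne (hσ hj)
    have hset : (Finset.univ \ Finset.univ.image fun j : Fin m => σ j.castSucc).erase k =
        Finset.univ \ Finset.univ.image σ := by
      ext j
      simp only [Finset.mem_erase, Finset.mem_sdiff, Finset.mem_univ, true_and, Finset.mem_image,
        not_exists, Fin.forall_fin_succ', hk]
      tauto
    have e1 : (fun t : V k => Fin.foldl m
        (fun G j => lpAlong (V (σ j.castSucc)) (p (σ j.castSucc)) G)
        (fun x => A * ∏ j, g j (component hV j x)) (x + (t : E))) = fun t : V k =>
        (A * (∏ i : Fin m, eLpNorm (g (σ i.castSucc)) (p (σ i.castSucc)) volume) *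
          ∏ j ∈ Finset.univ \ Finset.univ.image σ, g j (component hV j x)) *
          g k (component hV k x + t) := by
      funext t
      rw [ih _ hσ' (x + t), ← hset, ← Finset.prod_erase_mul _ _ hmem, ← mul_assoc]
      congr 1
      congr 1
      · refine Finset.prod_congr rfl fun j hj => ?_
        rw [map_add, component_coe_ne hV (Finset.ne_of_mem_erase hj).symm, add_zero]
      · rw [map_add, component_coe_same]
    rw [e1, eLpNorm_ennreal_const_mul _ (hp k).ne']
    · have h2 : eLpNorm (fun t : V k => g k (component hV k x + t)) (p k) volume =
          eLpNorm (g k) (p k) volume :=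
        eLpNorm_comp_measurePreserving (hg k).aestronglyMeasurable
          (measurePreserving_add_left volume (component hV k x))
      rw [h2]
      ring
    · exact ENNReal.mul_ne_top (ENNReal.mul_ne_top hA (ENNReal.prod_ne_top fun i _ => hnorm _))
        (ENNReal.prod_ne_top fun j _ => hfin _ _)

theorem eLpNorm_ofReal_one_add_norm_pow_ne_top {W : Type*} [NormedAddCommGroup W]
    [InnerProductSpace ℝ W] [FiniteDimensional ℝ W] [MeasurableSpace W] [BorelSpace W]
    {p : ℝ≥0∞} (hp : 0 < p) : ∃ m₀ : ℕ, ∀ m, m₀ ≤ m →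
    eLpNorm (fun t : W => ENNReal.ofReal ((1 + ‖t‖) ^ m)⁻¹) p volume ≠ ∞ := by
  by_cases hpt : p = ∞
  · refine ⟨0, fun m _ => ?_⟩
    subst hpt
    simp only [eLpNorm_exponent_top, eLpNormEssSup, enorm_eq_self]
    refine ne_top_of_le_ne_top ENNReal.one_ne_top (essSup_le_of_ae_le _ (ae_of_all _ fun t => ?_))
    rw [ENNReal.ofReal_le_one]
    exact inv_le_one_of_one_le₀ (one_le_pow₀ (by linarith [norm_nonneg t]))
  · have hp0 : 0 < p.toReal := ENNReal.toReal_pos hp.ne' hpt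
    obtain ⟨m₀, hm₀⟩ := exists_nat_gt ((Module.finrank ℝ W : ℝ) / p.toReal)
    refine ⟨m₀, fun m hm => ?_⟩
    have hm' : (Module.finrank ℝ W : ℝ) < m * p.toReal := by
      rw [div_lt_iff₀ hp0] at hm₀
      refine hm₀.trans_le ?_
      gcongr
    rw [eLpNorm_eq_lintegral_rpow_enorm_toReal hp.ne' hpt]
    refine ENNReal.rpow_ne_top_of_nonneg (by positivity) ?_
    have := finite_integral_one_add_norm (E := W) (μ := volume) hm'
    refine ne_of_eq_of_ne (lintegral_congr fun t => ?_) this.ne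
    have h1 : 0 < 1 + ‖t‖ := by linarith [norm_nonneg t]
    rw [enorm_eq_self, ENNReal.ofReal_rpow_of_nonneg (by positivity) hp0.le]
    congr 1
    rw [Real.rpow_neg h1.le, Real.rpow_mul h1.le, Real.rpow_natCast, Real.inv_rpow (by positivity)]

/-- Functions of sufficiently fast polynomial decay have finite mixed norm. -/
theorem mixedNorm_lt_top_of_decay (hV : DirectSum.IsInternal V) {p : Fin n → ℝ≥0∞}
    (hp : ∀ j, 0 < p j) : ∃ m : ℕ, ∀ (F : E → ℝ≥0∞) (C : ℝ),
    (∀ x, F x ≤ ENNReal.ofReal (C * ((1 + ‖x‖) ^ m)⁻¹)) → mixedNorm V p F < ∞ := by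
  choose m₀ hm₀ using fun j => eLpNorm_ofReal_one_add_norm_pow_ne_top (W := V j) (hp j)
  obtain ⟨κ, hκ, hcomp⟩ := exists_norm_component_le hV
  set M := ∑ j, m₀ j
  have hM : ∀ j, m₀ j ≤ M := fun j =>
    Finset.single_le_sum (f := m₀) (fun _ _ => Nat.zero_le _) (Finset.mem_univ j)
  -- Every component is at most κ|x|, so each of the `n` components can be granted a share of order
  -- `M` of the decay, and `M` suffices for all the exponents at once.
  refine ⟨M * n, fun F C hF => ?_⟩
  set A : ℝ := |C| * (κ ^ (M * n)) with hA
  have key : ∀ x, C * ((1 + ‖x‖) ^ (M * n))⁻¹ ≤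
      A * ∏ j : Fin n, ((1 + ‖component hV j x‖) ^ M)⁻¹ := by
    intro x
    have h1 : ∀ j, ((1 + ‖x‖) ^ M)⁻¹ ≤ κ ^ M * ((1 + ‖component hV j x‖) ^ M)⁻¹ := by
      intro j
      rw [← div_eq_mul_inv, le_div_iff₀ (by positivity), inv_mul_le_iff₀ (by positivity),
        ← mul_pow]
      gcongr
      nlinarith [hcomp j x, norm_nonneg x]
    have h2 : ((1 + ‖x‖) ^ (M * n))⁻¹ ≤
        κ ^ (M * n) * ∏ j : Fin n, ((1 + ‖component hV j x‖) ^ M)⁻¹ := by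
      have := Finset.prod_le_prod (s := (Finset.univ : Finset (Fin n)))
        (fun j _ => by positivity) (fun j _ => h1 j)
      simpa [Finset.prod_mul_distrib, ← pow_mul] using this
    calc C * ((1 + ‖x‖) ^ (M * n))⁻¹ ≤ |C| * ((1 + ‖x‖) ^ (M * n))⁻¹ := by
          gcongr; exact le_abs_self C
      _ ≤ |C| * (κ ^ (M * n) * ∏ j : Fin n, ((1 + ‖component hV j x‖) ^ M)⁻¹) := by gcongr
      _ = _ := by rw [hA]; ring
  have hA0 : 0 ≤ A := by positivity
  have hle : F ≤ fun x => ENNReal.ofReal A *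
      ∏ j, ENNReal.ofReal ((1 + ‖component hV j x‖) ^ M)⁻¹ := by
    intro x
    refine (hF x).trans ((ENNReal.ofReal_le_ofReal (key x)).trans_eq ?_)
    rw [ENNReal.ofReal_mul hA0, ENNReal.ofReal_prod_of_nonneg fun j _ => by positivity]
  refine (mixedNorm_mono V p hle).trans_lt ?_
  rw [mixedNorm_const_mul_prod hV ENNReal.ofReal_ne_top hp
    (g := fun j t => ENNReal.ofReal ((1 + ‖t‖) ^ M)⁻¹) (fun j => by fun_prop)
    (fun j t => ENNReal.ofReal_ne_top) fun j => hm₀ j M (hM j)]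
  exact (ENNReal.mul_ne_top ENNReal.ofReal_ne_top
    (ENNReal.prod_ne_top fun j _ => hm₀ j M (hM j))).lt_top

/-- For finite p the norm is exactly a constant times r^{D/p}, with D the dimension. Since r ≤ 1,
the exponent may be rounded up to an integer, the form needed when these bounds meet the holomorphy
argument. -/
theorem exists_le_eLpNorm_indicator_ball {W : Type*} [NormedAddCommGroup W]
    [InnerProductSpace ℝ W] [FiniteDimensional ℝ W] [MeasurableSpace W] [BorelSpace W]
    {p : ℝ≥0∞} (hp : 0 < p) : ∃ (N : ℕ) (c : ℝ), 0 < c ∧ ∀ (y : W) (r : ℝ), 0 < r → r ≤ 1 →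
    ENNReal.ofReal (c * r ^ N) ≤
        eLpNorm ((Metric.ball y r).indicator fun _ => (1 : ℝ≥0∞)) p volume ∧
      eLpNorm ((Metric.ball y r).indicator fun _ => (1 : ℝ≥0∞)) p volume ≠ ∞ := by
  by_cases hpt : p = ∞
  · subst hpt
    refine ⟨0, 1, one_pos, fun y r hr _ => ?_⟩
    have : eLpNorm ((Metric.ball y r).indicator fun _ => (1 : ℝ≥0∞)) ∞ volume = 1 := by
      rw [eLpNorm_exponent_top, eLpNormEssSup_indicator_const_eq _ _
        (Metric.measure_ball_pos volume y hr).ne']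
      simp
    simp [this]
  · have hp0 : 0 < p.toReal := ENNReal.toReal_pos hp.ne' hpt
    set D := Module.finrank ℝ W
    obtain ⟨N, hN⟩ := exists_nat_ge ((D : ℝ) / p.toReal)
    set v := volume.real (Metric.ball (0 : W) 1) with hv
    have hv0 : 0 < v := ENNReal.toReal_pos (Metric.measure_ball_pos volume _ one_pos).ne'
      measure_ball_lt_top.ne
    refine ⟨N, v ^ (1 / p.toReal), by positivity, fun y r hr hr1 => ?_⟩
    have hnorm : eLpNorm ((Metric.ball y r).indicator fun _ => (1 : ℝ≥0∞)) p volume =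
        ENNReal.ofReal (v ^ (1 / p.toReal) * r ^ (D / p.toReal)) := by
      rw [eLpNorm_indicator_const measurableSet_ball hp.ne' hpt,
        Measure.addHaar_ball_of_pos _ _ hr, enorm_eq_self, one_mul]
      rw [← ENNReal.ofReal_toReal (measure_ball_lt_top (μ := volume) (x := (0 : W)) (r := 1)).ne,
        ← ENNReal.ofReal_mul (by positivity),
        ENNReal.ofReal_rpow_of_nonneg (by positivity) (by positivity)]
      congr 1
      change (r ^ D * v) ^ (1 / p.toReal) = _
      rw [Real.mul_rpow (by positivity) hv0.le, ← Real.rpow_natCast, ← Real.rpow_mul hr.le]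
      ring_nf
    refine ⟨?_, by simp [hnorm]⟩
    rw [hnorm]
    apply ENNReal.ofReal_le_ofReal
    gcongr
    rw [← Real.rpow_natCast]
    exact Real.rpow_le_rpow_of_exponent_ge hr hr1 hN

/-- The mixed norm of the indicator function of a small ball is bounded from below by a power of
the radius. -/
theorem exists_le_mixedNorm_indicator_ball (hV : DirectSum.IsInternal V) {p : Fin n → ℝ≥0∞}
    (hp : ∀ j, 0 < p j) : ∃ (N : ℕ) (c : ℝ), 0 < c ∧ ∀ (y : E) (r a : ℝ), 0 < r → r ≤ 1 → 0 ≤ a →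
    ENNReal.ofReal (a * (c * r ^ N)) ≤
      mixedNorm V p ((Metric.ball y r).indicator fun _ => ENNReal.ofReal a) := by
  choose N c hc h using fun j => exists_le_eLpNorm_indicator_ball (W := V j) (hp j)
  refine ⟨∑ j, N j, ∏ j, (c j * ((n : ℝ) + 1)⁻¹ ^ N j), Finset.prod_pos fun j _ => by
    have := hc j; positivity, fun y r a hr hr1 ha => ?_⟩
  -- If every component of x - y is shorter than ρ then |x - y| ≤ nρ < r, so a product of balls fits
  -- inside the given ball. The shift by one keeps ρ meaningful when n = 0.
  set ρ : ℝ := ((n : ℝ) + 1)⁻¹ * r with hρ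
  have hρ0 : 0 < ρ := by positivity
  have hρ1 : ρ ≤ 1 := mul_le_one₀ (inv_le_one_of_one_le₀ (by simp)) hr.le hr1
  have hle : (fun x => ENNReal.ofReal a * ∏ j, (Metric.ball (component hV j y) ρ).indicator
      (fun _ => (1 : ℝ≥0∞)) (component hV j x)) ≤
      (Metric.ball y r).indicator fun _ => ENNReal.ofReal a := by
    intro x
    by_cases hx : ∀ j, component hV j x ∈ Metric.ball (component hV j y) ρ
    · have hxy : x ∈ Metric.ball y r := by
        rw [mem_ball_iff_norm, ← sum_component hV (x - y)]
        calc ‖∑ j, (component hV j (x - y) : E)‖ ≤ ∑ j, ‖(component hV j (x - y) : E)‖ :=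
              norm_sum_le _ _
          _ ≤ ∑ _j : Fin n, ρ := Finset.sum_le_sum fun j _ => by
              have := hx j
              rw [mem_ball_iff_norm, ← map_sub] at this
              exact this.le
          _ = n * ρ := by simp
          _ < r := by
              rw [hρ, ← mul_assoc, ← div_eq_mul_inv]
              have : (n : ℝ) / (n + 1) < 1 := by rw [div_lt_one (by positivity)]; linarith
              nlinarith
      rw [Set.indicator_of_mem hxy]
      simp [Set.indicator_of_mem (hx _)]
    · push Not at hx
      obtain ⟨j, hj⟩ := hx
      have : ∏ j, (Metric.ball (component hV j y) ρ).indicator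
          (fun _ => (1 : ℝ≥0∞)) (component hV j x) = 0 :=
        Finset.prod_eq_zero (Finset.mem_univ j) (Set.indicator_of_notMem hj _)
      simp only [this, mul_zero, zero_le]
  refine le_trans ?_ (mixedNorm_mono V p hle)
  rw [mixedNorm_const_mul_prod hV ENNReal.ofReal_ne_top hp
    (g := fun j => (Metric.ball (component hV j y) ρ).indicator fun _ => (1 : ℝ≥0∞))
    (fun j => measurable_const.indicator measurableSet_ball)
    (fun j t => by classical rw [Set.indicator_apply]; split_ifs <;> simp) fun j => (h j _ ρ hρ0 hρ1).2,
    ENNReal.ofReal_mul ha]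
  gcongr
  calc ENNReal.ofReal ((∏ j, (c j * ((n : ℝ) + 1)⁻¹ ^ N j)) * r ^ ∑ j, N j)
      = ∏ j, ENNReal.ofReal (c j * ρ ^ N j) := by
        rw [← ENNReal.ofReal_prod_of_nonneg fun j _ => by have := hc j; positivity]
        rw [← Finset.prod_pow_eq_pow_sum, ← Finset.prod_mul_distrib]
        simp only [hρ, mul_pow, mul_assoc]
    _ ≤ _ := Finset.prod_le_prod' fun j _ => (h j _ ρ hρ0 hρ1).1

end MixedNorms

/-! ### Factorials, exponentials and comparison of powers -/

section Elementary

/-- This is w^l / l! ≤ e^w at w = u^{1/s}, raised to the power s. It converts powers into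
Gelfand-Shilov factorials at an exponential cost. -/
theorem pow_le_factorial_rpow_mul_exp {s u : ℝ} (hs : 0 < s) (hu : 0 ≤ u) (l : ℕ) :
    u ^ l ≤ (l.factorial : ℝ) ^ s * Real.exp (s * u ^ (1 / s)) := by
  have hf : (0 : ℝ) < l.factorial := by exact_mod_cast l.factorial_pos
  have h := Real.pow_div_factorial_le_exp (u ^ (1 / s)) (by positivity) l
  rw [div_le_iff₀ hf] at h
  have h2 := Real.rpow_le_rpow (by positivity) h hs.le
  rw [Real.mul_rpow (by positivity) hf.le, ← Real.exp_mul, mul_comm (u ^ (1 / s)) s] at h2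
  calc u ^ l = ((u ^ (1 / s)) ^ l) ^ s := by
        rw [← Real.rpow_natCast, ← Real.rpow_natCast, ← Real.rpow_mul hu, ← Real.rpow_mul hu]
        congr 1; field_simp
    _ ≤ _ := by rw [mul_comm]; exact h2

/-- The converse passage, from factorial bounds on all moments to exponential decay: take s-th roots
and sum the exponential series at w/2, where w = u^{1/s}. The halving produces a geometric series
with sum 2, which is the source of 2^s. -/
theorem mul_exp_le_of_forall_pow_mul_le {s u a C : ℝ} (hs : 0 < s) (hu : 0 ≤ u) (ha : 0 ≤ a)
    (h : ∀ n : ℕ, u ^ n * a ≤ C * (n.factorial : ℝ) ^ s) :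
    a * Real.exp (s / 2 * u ^ (1 / s)) ≤ 2 ^ s * C := by
  have hC : 0 ≤ C := ha.trans (by simpa using h 0)
  rcases ha.eq_or_lt with rfl | ha
  · simp; positivity
  set w := u ^ (1 / s) with hw
  have hw0 : 0 ≤ w := by positivity
  set D := (C / a) ^ (1 / s) with hD
  have h1 : ∀ n : ℕ, (w / 2) ^ n / n.factorial ≤ D * (1 / 2) ^ n := by
    intro n
    have hf : (0 : ℝ) < n.factorial := by exact_mod_cast n.factorial_pos
    have h2 : u ^ n ≤ C / a * (n.factorial : ℝ) ^ s := by
      rw [div_mul_eq_mul_div, le_div_iff₀ ha]; exact h n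
    have h3 := Real.rpow_le_rpow (by positivity) h2 (show (0 : ℝ) ≤ 1 / s by positivity)
    rw [Real.mul_rpow (by positivity) (by positivity), ← Real.rpow_mul hf.le,
      mul_one_div_cancel hs.ne', Real.rpow_one] at h3
    have h4 : (u ^ n) ^ (1 / s) = w ^ n := by
      rw [hw, ← Real.rpow_natCast, ← Real.rpow_natCast, ← Real.rpow_mul hu, ← Real.rpow_mul hu,
        mul_comm]
    rw [h4] at h3
    rw [div_pow, div_div, div_le_iff₀ (by positivity), one_div, inv_pow]
    calc w ^ n ≤ D * n.factorial := h3
      _ = _ := by field_simp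
  have h5 : Real.exp (w / 2) ≤ D * 2 := by
    have e1 := (NormedSpace.expSeries_div_hasSum_exp (w / 2) (𝔸 := ℝ))
    rw [← Real.exp_eq_exp_ℝ] at e1
    exact hasSum_le h1 e1 (hasSum_geometric_two.mul_left D)
  have h6 := Real.rpow_le_rpow (Real.exp_pos _).le h5 hs.le
  rw [← Real.exp_mul, Real.mul_rpow (by positivity) (by norm_num), hD,
    ← Real.rpow_mul (by positivity), one_div_mul_cancel hs.ne', Real.rpow_one] at h6
  calc a * Real.exp (s / 2 * w) = a * Real.exp (w / 2 * s) := by ring_nf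
    _ ≤ a * (C / a * 2 ^ s) := by gcongr
    _ = _ := by field_simp

theorem exists_rpow_le_mul_rpow_add {p q : ℝ} (hp : 0 < p) (hpq : p < q) {δ K : ℝ} (hδ : 0 < δ)
    (hK : 0 ≤ K) : ∃ C : ℝ, ∀ t : ℝ, 0 ≤ t → K * t ^ p ≤ δ * t ^ q + C := by
  -- Here K t^p and δ t^q balance; beyond `T` the larger power wins and before it the left side is
  -- at most K T^p.
  set T := (K / δ) ^ (1 / (q - p)) with hT
  have hqp : 0 < q - p := sub_pos.2 hpq
  have hT0 : 0 ≤ T := by positivity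
  refine ⟨K * T ^ p, fun t ht => ?_⟩
  rcases le_total t T with h | h
  · have : K * t ^ p ≤ K * T ^ p := by gcongr
    have : 0 ≤ δ * t ^ q := by positivity
    linarith
  · have h1 : K / δ ≤ t ^ (q - p) := by
      have := Real.rpow_le_rpow hT0 h hqp.le
      rwa [hT, ← Real.rpow_mul (by positivity), one_div_mul_cancel hqp.ne', Real.rpow_one] at this
    rw [div_le_iff₀ hδ] at h1
    have h2 : t ^ q = t ^ (q - p) * t ^ p := by
      rcases ht.eq_or_lt with rfl | ht
      · rw [Real.zero_rpow (hp.trans hpq).ne', Real.zero_rpow hp.ne', mul_zero]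
      · rw [← Real.rpow_add ht]; ring_nf
    have h3 : K * t ^ p ≤ δ * t ^ q := by
      rw [h2, ← mul_assoc, mul_comm δ]; gcongr
    have : 0 ≤ K * T ^ p := by positivity
    linarith

theorem exists_one_add_pow_le_exp_rpow {r q : ℝ} (hr : 0 < r) (hq : 0 < q) (m : ℕ) :
    ∃ C : ℝ, 0 < C ∧ ∀ t : ℝ, 0 ≤ t → (1 + t) ^ m ≤ C * Real.exp (r * t ^ q) := by
  -- Chosen so that (1/q)(κt)^q = r t^q, the exponent delivered by `pow_le_factorial_rpow_mul_exp`
  -- with s = 1/q.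
  set κ := (r * q) ^ (1 / q) with hκ
  have hκ0 : 0 < κ := by positivity
  refine ⟨2 ^ m * (1 + (κ ^ m)⁻¹ * (m.factorial : ℝ) ^ (1 / q)), by positivity, fun t ht => ?_⟩
  have h1 := pow_le_factorial_rpow_mul_exp (s := 1 / q) (by positivity)
    (show 0 ≤ κ * t by positivity) m
  have h2 : 1 / q * (κ * t) ^ (1 / (1 / q)) = r * t ^ q := by
    rw [one_div_one_div, Real.mul_rpow hκ0.le ht, hκ, ← Real.rpow_mul (by positivity),
      one_div_mul_cancel hq.ne', Real.rpow_one]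
    field_simp
  rw [h2, mul_pow] at h1
  have h3 : t ^ m ≤ (κ ^ m)⁻¹ * (m.factorial : ℝ) ^ (1 / q) * Real.exp (r * t ^ q) := by
    rw [mul_assoc, ← div_eq_inv_mul, le_div_iff₀ (by positivity), mul_comm]
    exact h1
  have h4 : 1 ≤ Real.exp (r * t ^ q) := Real.one_le_exp (by positivity)
  have h5 : (1 + t) ^ m ≤ 2 ^ m * (1 + t ^ m) := by
    rcases le_total t 1 with h | h
    · calc (1 + t) ^ m ≤ 2 ^ m := by gcongr; linarith
        _ ≤ _ := le_mul_of_one_le_right (by positivity) (by linarith [pow_nonneg ht m])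
    · calc (1 + t) ^ m ≤ (2 * t) ^ m := by gcongr; linarith
        _ = 2 ^ m * t ^ m := mul_pow _ _ _
        _ ≤ _ := by gcongr; linarith
  calc (1 + t) ^ m ≤ 2 ^ m * (1 + t ^ m) := h5
    _ ≤ 2 ^ m * (Real.exp (r * t ^ q) +
          (κ ^ m)⁻¹ * (m.factorial : ℝ) ^ (1 / q) * Real.exp (r * t ^ q)) := by gcongr
    _ = _ := by ring

/-- The bound for the largest t_i controls the average. It assembles separate decay in each
coordinate into joint decay; the added one covers an empty index set. -/
theorem le_mul_exp_neg_sum {ι : Type*} [Fintype ι] {A B : ℝ} {t : ι → ℝ} (hB : 0 ≤ B)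
    (ht : ∀ i, 0 ≤ t i) (h0 : A ≤ B) (h : ∀ i, A ≤ B * Real.exp (-t i)) :
    A ≤ B * Real.exp (-((∑ i, t i) / (Fintype.card ι + 1))) := by
  by_cases hι : Nonempty ι
  · obtain ⟨i, hi⟩ := Finite.exists_max t
    refine (h i).trans ?_
    gcongr
    rw [div_le_iff₀ (by positivity)]
    calc ∑ j, t j ≤ ∑ _j : ι, t i := Finset.sum_le_sum fun j _ => hi j
      _ = Fintype.card ι * t i := by simp
      _ ≤ _ := by nlinarith [ht i]
  · have : IsEmpty ι := not_nonempty_iff.1 hι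
    simpa using h0

variable {d : ℕ}

theorem sum_abs_rpow_le (x : Rd d) {q : ℝ} (hq : 0 < q) : ∑ i, |x i| ^ q ≤ d * ‖x‖ ^ q := by
  calc ∑ i, |x i| ^ q ≤ ∑ _i : Fin d, ‖x‖ ^ q := Finset.sum_le_sum fun i _ => by
        gcongr
        exact PiLp.norm_apply_le x i
    _ = _ := by simp

theorem norm_rpow_le_sum (x : Rd d) {q : ℝ} (hq : 0 < q) :
    ‖x‖ ^ q ≤ (d : ℝ) ^ q * ∑ i, |x i| ^ q := by
  rcases Nat.eq_zero_or_pos d with rfl | hd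
  · have : x = 0 := Subsingleton.elim _ _
    simp [this, Real.zero_rpow hq.ne']
  · have : Nonempty (Fin d) := ⟨⟨0, hd⟩⟩
    obtain ⟨i, -, hi⟩ := Finset.exists_max_image Finset.univ (fun i => |x i|) Finset.univ_nonempty
    have h1 : ‖x‖ ≤ d * |x i| := by
      refine abs_le_of_sq_le_sq ?_ (by positivity) |>.trans' (le_abs_self _)
      rw [EuclideanSpace.real_norm_sq_eq]
      have hd1 : (1 : ℝ) ≤ d := by exact_mod_cast hd
      calc ∑ j, x j ^ 2 ≤ ∑ _j : Fin d, |x i| ^ 2 := Finset.sum_le_sum fun j _ => by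
            rw [sq_abs]; exact sq_le_sq.2 (hi j (Finset.mem_univ j))
        _ = d * |x i| ^ 2 := by simp
        _ ≤ (d * |x i|) ^ 2 := by rw [mul_pow]; gcongr; nlinarith
    calc ‖x‖ ^ q ≤ (d * |x i|) ^ q := by gcongr
      _ = (d : ℝ) ^ q * |x i| ^ q := Real.mul_rpow (by positivity) (abs_nonneg _)
      _ ≤ _ := by
        gcongr
        exact Finset.single_le_sum (f := fun i => |x i| ^ q) (fun _ _ => by positivity)
          (Finset.mem_univ i)

/-- Shorthand for `|x|^q + |ξ|^q`. -/
def phaseRpow (q : ℝ) (X : R2d d) : ℝ := ‖X.fst‖ ^ q + ‖X.snd‖ ^ q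

theorem phaseRpow_nonneg (q : ℝ) (X : R2d d) : 0 ≤ phaseRpow q X := by
  unfold phaseRpow; positivity

theorem continuous_phaseRpow {q : ℝ} (hq : 0 < q) :
    Continuous (phaseRpow q : R2d d → ℝ) := by
  unfold phaseRpow
  have h1 : Continuous fun X : R2d d => X.fst := WithLp.continuous_fst 2 _ _
  have h2 : Continuous fun X : R2d d => X.snd := WithLp.continuous_snd 2 _ _
  exact (h1.norm.rpow_const fun _ => Or.inr hq.le).add (h2.norm.rpow_const fun _ => Or.inr hq.le)

theorem exists_exp_phaseRpow_le {r q : ℝ} (hr : 0 < r) (hq : 0 < q) (m : ℕ) :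
    ∃ C : ℝ, 0 < C ∧ ∀ X : R2d d,
      Real.exp (-(r * phaseRpow q X)) ≤ C * ((1 + ‖X‖) ^ m)⁻¹ := by
  obtain ⟨C, hC, h⟩ := exists_one_add_pow_le_exp_rpow hr hq m
  refine ⟨C * C, by positivity, fun X => ?_⟩
  have h1 : ‖X‖ ≤ ‖X.fst‖ + ‖X.snd‖ := by
    refine abs_le_of_sq_le_sq ?_ (by positivity) |>.trans' (le_abs_self _)
    rw [WithLp.prod_norm_sq_eq_of_L2]
    nlinarith [norm_nonneg X.fst, norm_nonneg X.snd]
  rw [Real.exp_neg, ← div_eq_mul_inv, le_div_iff₀ (by positivity), inv_mul_le_iff₀ (by positivity)]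
  calc (1 + ‖X‖) ^ m ≤ ((1 + ‖X.fst‖) * (1 + ‖X.snd‖)) ^ m := by
        gcongr
        nlinarith [norm_nonneg X.fst, norm_nonneg X.snd]
    _ ≤ (C * Real.exp (r * ‖X.fst‖ ^ q)) * (C * Real.exp (r * ‖X.snd‖ ^ q)) := by
        rw [mul_pow]
        gcongr
        · exact h _ (norm_nonneg _)
        · exact h _ (norm_nonneg _)
    _ = _ := by rw [phaseRpow, mul_add, Real.exp_add]; ring

theorem integrable_exp_neg_phaseRpow {r q : ℝ} (hr : 0 < r) (hq : 0 < q) :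
    Integrable fun X : R2d d => Real.exp (-(r * phaseRpow q X)) := by
  obtain ⟨C, hC, h⟩ := exists_exp_phaseRpow_le (d := d) hr hq (Module.finrank ℝ (R2d d) + 1)
  have h1 := (integrable_one_add_norm (E := R2d d) (μ := volume)
    (r := (Module.finrank ℝ (R2d d) + 1 : ℕ)) (by push_cast; linarith)).const_mul C
  refine h1.mono' ?_ (ae_of_all _ fun X => ?_)
  · exact (Real.continuous_exp.comp ((continuous_phaseRpow hq).const_mul r).neg).aestronglyMeasurable
  · rw [Real.norm_of_nonneg (Real.exp_pos _).le, Real.rpow_neg (by positivity), Real.rpow_natCast]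
    exact h X

/-- This is where the strict gap between exponents is used: it lets rates such as `c` or powers of
two be replaced by arbitrarily small ones. -/
theorem exists_phaseRpow_le {p q : ℝ} (hp : 0 < p) (hpq : p < q) {δ K : ℝ} (hδ : 0 < δ)
    (hK : 0 ≤ K) : ∃ C : ℝ, ∀ X : R2d d, K * phaseRpow p X ≤ δ * phaseRpow q X + C := by
  obtain ⟨C, hC⟩ := exists_rpow_le_mul_rpow_add hp hpq hδ hK
  refine ⟨C + C, fun X => ?_⟩
  have h1 := hC _ (norm_nonneg X.fst)
  have h2 := hC _ (norm_nonneg X.snd)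
  unfold phaseRpow
  linarith [mul_add K (‖X.fst‖ ^ p) (‖X.snd‖ ^ p), mul_add δ (‖X.fst‖ ^ q) (‖X.snd‖ ^ q)]

end Elementary

/-! ### Seminorms of time-frequency shifts of the Gaussian -/

section WindowBounds

/-- The one-dimensional function `t ↦ e^{-(t-x)²/2} e^{-itξ}`. -/
def shiftR (x ξ t : ℝ) : ℂ := gaussR 0 (t - x) * Complex.exp ((-Complex.I * ξ) * t)

theorem contDiff_cexp_mul (c : ℂ) : ContDiff ℝ (⊤ : ℕ∞) fun t : ℝ => Complex.exp (c * t) :=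
  (contDiff_const.mul Complex.ofRealCLM.contDiff).cexp

theorem iteratedDeriv_cexp_mul (c : ℂ) (n : ℕ) (t : ℝ) :
    iteratedDeriv n (fun t : ℝ => Complex.exp (c * t)) t = c ^ n * Complex.exp (c * t) := by
  induction n generalizing t with
  | zero => simp
  | succ n ih =>
    rw [iteratedDeriv_succ, funext ih]
    have h : HasDerivAt (fun t : ℝ => Complex.exp (c * t)) (Complex.exp (c * t) * (c * 1)) t :=
      ((Complex.ofRealCLM.hasDerivAt (x := t)).const_mul c).cexp
    rw [(h.const_mul (c ^ n)).deriv]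
    ring

theorem contDiff_gaussR_sub (x : ℝ) : ContDiff ℝ (⊤ : ℕ∞) fun t : ℝ => gaussR 0 (t - x) :=
  (contDiff_gaussR 0).comp (contDiff_id.sub contDiff_const)

theorem contDiff_shiftR (x ξ : ℝ) : ContDiff ℝ (⊤ : ℕ∞) (shiftR x ξ) :=
  (contDiff_gaussR_sub x).mul (contDiff_cexp_mul _)

theorem iteratedDeriv_shiftR (x ξ : ℝ) (n : ℕ) (t : ℝ) :
    iteratedDeriv n (shiftR x ξ) t = ∑ j ∈ Finset.range (n + 1),
      (n.choose j : ℂ) * iteratedDeriv j (gaussR 0) (t - x) *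
        ((-Complex.I * ξ) ^ (n - j) * Complex.exp ((-Complex.I * ξ) * t)) := by
  unfold shiftR
  rw [iteratedDeriv_fun_mul
    ((contDiff_gaussR_sub x).contDiffAt.of_le (by exact_mod_cast le_top))
    ((contDiff_cexp_mul _).contDiffAt.of_le (by exact_mod_cast le_top))]
  simp_rw [iteratedDeriv_comp_sub_const, iteratedDeriv_cexp_mul]

theorem abs_pow_mul_le_factorial {s η u : ℝ} (hs : 1 / 2 ≤ s) (hη : 0 < η) (m : ℕ) :
    |u| ^ m ≤ η ^ m * (m.factorial : ℝ) ^ s * Real.exp (s * (|u| / η) ^ (1 / s)) := by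
  have h := pow_le_factorial_rpow_mul_exp (by linarith : 0 < s) (show 0 ≤ |u| / η by positivity) m
  rw [div_pow, div_le_iff₀ (by positivity)] at h
  linarith

/-- Write t = (t - x) + x in the power and apply the Leibniz rule to the derivative. Powers of x and
ξ are traded for factorials at scale η, the centred Gaussian contributes scale e³, and l!(k-l)! ≤ k!
recombines the factorials. The binomial sums then give η + e³. A large η makes the exponential
growth slow at the price of a large h; s ≥ 1/2 is needed for the Gaussian factor. -/
theorem shiftR_bound {s η : ℝ} (hs : 1 / 2 ≤ s) (hη : 0 < η) (x ξ : ℝ) (n k : ℕ) (t : ℝ) :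
    |t| ^ k * ‖iteratedDeriv n (shiftR x ξ) t‖ ≤
      Real.exp 3 * ((η + Real.exp 3) ^ (n + k) * ((n.factorial : ℝ) * k.factorial) ^ s) *
        Real.exp (s * (|x| / η) ^ (1 / s) + s * (|ξ| / η) ^ (1 / s)) := by
  set H := Real.exp 3 with hH
  have hH0 : 0 < H := Real.exp_pos 3
  set Ex := Real.exp (s * (|x| / η) ^ (1 / s)) with hEx
  set Eξ := Real.exp (s * (|ξ| / η) ^ (1 / s)) with hEξ
  have h1 : |t| ^ k ≤ ∑ l ∈ Finset.range (k + 1), |t - x| ^ l * |x| ^ (k - l) * (k.choose l) := by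
    rw [← add_pow]
    gcongr
    simpa using abs_add_le (t - x) x
  have h2 : ‖iteratedDeriv n (shiftR x ξ) t‖ ≤ ∑ j ∈ Finset.range (n + 1),
      (n.choose j : ℝ) * ‖iteratedDeriv j (gaussR 0) (t - x)‖ * |ξ| ^ (n - j) := by
    rw [iteratedDeriv_shiftR]
    refine (norm_sum_le _ _).trans_eq (Finset.sum_congr rfl fun j _ => ?_)
    rw [norm_mul, norm_mul, norm_mul, norm_pow, norm_mul, Complex.norm_natCast, norm_neg,
      Complex.norm_I, Complex.norm_real, Complex.norm_exp, one_mul]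
    simp
  have hfac : ∀ {m l : ℕ}, l ≤ m → ((l.factorial : ℝ) * (m - l).factorial) ^ s ≤
      (m.factorial : ℝ) ^ s := by
    intro m l hl
    have : (l.factorial * (m - l).factorial : ℕ) ≤ m.factorial :=
      Nat.le_of_dvd m.factorial_pos (Nat.factorial_mul_factorial_dvd_factorial hl)
    have : ((l.factorial * (m - l).factorial : ℕ) : ℝ) ≤ m.factorial := by exact_mod_cast this
    push_cast at this
    exact Real.rpow_le_rpow (by positivity) this (by linarith)
  have hterm : ∀ l ∈ Finset.range (k + 1), ∀ j ∈ Finset.range (n + 1),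
      (|t - x| ^ l * |x| ^ (k - l) * (k.choose l)) *
        ((n.choose j : ℝ) * ‖iteratedDeriv j (gaussR 0) (t - x)‖ * |ξ| ^ (n - j)) ≤
      (H * ((n.factorial : ℝ) * k.factorial) ^ s * (Ex * Eξ)) *
        ((H ^ l * η ^ (k - l) * (k.choose l)) * (H ^ j * η ^ (n - j) * (n.choose j))) := by
    intro l hl j hj
    have hl' : l ≤ k := Nat.lt_succ_iff.1 (Finset.mem_range.1 hl)
    have hj' : j ≤ n := Nat.lt_succ_iff.1 (Finset.mem_range.1 hj)
    have hg : |t - x| ^ l * ‖iteratedDeriv j (gaussR 0) (t - x)‖ ≤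
        H * (H ^ (j + l) * ((j.factorial : ℝ) * l.factorial) ^ s) := by
      have := gaussR_bound 0 j l (t - x)
      simp only [norm_zero, ne_eq, OfNat.ofNat_ne_zero, not_false_eq_true, zero_pow, mul_zero,
        add_zero] at this
      refine this.trans ?_
      gcongr
      have h : 1 ≤ j.factorial * l.factorial := Nat.mul_pos j.factorial_pos l.factorial_pos
      exact_mod_cast h
    have hx := abs_pow_mul_le_factorial (u := x) hs hη (k - l)
    have hξ := abs_pow_mul_le_factorial (u := ξ) hs hη (n - j)
    calc (|t - x| ^ l * |x| ^ (k - l) * (k.choose l)) *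
        ((n.choose j : ℝ) * ‖iteratedDeriv j (gaussR 0) (t - x)‖ * |ξ| ^ (n - j))
        = (|t - x| ^ l * ‖iteratedDeriv j (gaussR 0) (t - x)‖) * |x| ^ (k - l) * |ξ| ^ (n - j) *
          ((k.choose l) * (n.choose j)) := by ring
      _ ≤ (H * (H ^ (j + l) * ((j.factorial : ℝ) * l.factorial) ^ s)) *
          (η ^ (k - l) * ((k - l).factorial : ℝ) ^ s * Ex) *
          (η ^ (n - j) * ((n - j).factorial : ℝ) ^ s * Eξ) * ((k.choose l) * (n.choose j)) := by
          gcongr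
      _ = (((j.factorial : ℝ) * (n - j).factorial) ^ s *
            ((l.factorial : ℝ) * (k - l).factorial) ^ s) * (H * (Ex * Eξ) *
          ((H ^ l * η ^ (k - l) * (k.choose l)) * (H ^ j * η ^ (n - j) * (n.choose j)))) := by
          rw [Real.mul_rpow (by positivity) (by positivity),
            Real.mul_rpow (by positivity) (by positivity),
            Real.mul_rpow (by positivity) (by positivity), pow_add]
          ring
      _ ≤ ((n.factorial : ℝ) ^ s * (k.factorial : ℝ) ^ s) * (H * (Ex * Eξ) *
          ((H ^ l * η ^ (k - l) * (k.choose l)) * (H ^ j * η ^ (n - j) * (n.choose j)))) := by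
          gcongr ?_ * ?_ * _
          · exact hfac hj'
          · exact hfac hl'
      _ = _ := by rw [Real.mul_rpow (by positivity) (by positivity)]; ring
  calc |t| ^ k * ‖iteratedDeriv n (shiftR x ξ) t‖
      ≤ (∑ l ∈ Finset.range (k + 1), |t - x| ^ l * |x| ^ (k - l) * (k.choose l)) *
        ∑ j ∈ Finset.range (n + 1),
          (n.choose j : ℝ) * ‖iteratedDeriv j (gaussR 0) (t - x)‖ * |ξ| ^ (n - j) :=
        mul_le_mul h1 h2 (norm_nonneg _) (Finset.sum_nonneg fun _ _ => by positivity)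
    _ ≤ ∑ l ∈ Finset.range (k + 1), ∑ j ∈ Finset.range (n + 1),
        (H * ((n.factorial : ℝ) * k.factorial) ^ s * (Ex * Eξ)) *
        ((H ^ l * η ^ (k - l) * (k.choose l)) * (H ^ j * η ^ (n - j) * (n.choose j))) := by
      rw [Finset.sum_mul_sum]
      exact Finset.sum_le_sum fun l hl => Finset.sum_le_sum fun j hj => hterm l hl j hj
    _ = (H * ((n.factorial : ℝ) * k.factorial) ^ s * (Ex * Eξ)) *
        ((∑ l ∈ Finset.range (k + 1), H ^ l * η ^ (k - l) * (k.choose l)) *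
          ∑ j ∈ Finset.range (n + 1), H ^ j * η ^ (n - j) * (n.choose j)) := by
      rw [Finset.sum_mul_sum, Finset.mul_sum]
      simp_rw [Finset.mul_sum]
    _ = _ := by
      rw [← add_pow, ← add_pow, Real.exp_add, add_comm H η, pow_add]
      ring

variable {d : ℕ}

theorem windowShift_eq_smul_prodFun_shiftR (x ξ : Rd d) :
    windowShift x ξ = ((Real.pi ^ (-(d : ℝ) / 4) : ℝ) : ℂ) •
      prodFun (fun i => shiftR (x i) (ξ i)) := by
  funext y
  simp only [windowShift, gaussWindow, Complex.conj_ofReal, Pi.smul_apply, smul_eq_mul, prodFun,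
    shiftR, gaussR, gauss1, Finset.prod_mul_distrib, ← Complex.exp_sum]
  push_cast
  rw [mul_assoc]
  congr 3
  · have h1 : ((‖y - x‖ : ℝ) : ℂ) ^ 2 = ∑ i, ((y i : ℂ) - x i) ^ 2 := by
      rw [← Complex.ofReal_pow, EuclideanSpace.real_norm_sq_eq]
      push_cast
      refine Finset.sum_congr rfl fun i _ => ?_
      simp
    rw [h1, ← Finset.sum_neg_distrib, Finset.sum_div]
    refine Finset.sum_congr rfl fun i _ => ?_
    ring
  · rw [PiLp.inner_apply]
    push_cast
    rw [Finset.mul_sum]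
    refine Finset.sum_congr rfl fun i _ => ?_
    simp [mul_assoc]

theorem iterPartial_windowShift (x ξ : Rd d) (α : Fin d → ℕ) :
    iterPartial α (windowShift x ξ) = ((Real.pi ^ (-(d : ℝ) / 4) : ℝ) : ℂ) •
      prodFun (fun i => iteratedDeriv (α i) (shiftR (x i) (ξ i))) := by
  have hg : ∀ i, ContDiff ℝ (⊤ : ℕ∞) (shiftR (x i) (ξ i)) := fun i => contDiff_shiftR _ _
  rw [windowShift_eq_smul_prodFun_shiftR, iterPartial, listPartial_smul _ (contDiff_prodFun hg),
    ← iterPartial, iterPartial_prodFun hg]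

theorem gsFactor_eq_prod (s h : ℝ) (α β : Fin d → ℕ) :
    gsFactor s h α β =
      ∏ i, (h ^ (α i + β i) * (((α i).factorial : ℝ) * (β i).factorial) ^ s) := by
  rw [gsFactor, Finset.prod_mul_distrib, Finset.prod_pow_eq_pow_sum, Finset.sum_add_distrib,
    Real.finsetProd_rpow _ _ (fun i _ => by positivity), Finset.prod_mul_distrib]
  push_cast
  rfl

/-- The growth of the Gelfand-Shilov seminorms of the time-frequency shifts of the window. -/
theorem exists_monoDeriv_windowShift_le {s κ : ℝ} (hs : 1 / 2 ≤ s) (hκ : 0 < κ) (h₀ : ℝ) :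
    ∃ h C : ℝ, h₀ ≤ h ∧ 0 < h ∧ 0 < C ∧ ∀ (X : R2d d) (α β : Fin d → ℕ) (y : Rd d),
      monoDeriv (windowShift X.fst X.snd) α β y ≤
        C * gsFactor s h α β * Real.exp (κ * phaseRpow (1 / s) X) := by
  have hs0 : 0 < s := by linarith
  -- The sum over coordinates costs s·d / η^{1/s}, which this choice makes at most κ. The added one
  -- keeps `η₀` positive for d = 0, and the maximum with `h₀` lets the caller demand a large h.
  set η₀ : ℝ := ((s * d + 1) / κ) ^ s with hη₀
  have hη₀0 : 0 < η₀ := by positivity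
  set η := max η₀ h₀ with hη
  have hη0 : 0 < η := lt_max_of_lt_left hη₀0
  refine ⟨η + Real.exp 3, Real.pi ^ (-(d : ℝ) / 4) * Real.exp 3 ^ d,
    (le_max_right _ _).trans (le_add_of_nonneg_right (Real.exp_pos _).le), by positivity,
    by positivity, fun X α β y => ?_⟩
  have hb : ∀ u : Rd d, ∑ i, s * (|u i| / η) ^ (1 / s) ≤ κ * ‖u‖ ^ (1 / s) := by
    intro u
    have h1 := sum_abs_rpow_le u (show 0 < 1 / s by positivity)
    have h2 : (s * d + 1) / κ ≤ η ^ (1 / s) := by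
      have : η₀ ^ (1 / s) ≤ η ^ (1 / s) := by gcongr; exact le_max_left _ _
      rwa [hη₀, ← Real.rpow_mul (by positivity), mul_one_div_cancel hs0.ne', Real.rpow_one] at this
    rw [div_le_iff₀ hκ] at h2
    have h3 : ∑ i, s * (|u i| / η) ^ (1 / s) = s * (∑ i, |u i| ^ (1 / s)) / η ^ (1 / s) := by
      rw [mul_div_assoc, Finset.sum_div, Finset.mul_sum]
      refine Finset.sum_congr rfl fun i _ => ?_
      rw [Real.div_rpow (abs_nonneg _) hη0.le]
    rw [h3, div_le_iff₀ (by positivity)]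
    have h4 : 0 ≤ ‖u‖ ^ (1 / s) := by positivity
    calc s * ∑ i, |u i| ^ (1 / s) ≤ s * (d * ‖u‖ ^ (1 / s)) := by gcongr
      _ ≤ (η ^ (1 / s) * κ) * ‖u‖ ^ (1 / s) := by nlinarith
      _ = _ := by ring
  have hpi : (0 : ℝ) < Real.pi ^ (-(d : ℝ) / 4) := by positivity
  calc monoDeriv (windowShift X.fst X.snd) α β y
      = Real.pi ^ (-(d : ℝ) / 4) * ∏ i, (|y i| ^ β i *
          ‖iteratedDeriv (α i) (shiftR (X.fst i) (X.snd i)) (y i)‖) := by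
        rw [monoDeriv, iterPartial_windowShift, Pi.smul_apply, norm_smul, prodFun, norm_prod,
          norm_prod, Complex.norm_real, Real.norm_of_nonneg hpi.le, Finset.prod_mul_distrib]
        simp only [norm_pow, Real.norm_eq_abs]
        ring
    _ ≤ Real.pi ^ (-(d : ℝ) / 4) * ∏ i, (Real.exp 3 * ((η + Real.exp 3) ^ (α i + β i) *
          (((α i).factorial : ℝ) * (β i).factorial) ^ s) *
          Real.exp (s * (|X.fst i| / η) ^ (1 / s) + s * (|X.snd i| / η) ^ (1 / s))) := by
        refine mul_le_mul_of_nonneg_left (Finset.prod_le_prod (fun i _ => by positivity)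
          fun i _ => ?_) hpi.le
        exact shiftR_bound hs hη0 _ _ _ _ _
    _ = Real.pi ^ (-(d : ℝ) / 4) * Real.exp 3 ^ d * gsFactor s (η + Real.exp 3) α β *
          Real.exp (∑ i, s * (|X.fst i| / η) ^ (1 / s) +
            ∑ i, s * (|X.snd i| / η) ^ (1 / s)) := by
        rw [gsFactor_eq_prod, Finset.prod_mul_distrib, Finset.prod_mul_distrib,
          Finset.prod_const, ← Real.exp_sum Finset.univ fun i =>
            s * (|X.fst i| / η) ^ (1 / s) + s * (|X.snd i| / η) ^ (1 / s),
          Finset.sum_add_distrib, Finset.card_univ, Fintype.card_fin]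
        ring
    _ ≤ _ := by
        have := gsFactor_pos (s := s) (show 0 < η + Real.exp 3 by positivity) α β
        gcongr
        rw [phaseRpow, mul_add]
        exact add_le_add (hb _) (hb _)

end WindowBounds

/-! ### Decay of the transform of a Gelfand-Shilov function -/

section Decay

variable {d : ℕ}

/-- The integral `∫ φ(y) φ₀(y - x) e^{i⟨y, ξ⟩} dy` of `φ` against the conjugate of a time-frequency
shift of the Gaussian window. -/
def analysis (φ : Rd d → ℂ) (X : R2d d) : ℂ := ∫ y, φ y * windowShift X.fst (-X.snd) y

theorem listPartial_single (i : Fin d) (j : ℕ) (f : Rd d → ℂ) (l : List (Fin d)) (hl : l.Nodup) :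
    listPartial (Pi.single i j) l f = if i ∈ l then (partialD i)^[j] f else f := by
  induction l with
  | nil => simp [listPartial]
  | cons a l ih =>
    obtain ⟨ha, hl'⟩ := List.nodup_cons.1 hl
    change (partialD a)^[(Pi.single i j : Fin d → ℕ) a] (listPartial (Pi.single i j) l f) = _
    rw [ih hl']
    by_cases h : i = a
    · subst h; simp [ha]
    · simp [h]

theorem iterPartial_single (i : Fin d) (j : ℕ) (f : Rd d → ℂ) :
    iterPartial (Pi.single i j) f = (partialD i)^[j] f := by
  rw [iterPartial, listPartial_single i j f _ (List.nodup_finRange d)]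
  simp

theorem iterPartial_zero (f : Rd d → ℂ) : iterPartial 0 f = f := by
  rcases Nat.eq_zero_or_pos d with rfl | hd
  · rfl
  · simpa using iterPartial_single ⟨0, hd⟩ 0 f

theorem prod_factorial_single (i : Fin d) (j : ℕ) :
    ∏ k, ((Pi.single i j : Fin d → ℕ) k).factorial = j.factorial := by
  rw [Finset.prod_eq_single i]
  · simp
  · intro b _ hb; simp [hb]
  · simp

theorem prod_pow_single (i : Fin d) (j : ℕ) (y : Rd d) :
    ∏ k, y k ^ (Pi.single i j : Fin d → ℕ) k = y i ^ j := by
  rw [Finset.prod_eq_single i]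
  · simp
  · intro b _ hb; simp [hb]
  · simp

theorem gsFactor_single_left (s h : ℝ) (i : Fin d) (j : ℕ) :
    gsFactor s h (Pi.single i j) 0 = h ^ j * (j.factorial : ℝ) ^ s := by
  simp only [gsFactor, prod_factorial_single]
  simp

theorem gsFactor_single_right (s h : ℝ) (i : Fin d) (j : ℕ) :
    gsFactor s h 0 (Pi.single i j) = h ^ j * (j.factorial : ℝ) ^ s := by
  simp only [gsFactor, prod_factorial_single]
  simp

theorem nonneg_of_monoDeriv_le {φ : Rd d → ℂ} {s h B : ℝ}
    (hB : ∀ α β y, monoDeriv φ α β y ≤ B * gsFactor s h α β) : 0 ≤ B := by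
  have h1 := hB 0 0 0
  have h2 : gsFactor s h (0 : Fin d → ℕ) 0 = 1 := by simp [gsFactor]
  rw [h2, mul_one] at h1
  exact le_trans (by unfold monoDeriv; positivity) h1

theorem norm_partialD_iterate_le {φ : Rd d → ℂ} {s h B : ℝ}
    (hB : ∀ α β y, monoDeriv φ α β y ≤ B * gsFactor s h α β) (i : Fin d) (j : ℕ) (y : Rd d) :
    ‖(partialD i)^[j] φ y‖ ≤ B * (h ^ j * (j.factorial : ℝ) ^ s) := by
  have h1 := hB (Pi.single i j) 0 y
  rw [gsFactor_single_left, monoDeriv, iterPartial_single] at h1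
  simpa using h1

theorem abs_pow_mul_norm_le {φ : Rd d → ℂ} {s h B : ℝ}
    (hB : ∀ α β y, monoDeriv φ α β y ≤ B * gsFactor s h α β) (i : Fin d) (k : ℕ) (y : Rd d) :
    |y i| ^ k * ‖φ y‖ ≤ B * (h ^ k * (k.factorial : ℝ) ^ s) := by
  have h1 := hB 0 (Pi.single i k) y
  rw [gsFactor_single_right, monoDeriv, prod_pow_single, iterPartial_zero] at h1
  simpa using h1

theorem norm_le_of_monoDeriv_le {φ : Rd d → ℂ} {s h B : ℝ}
    (hB : ∀ α β y, monoDeriv φ α β y ≤ B * gsFactor s h α β) (y : Rd d) : ‖φ y‖ ≤ B := by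
  have h1 := hB 0 0 y
  have h2 : gsFactor s h (0 : Fin d → ℕ) 0 = 1 := by simp [gsFactor]
  rw [h2, mul_one, monoDeriv, iterPartial_zero] at h1
  simpa using h1

/-- Polynomial decay of the partial derivatives of Gelfand-Shilov functions. -/
theorem exists_one_add_norm_pow_mul_le (s : ℝ) {h : ℝ} (hh : 0 < h) (m : ℕ) :
    ∃ C : ℝ, 0 < C ∧ ∀ (φ : Rd d → ℂ) (B : ℝ),
      (∀ α β y, monoDeriv φ α β y ≤ B * gsFactor s h α β) → ∀ (α : Fin d → ℕ) (y : Rd d),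
      (1 + ‖y‖) ^ (m + 1) * ‖iterPartial α φ y‖ ≤ C * (B * gsFactor s h α 0) := by
  set M : ℝ := h ^ (m + 1) * ((m + 1).factorial : ℝ) ^ s
  refine ⟨2 ^ (m + 1) * (1 + (d : ℝ) ^ (m + 1) * (d * M)), by positivity, fun φ B hB α y => ?_⟩
  set D := ‖iterPartial α φ y‖ with hD
  have h0 : D ≤ B * gsFactor s h α 0 := by simpa [monoDeriv] using hB α 0 y
  have h1 : ∀ i, |y i| ^ (m + 1) * D ≤ B * gsFactor s h α 0 * M := by
    intro i
    have h2 := hB α (Pi.single i (m + 1)) y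
    have h3 : gsFactor s h α (Pi.single i (m + 1)) = gsFactor s h α 0 * M := by
      simp only [gsFactor, prod_factorial_single]
      simp only [Pi.zero_apply, Finset.sum_const_zero, add_zero, Nat.factorial_zero,
        Finset.prod_const_one, mul_one, Finset.sum_pi_single', Finset.mem_univ, if_true]
      push_cast
      rw [Real.mul_rpow (by positivity) (by positivity), pow_add]
      ring
    rw [h3, monoDeriv, prod_pow_single] at h2
    simpa [mul_assoc] using h2
  have h2 : (1 + ‖y‖) ^ (m + 1) ≤ 2 ^ (m + 1) * (1 + ‖y‖ ^ (m + 1)) := by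
    have ht := norm_nonneg y
    rcases le_total ‖y‖ 1 with h | h
    · calc (1 + ‖y‖) ^ (m + 1) ≤ 2 ^ (m + 1) := by gcongr; linarith
        _ ≤ _ := le_mul_of_one_le_right (by positivity) (by linarith [pow_nonneg ht (m + 1)])
    · calc (1 + ‖y‖) ^ (m + 1) ≤ (2 * ‖y‖) ^ (m + 1) := by gcongr; linarith
        _ = 2 ^ (m + 1) * ‖y‖ ^ (m + 1) := mul_pow _ _ _
        _ ≤ _ := by gcongr; linarith
  have h3 : ‖y‖ ^ (m + 1) ≤ (d : ℝ) ^ (m + 1) * ∑ i, |y i| ^ (m + 1) := by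
    have := norm_rpow_le_sum y (q := (m + 1 : ℕ)) (by positivity)
    simpa only [Real.rpow_natCast] using this
  calc (1 + ‖y‖) ^ (m + 1) * D
      ≤ 2 ^ (m + 1) * (1 + (d : ℝ) ^ (m + 1) * ∑ i, |y i| ^ (m + 1)) * D := by
        have : 0 ≤ D := norm_nonneg _
        gcongr
        exact h2.trans (by gcongr)
    _ = 2 ^ (m + 1) * (D + (d : ℝ) ^ (m + 1) * ∑ i, |y i| ^ (m + 1) * D) := by
        rw [← Finset.sum_mul]; ring
    _ ≤ 2 ^ (m + 1) * (B * gsFactor s h α 0 +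
          (d : ℝ) ^ (m + 1) * ∑ _i : Fin d, B * gsFactor s h α 0 * M) := by
        gcongr ?_ * (?_ + _ * ?_)
        exact Finset.sum_le_sum fun i _ => h1 i
    _ = _ := by
        rw [Finset.sum_const, Finset.card_univ, Fintype.card_fin, nsmul_eq_mul]; ring

theorem integrable_inv_one_add_norm_pow :
    Integrable fun y : Rd d => ((1 + ‖y‖) ^ (d + 1))⁻¹ := by
  have := integrable_one_add_norm (E := Rd d) (μ := volume) (r := (d + 1 : ℕ)) (by simp)
  refine this.congr (ae_of_all _ fun y => ?_)
  simp only
  rw [Real.rpow_neg (by positivity), Real.rpow_natCast]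

theorem partialD_comp_sub (f : Rd d → ℂ) (x : Rd d) (i : Fin d) :
    partialD i (fun y => f (y - x)) = fun y => partialD i f (y - x) := by
  funext y
  rw [partialD, fderiv_comp_sub]
  rfl

theorem partialD_iterate_comp_sub (f : Rd d → ℂ) (x : Rd d) (i : Fin d) (j : ℕ) :
    (partialD i)^[j] (fun y => f (y - x)) = fun y => (partialD i)^[j] f (y - x) := by
  induction j with
  | zero => rfl
  | succ j ih => rw [Function.iterate_succ_apply', ih, partialD_comp_sub,
      Function.iterate_succ_apply']

theorem windowShift_zero_right (x y : Rd d) : windowShift x 0 y = windowShift 0 0 (y - x) := by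
  simp [windowShift]

theorem windowShift_neg_right (x ξ y : Rd d) : windowShift x (-ξ) y =
    windowShift x 0 y * Complex.exp (Complex.I * ((inner ℝ y ξ : ℝ) : ℂ)) := by
  simp [windowShift]

theorem norm_windowShift (x ξ y : Rd d) : ‖windowShift x ξ y‖ = ‖windowShift x 0 y‖ := by
  rw [windowShift, windowShift, norm_mul, norm_mul]
  congr 1
  rw [Complex.norm_exp, Complex.norm_exp]
  simp

theorem contDiff_windowShift (x ξ : Rd d) : ContDiff ℝ (⊤ : ℕ∞) (windowShift x ξ) :=
  (windowShift_mem x ξ).1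

theorem continuous_windowShift (x ξ : Rd d) : Continuous (windowShift x ξ) :=
  (contDiff_windowShift x ξ).continuous

theorem integrable_of_mem_GS {s : ℝ} {f : Rd d → ℂ} (hf : f ∈ GS d s) : Integrable f := by
  obtain ⟨hc, h, hh, hn⟩ := hf
  obtain ⟨B, hB⟩ := (gsNorm_lt_top_iff hh f).1 hn
  obtain ⟨C, hC, hdec⟩ := exists_one_add_norm_pow_mul_le (d := d) s hh d
  refine (integrable_inv_one_add_norm_pow.const_mul (C * (B * gsFactor s h (0 : Fin d → ℕ) 0))).mono'
    hc.continuous.aestronglyMeasurable (ae_of_all _ fun y => ?_)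
  have := hdec f B hB 0 y
  rw [iterPartial_zero] at this
  rw [← div_eq_mul_inv, le_div_iff₀ (by positivity), mul_comm]
  exact this

theorem integrable_windowShift (x ξ : Rd d) : Integrable (windowShift x ξ) :=
  integrable_of_mem_GS (windowShift_mem x ξ)

theorem norm_windowShift_zero (u : Rd d) :
    ‖windowShift 0 0 u‖ = Real.pi ^ (-(d : ℝ) / 4) * Real.exp (-‖u‖ ^ 2 / 2) := by
  have h : 0 < Real.pi ^ (-(d : ℝ) / 4) * Real.exp (-‖u‖ ^ 2 / 2) := by positivity
  simp only [windowShift, sub_zero, gaussWindow, Complex.conj_ofReal, inner_zero_right,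
    Complex.ofReal_zero, mul_zero, Complex.exp_zero, mul_one, Complex.norm_real]
  exact Real.norm_of_nonneg h.le

/-- In the application J j l is an integral with j derivatives on the function and l on the window.
Each factor t is paid for by one integration by parts, which raises j + l by one and doubles the
number of terms. -/
theorem pow_mul_norm_le_of_recursion {J : ℕ → ℕ → ℂ} {t A H s : ℝ} (ht : 0 ≤ t)
    (hJ : ∀ j l, ‖J j l‖ ≤ A * (H ^ (j + l) * ((j + l).factorial : ℝ) ^ s))
    (hrec : ∀ j l, t * ‖J j l‖ ≤ ‖J (j + 1) l‖ + ‖J j (l + 1)‖) (k j l : ℕ) :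
    t ^ k * ‖J j l‖ ≤ A * (2 ^ k * (H ^ (j + l + k) * ((j + l + k).factorial : ℝ) ^ s)) := by
  induction k generalizing j l with
  | zero => simpa using hJ j l
  | succ k ih =>
    have h1 := ih (j + 1) l
    have h2 := ih j (l + 1)
    have e1 : j + 1 + l + k = j + l + (k + 1) := by ring
    have e2 : j + (l + 1) + k = j + l + (k + 1) := by ring
    rw [e1] at h1
    rw [e2] at h2
    calc t ^ (k + 1) * ‖J j l‖ = t ^ k * (t * ‖J j l‖) := by ring
      _ ≤ t ^ k * (‖J (j + 1) l‖ + ‖J j (l + 1)‖) := by gcongr; exact hrec j l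
      _ ≤ _ := by rw [mul_add, pow_succ]; linarith

/-- Multiplication by ξ_i is differentiation of the character e^{i⟨y,ξ⟩}; integrating by parts
spreads the derivatives over function and window. Both have factorial growth, and j! l! ≤ (j+l)!
keeps the total of Gelfand-Shilov type. -/
theorem exists_pow_snd_mul_norm_analysis_le {s h : ℝ} (hs : 1 / 2 ≤ s) (hh : 0 < h) :
    ∃ C H : ℝ, 0 < C ∧ 0 < H ∧ ∀ (φ : Rd d → ℂ), ContDiff ℝ (⊤ : ℕ∞) φ → ∀ B : ℝ,
      (∀ α β y, monoDeriv φ α β y ≤ B * gsFactor s h α β) → ∀ (X : R2d d) (i : Fin d) (k : ℕ),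
      |X.snd i| ^ k * ‖analysis φ X‖ ≤ C * B * (H ^ k * (k.factorial : ℝ) ^ s) := by
  -- Only the unshifted window (X = 0) is used, so the rate 1 is immaterial. Passing `h` as the
  -- lower bound gives h ≤ H, so a single constant serves both factors.
  obtain ⟨H, C₀, hH, hH0, hC₀, hw⟩ := exists_monoDeriv_windowShift_le (d := d) hs one_pos h
  have hq : 1 / s ≠ 0 := by
    have : 0 < s := by linarith
    positivity
  have hw0 : ∀ α β y, monoDeriv (windowShift (0 : Rd d) 0) α β y ≤ C₀ * gsFactor s H α β := by
    intro α β y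
    have := hw 0 α β y
    simpa [phaseRpow, Real.zero_rpow hq, -one_div] using this
  obtain ⟨C₁, hC₁, hdec⟩ := exists_one_add_norm_pow_mul_le (d := d) s hH0 d
  set K : ℝ := ∫ y : Rd d, ((1 + ‖y‖) ^ (d + 1))⁻¹ with hK
  have hK0 : 0 ≤ K := integral_nonneg fun y => by positivity
  refine ⟨C₁ * C₀ * (K + 1), 2 * H, by positivity, by positivity, fun φ hφ B hB X i k => ?_⟩
  have hB0 := nonneg_of_monoDeriv_le hB
  set w : Rd d → ℂ := windowShift X.fst 0 with hwdef
  have hwc : ContDiff ℝ (⊤ : ℕ∞) w := contDiff_windowShift _ _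
  set e : Rd d → ℂ := fun y => Complex.exp (Complex.I * ((inner ℝ y X.snd : ℝ) : ℂ)) with he
  have hec : ContDiff ℝ (⊤ : ℕ∞) e :=
    (contDiff_const.mul (Complex.ofRealCLM.contDiff.comp (contDiff_id.inner ℝ contDiff_const))).cexp
  have hen : ∀ y, ‖e y‖ = 1 := fun y => by
    rw [he, Complex.norm_exp]; simp
  have hed : ∀ y, partialD i e y = Complex.I * X.snd i * e y := by
    intro y
    have h1 : HasFDerivAt (fun y : Rd d => Complex.I * ((inner ℝ y X.snd : ℝ) : ℂ))
        (Complex.I • (Complex.ofRealCLM.comp ((innerSL ℝ X.snd)))) y := by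
      have h2 : HasFDerivAt (fun y : Rd d => ((inner ℝ X.snd y : ℝ) : ℂ))
        (Complex.ofRealCLM.comp (innerSL ℝ X.snd)) y :=
        (Complex.ofRealCLM.comp (innerSL ℝ X.snd)).hasFDerivAt
      simp_rw [real_inner_comm X.snd]
      exact h2.const_mul Complex.I
    rw [partialD, h1.cexp.fderiv]
    simp [he, EuclideanSpace.inner_single_right]
    ring
  set P : ℕ → ℕ → Rd d → ℂ := fun j l y => (partialD i)^[j] φ y * (partialD i)^[l] w y with hP
  have hPc : ∀ j l, ContDiff ℝ (⊤ : ℕ∞) (P j l) := fun j l =>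
    (contDiff_partialD_iterate hφ i j).mul (contDiff_partialD_iterate hwc i l)
  have hPd : ∀ j l y, partialD i (P j l) y = P (j + 1) l y + P j (l + 1) y := by
    intro j l y
    have h1 := ((contDiff_partialD_iterate hφ i j).differentiable (by simp) y)
    have h2 := ((contDiff_partialD_iterate hwc i l).differentiable (by simp) y)
    simp only [hP]
    rw [partialD, fderiv_fun_mul h1 h2, Function.iterate_succ_apply', Function.iterate_succ_apply']
    simp only [add_apply, smul_apply, smul_eq_mul, partialD]
    ring
  have hPb : ∀ j l y, ‖P j l y‖ ≤ C₁ * C₀ * B * (H ^ (j + l) * ((j + l).factorial : ℝ) ^ s) *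
      ((1 + ‖y - X.fst‖) ^ (d + 1))⁻¹ := by
    intro j l y
    have h1 := norm_partialD_iterate_le hB i j y
    have h2 := hdec _ _ hw0 (Pi.single i l) (y - X.fst)
    rw [iterPartial_single, gsFactor_single_left] at h2
    have h3 : (partialD i)^[l] w y = (partialD i)^[l] (windowShift 0 0) (y - X.fst) := by
      have : w = fun y => windowShift 0 0 (y - X.fst) := funext (windowShift_zero_right _)
      rw [this, partialD_iterate_comp_sub]
    rw [mul_comm, ← le_div_iff₀ (by positivity)] at h2
    simp only [hP, norm_mul, h3]
    have h4 : ((j.factorial : ℝ)) ^ s * (l.factorial : ℝ) ^ s ≤ ((j + l).factorial : ℝ) ^ s := by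
      rw [← Real.mul_rpow (by positivity) (by positivity)]
      refine Real.rpow_le_rpow (by positivity) ?_ (by linarith)
      exact_mod_cast Nat.le_of_dvd (Nat.factorial_pos _)
        (Nat.factorial_mul_factorial_dvd_factorial_add j l)
    calc _ ≤ (B * (h ^ j * (j.factorial : ℝ) ^ s)) *
          (C₁ * (C₀ * (H ^ l * (l.factorial : ℝ) ^ s)) / (1 + ‖y - X.fst‖) ^ (d + 1)) := by gcongr
      _ ≤ (B * (H ^ j * (j.factorial : ℝ) ^ s)) *
          (C₁ * (C₀ * (H ^ l * (l.factorial : ℝ) ^ s)) / (1 + ‖y - X.fst‖) ^ (d + 1)) := by gcongr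
      _ = C₁ * C₀ * B * (H ^ (j + l) * ((j.factorial : ℝ) ^ s * (l.factorial : ℝ) ^ s)) *
          ((1 + ‖y - X.fst‖) ^ (d + 1))⁻¹ := by rw [pow_add]; ring
      _ ≤ _ := by gcongr
  have hdomint : Integrable fun y : Rd d => ((1 + ‖y - X.fst‖) ^ (d + 1))⁻¹ :=
    integrable_inv_one_add_norm_pow.comp_sub_right X.fst
  have hPe : ∀ j l, Integrable fun y => P j l y * e y := by
    intro j l
    refine (hdomint.const_mul (C₁ * C₀ * B * (H ^ (j + l) * ((j + l).factorial : ℝ) ^ s))).mono'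
      ((hPc j l).continuous.mul hec.continuous).aestronglyMeasurable (ae_of_all _ fun y => ?_)
    rw [norm_mul, hen, mul_one]
    exact hPb j l y
  set J : ℕ → ℕ → ℂ := fun j l => ∫ y, P j l y * e y with hJ
  have hJb : ∀ j l, ‖J j l‖ ≤ C₁ * C₀ * (K + 1) * B * (H ^ (j + l) * ((j + l).factorial : ℝ) ^ s) := by
    intro j l
    calc ‖J j l‖ ≤ ∫ y, C₁ * C₀ * B * (H ^ (j + l) * ((j + l).factorial : ℝ) ^ s) *
          ((1 + ‖y - X.fst‖) ^ (d + 1))⁻¹ := by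
          refine norm_integral_le_of_norm_le (hdomint.const_mul _) (ae_of_all _ fun y => ?_)
          rw [norm_mul, hen, mul_one]
          exact hPb j l y
      _ = C₁ * C₀ * B * (H ^ (j + l) * ((j + l).factorial : ℝ) ^ s) * K := by
          rw [integral_const_mul, hK,
            integral_sub_right_eq_self (fun y : Rd d => ((1 + ‖y‖) ^ (d + 1))⁻¹) X.fst]
      _ ≤ C₁ * C₀ * B * (H ^ (j + l) * ((j + l).factorial : ℝ) ^ s) * (K + 1) := by
          gcongr; linarith
      _ = _ := by ring
  -- Integration by parts in the direction e_i. All three integrands are integrable because the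
  -- window has polynomial decay of order d + 1 about x.
  have hrec : ∀ j l, |X.snd i| * ‖J j l‖ ≤ ‖J (j + 1) l‖ + ‖J j (l + 1)‖ := by
    intro j l
    have h1 := integral_mul_fderiv_eq_neg_fderiv_mul_of_integrable (μ := (volume : Measure (Rd d)))
      (f := P j l) (g := e) (v := EuclideanSpace.single i (1 : ℝ))
      (((hPe (j + 1) l).add (hPe j (l + 1))).congr (ae_of_all _ fun y => by
        have := hPd j l y
        simp only [partialD] at this
        simp only [Pi.add_apply, this]; ring))
      (((hPe j l).const_mul (Complex.I * X.snd i)).congr (ae_of_all _ fun y => by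
        have := hed y
        simp only [partialD] at this
        simp only [this]; ring)) (hPe j l)
      (fun y _ => (hPc j l).differentiable (by simp) y) (fun y _ => hec.differentiable (by simp) y)
    have h2 : ∫ y, P j l y * fderiv ℝ e y (EuclideanSpace.single i (1 : ℝ)) =
        Complex.I * X.snd i * J j l := by
      rw [hJ, ← integral_const_mul]
      refine integral_congr_ae (ae_of_all _ fun y => ?_)
      have := hed y
      simp only [partialD] at this
      simp only [this]; ring
    have h3 : ∫ y, fderiv ℝ (P j l) y (EuclideanSpace.single i (1 : ℝ)) * e y =
        J (j + 1) l + J j (l + 1) := by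
      rw [hJ]
      simp only
      rw [← integral_add (hPe _ _) (hPe _ _)]
      refine integral_congr_ae (ae_of_all _ fun y => ?_)
      have := hPd j l y
      simp only [partialD] at this
      simp only [this]; ring
    rw [h2, h3] at h1
    have h4 := congrArg norm h1
    rw [norm_mul, norm_mul, Complex.norm_I, one_mul, Complex.norm_real, norm_neg] at h4
    rw [Real.norm_eq_abs] at h4
    rw [h4]
    exact norm_add_le _ _
  have hfin := pow_mul_norm_le_of_recursion (abs_nonneg (X.snd i)) hJb hrec k 0 0
  have h00 : J 0 0 = analysis φ X := by
    rw [hJ, analysis]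
    refine integral_congr_ae (ae_of_all _ fun y => ?_)
    simp only [hP, he, Function.iterate_zero, id]
    rw [windowShift_neg_right, mul_assoc]
  rw [h00] at hfin
  simpa [mul_pow, mul_assoc] using hfin

theorem exists_pow_mul_norm_windowShift_zero_le : ∃ C : ℝ, 0 < C ∧
    ∀ (u : Rd d) (i : Fin d) (k : ℕ), |u i| ^ k * ‖windowShift 0 0 u‖ ≤
      C * (2 ^ k * (k.factorial : ℝ) ^ (1 / 2 : ℝ)) * ((1 + ‖u‖) ^ (d + 1))⁻¹ := by
  -- The Gaussian exponent 1/2 is split as 1/8 + 3/8: the first part absorbs the power of u_i, the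
  -- second the polynomial weight.
  obtain ⟨C, hC, h⟩ := exists_one_add_pow_le_exp_rpow (r := 3 / 8) (q := 2) (by norm_num)
    (by norm_num) (d + 1)
  refine ⟨Real.pi ^ (-(d : ℝ) / 4) * C, by positivity, fun u i k => ?_⟩
  have h1 := pow_le_factorial_rpow_mul_exp (s := 1 / 2) (u := |u i| / 2) (by norm_num)
    (by positivity) k
  have h2 : (|u i| / 2) ^ (1 / (1 / 2) : ℝ) = |u i| ^ 2 / 4 := by
    rw [one_div_one_div, Real.rpow_two, div_pow]; norm_num
  rw [h2, div_pow, div_le_iff₀ (by positivity)] at h1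
  have h3 := h ‖u‖ (norm_nonneg u)
  rw [Real.rpow_two] at h3
  have h4 : |u i| ^ 2 ≤ ‖u‖ ^ 2 := by
    gcongr
    exact PiLp.norm_apply_le u i
  have h5 : Real.exp (1 / 2 * (|u i| ^ 2 / 4)) ≤ Real.exp (‖u‖ ^ 2 / 8) := by
    gcongr; linarith
  rw [norm_windowShift_zero, ← div_eq_mul_inv, le_div_iff₀ (by positivity)]
  calc |u i| ^ k * (Real.pi ^ (-(d : ℝ) / 4) * Real.exp (-‖u‖ ^ 2 / 2)) * (1 + ‖u‖) ^ (d + 1)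
      ≤ ((k.factorial : ℝ) ^ (1 / 2 : ℝ) * Real.exp (‖u‖ ^ 2 / 8) * 2 ^ k) *
        (Real.pi ^ (-(d : ℝ) / 4) * Real.exp (-‖u‖ ^ 2 / 2)) *
        (C * Real.exp (3 / 8 * ‖u‖ ^ 2)) := by
        gcongr
        exact h1.trans (by gcongr)
    _ = Real.pi ^ (-(d : ℝ) / 4) * C * (2 ^ k * (k.factorial : ℝ) ^ (1 / 2 : ℝ)) *
        Real.exp (‖u‖ ^ 2 / 8 + -‖u‖ ^ 2 / 2 + 3 / 8 * ‖u‖ ^ 2) := by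
        rw [Real.exp_add, Real.exp_add]; ring
    _ = _ := by
        have : ‖u‖ ^ 2 / 8 + -‖u‖ ^ 2 / 2 + 3 / 8 * ‖u‖ ^ 2 = 0 := by ring
        rw [this, Real.exp_zero, mul_one]

/-- Since x_i = y_i - (y_i - x_i), powers of x_i are shared between the function, which decays in y,
and the window, which decays in y - x. No derivatives are involved. -/
theorem exists_pow_fst_mul_norm_analysis_le {s h : ℝ} (hs : 1 / 2 ≤ s) (hh : 0 < h) :
    ∃ C H : ℝ, 0 < C ∧ 0 < H ∧ ∀ (φ : Rd d → ℂ), ∀ B : ℝ,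
      (∀ α β y, monoDeriv φ α β y ≤ B * gsFactor s h α β) → ∀ (X : R2d d) (i : Fin d) (k : ℕ),
      |X.fst i| ^ k * ‖analysis φ X‖ ≤ C * B * (H ^ k * (k.factorial : ℝ) ^ s) := by
  obtain ⟨C₀, hC₀, hw⟩ := exists_pow_mul_norm_windowShift_zero_le (d := d)
  set K : ℝ := ∫ y : Rd d, ((1 + ‖y‖) ^ (d + 1))⁻¹ with hK
  have hK0 : 0 ≤ K := integral_nonneg fun y => by positivity
  refine ⟨2 * C₀ * (K + 1), 2 * (h + 2), by positivity, by positivity, fun φ B hB X i k => ?_⟩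
  have hB0 := nonneg_of_monoDeriv_le hB
  set x := X.fst
  have hdomint : Integrable fun y : Rd d => ((1 + ‖y - x‖) ^ (d + 1))⁻¹ :=
    integrable_inv_one_add_norm_pow.comp_sub_right x
  set F : ℝ := (k.factorial : ℝ) ^ s with hF
  have hpt : ∀ y, ‖(((|x i| ^ k : ℝ)) : ℂ) * (φ y * windowShift x (-X.snd) y)‖ ≤
      2 * C₀ * B * ((2 * (h + 2)) ^ k * F) * ((1 + ‖y - x‖) ^ (d + 1))⁻¹ := by
    intro y
    set D := ((1 + ‖y - x‖) ^ (d + 1))⁻¹ with hD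
    have hD0 : 0 ≤ D := by positivity
    rw [norm_mul, norm_mul, Complex.norm_real, Real.norm_of_nonneg (by positivity),
      norm_windowShift, windowShift_zero_right]
    have h1 : |x i| ^ k ≤ 2 ^ k * (|y i| ^ k + |(y - x) i| ^ k) := by
      have e : |x i| ≤ |y i| + |(y - x) i| := by
        have := abs_sub_abs_le_abs_sub (x i) (y i)
        rw [PiLp.sub_apply, abs_sub_comm (y i)]
        linarith
      refine (pow_le_pow_left₀ (abs_nonneg _) e k).trans
        ((add_pow_le (abs_nonneg _) (abs_nonneg _) k).trans ?_)
      gcongr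
      · norm_num
      · omega
    have h2 := abs_pow_mul_norm_le hB i k y
    have h3 := norm_le_of_monoDeriv_le hB y
    have h4 := hw (y - x) i k
    have h5 := hw (y - x) i 0
    simp only [pow_zero, one_mul, Nat.factorial_zero, Nat.cast_one, Real.one_rpow, mul_one] at h5
    have h6 : (k.factorial : ℝ) ^ (1 / 2 : ℝ) ≤ F :=
      Real.rpow_le_rpow_of_exponent_le (by exact_mod_cast k.factorial_pos) hs
    have hF0 : 0 ≤ F := by positivity
    set W := ‖windowShift (0 : Rd d) 0 (y - x)‖
    calc |x i| ^ k * (‖φ y‖ * W)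
        ≤ 2 ^ k * (|y i| ^ k + |(y - x) i| ^ k) * (‖φ y‖ * W) := by gcongr
      _ = 2 ^ k * ((|y i| ^ k * ‖φ y‖) * W + ‖φ y‖ * (|(y - x) i| ^ k * W)) := by ring
      _ ≤ 2 ^ k * ((B * (h ^ k * F)) * (C₀ * D) + B * (C₀ * (2 ^ k * F) * D)) := by
          have h7 := h4.trans (show C₀ * (2 ^ k * (k.factorial : ℝ) ^ (1 / 2 : ℝ)) * D ≤
            C₀ * (2 ^ k * F) * D by gcongr)
          have h8 : (|y i| ^ k * ‖φ y‖) * W ≤ (B * (h ^ k * F)) * (C₀ * D) := by gcongr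
          have h9 : ‖φ y‖ * (|(y - x) i| ^ k * W) ≤ B * (C₀ * (2 ^ k * F) * D) := by
            refine mul_le_mul h3 h7 (by positivity) hB0
          gcongr
      _ ≤ 2 ^ k * ((B * ((h + 2) ^ k * F)) * (C₀ * D) + B * (C₀ * ((h + 2) ^ k * F) * D)) := by
          gcongr <;> linarith
      _ = _ := by rw [mul_pow]; ring
  have e : (((|x i| ^ k : ℝ)) : ℂ) * analysis φ X =
      ∫ y, (((|x i| ^ k : ℝ)) : ℂ) * (φ y * windowShift x (-X.snd) y) := by
    rw [integral_const_mul]; rfl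
  calc |x i| ^ k * ‖analysis φ X‖ = ‖(((|x i| ^ k : ℝ)) : ℂ) * analysis φ X‖ := by
        rw [norm_mul, Complex.norm_real, Real.norm_of_nonneg (by positivity)]
    _ ≤ ∫ y, 2 * C₀ * B * ((2 * (h + 2)) ^ k * F) * ((1 + ‖y - x‖) ^ (d + 1))⁻¹ := by
        rw [e]
        exact norm_integral_le_of_norm_le (hdomint.const_mul _) (ae_of_all _ hpt)
    _ = 2 * C₀ * B * ((2 * (h + 2)) ^ k * F) * K := by
        rw [integral_const_mul, hK,
          integral_sub_right_eq_self (fun y : Rd d => ((1 + ‖y‖) ^ (d + 1))⁻¹) x]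
    _ ≤ 2 * C₀ * B * ((2 * (h + 2)) ^ k * F) * (K + 1) := by gcongr; linarith
    _ = _ := by ring

theorem norm_analysis_le {s h : ℝ} {φ : Rd d → ℂ} {B : ℝ}
    (hB : ∀ α β y, monoDeriv φ α β y ≤ B * gsFactor s h α β) (X : R2d d) :
    ‖analysis φ X‖ ≤ B * ∫ u : Rd d, ‖windowShift (0 : Rd d) 0 u‖ := by
  rw [← integral_sub_right_eq_self (fun u : Rd d => ‖windowShift (0 : Rd d) 0 u‖) X.fst,
    ← integral_const_mul]
  refine norm_integral_le_of_norm_le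
    (((integrable_windowShift 0 0).norm.comp_sub_right X.fst).const_mul B) (ae_of_all _ fun y => ?_)
  rw [norm_mul, norm_windowShift, windowShift_zero_right]
  gcongr
  exact norm_le_of_monoDeriv_le hB y

/-- Decay of `analysis φ` for Gelfand-Shilov functions `φ`. -/
theorem exists_norm_analysis_le {s h : ℝ} (hs : 1 / 2 ≤ s) (hh : 0 < h) :
    ∃ C r : ℝ, 0 < C ∧ 0 < r ∧ ∀ (φ : Rd d → ℂ), ContDiff ℝ (⊤ : ℕ∞) φ → ∀ B : ℝ,
      (∀ α β y, monoDeriv φ α β y ≤ B * gsFactor s h α β) → ∀ X : R2d d,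
      ‖analysis φ X‖ ≤ C * B * Real.exp (-(r * phaseRpow (1 / s) X)) := by
  have hs0 : 0 < s := by linarith
  have hq : 0 < 1 / s := by positivity
  obtain ⟨C₁, H₁, hC₁, hH₁, h₁⟩ := exists_pow_fst_mul_norm_analysis_le (d := d) hs hh
  obtain ⟨C₂, H₂, hC₂, hH₂, h₂⟩ := exists_pow_snd_mul_norm_analysis_le (d := d) hs hh
  set K := ∫ u : Rd d, ‖windowShift (0 : Rd d) 0 u‖ with hK
  have hK0 : 0 ≤ K := integral_nonneg fun _ => norm_nonneg _
  set C := K + 2 ^ s * (C₁ + C₂) with hC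
  have hC0 : 0 < C := by positivity
  set H := H₁ + H₂ with hH
  have hH0 : 0 < H := by positivity
  -- The rate s/2 at scale `H` holds in each coordinate by `mul_exp_le_of_forall_pow_mul_le`; 2d + 1
  -- comes from combining the 2d coordinates, and (d+1)^{1/s} from comparing coordinates with the
  -- Euclidean norm.
  set r := s / 2 / (H ^ (1 / s) * ((d + 1 : ℝ) ^ (1 / s) * (2 * d + 1))) with hr
  refine ⟨C, r, hC0, by positivity, fun φ hφ B hB X => ?_⟩
  have hB0 := nonneg_of_monoDeriv_le hB
  set a := ‖analysis φ X‖
  have hone : ∀ {C' H' u : ℝ}, 0 ≤ C' → C' ≤ C₁ + C₂ → 0 < H' → H' ≤ H →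
      (∀ k : ℕ, |u| ^ k * a ≤ C' * B * (H' ^ k * (k.factorial : ℝ) ^ s)) →
      a ≤ C * B * Real.exp (-(s / 2 * (|u| / H) ^ (1 / s))) := by
    intro C' H' u hC0' hC' hH0' hH' hk
    have := mul_exp_le_of_forall_pow_mul_le (s := s) (u := |u| / H) (a := a) (C := C' * B) hs0
      (by positivity) (norm_nonneg _) fun k => by
        rw [div_pow, div_mul_eq_mul_div, div_le_iff₀ (by positivity)]
        refine (hk k).trans ?_
        rw [mul_assoc (C' * B), mul_comm _ (H ^ k)]
        gcongr
    rw [Real.exp_neg, ← div_eq_mul_inv, le_div_iff₀ (Real.exp_pos _)]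
    refine this.trans ?_
    rw [← mul_assoc]
    gcongr
    rw [hC]
    have : (2 : ℝ) ^ s * C' ≤ 2 ^ s * (C₁ + C₂) := by gcongr
    linarith
  have hbase : a ≤ C * B := by
    refine (norm_analysis_le hB X).trans ?_
    rw [mul_comm, ← hK]
    gcongr
    rw [hC]
    have : 0 ≤ (2 : ℝ) ^ s * (C₁ + C₂) := by positivity
    linarith
  have hmain := le_mul_exp_neg_sum (ι := Fin d ⊕ Fin d) (A := a) (B := C * B)
    (t := Sum.elim (fun i => s / 2 * (|X.fst i| / H) ^ (1 / s))
      (fun i => s / 2 * (|X.snd i| / H) ^ (1 / s))) (by positivity)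
    (by rintro (i | i) <;> simp only [Sum.elim_inl, Sum.elim_inr] <;> positivity) hbase
    (by
      rintro (i | i)
      · exact hone hC₁.le (by linarith) hH₁ (by linarith) fun k => h₁ φ B hB X i k
      · exact hone hC₂.le (by linarith) hH₂ (by linarith) fun k => h₂ φ hφ B hB X i k)
  refine hmain.trans ?_
  have hsum : ∀ x : Rd d, ‖x‖ ^ (1 / s) / (d + 1 : ℝ) ^ (1 / s) * (s / 2 / H ^ (1 / s)) ≤
      ∑ i, s / 2 * (|x i| / H) ^ (1 / s) := by
    intro x
    have h1 := norm_rpow_le_sum x hq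
    have h2 : ‖x‖ ^ (1 / s) / (d + 1 : ℝ) ^ (1 / s) ≤ ∑ i, |x i| ^ (1 / s) := by
      rw [div_le_iff₀ (by positivity), mul_comm]
      refine h1.trans ?_
      have : 0 ≤ ∑ i, |x i| ^ (1 / s) := Finset.sum_nonneg fun _ _ => by positivity
      gcongr
      linarith
    have h3 : ∑ i, s / 2 * (|x i| / H) ^ (1 / s) =
        (∑ i, |x i| ^ (1 / s)) * (s / 2 / H ^ (1 / s)) := by
      rw [Finset.sum_mul]
      refine Finset.sum_congr rfl fun i _ => ?_
      rw [Real.div_rpow (abs_nonneg _) hH0.le]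
      ring
    rw [h3]
    gcongr
  gcongr
  rw [Fintype.sum_sum_type, le_div_iff₀ (by positivity)]
  simp only [Sum.elim_inl, Sum.elim_inr, Fintype.card_sum, Fintype.card_fin]
  refine le_trans (le_of_eq ?_) (add_le_add (hsum X.fst) (hsum X.snd))
  rw [hr, phaseRpow]
  push_cast
  field_simp
  ring

end Decay

/-! ### Superpositions of shifted Gaussians -/

section Synthesis

variable {d : ℕ}

/-- The Gaussian `y ↦ e^{-⟨y, y⟩/2 + ⟨a, y⟩}` with complex parameter `a`. -/
def gaussExp (a : Fin d → ℂ) : Rd d → ℂ := prodFun fun i => gaussR (a i)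

/-- The complex parameter `x - iξ` of a phase space point. -/
def phaseParam (X : R2d d) : Fin d → ℂ := fun i => (X.fst i : ℂ) - Complex.I * (X.snd i : ℂ)

/-- The factor relating `windowShift` and `gaussExp`. -/
def shiftFactor (x : Rd d) : ℝ := Real.pi ^ (-(d : ℝ) / 4) * Real.exp (-‖x‖ ^ 2 / 2)

theorem windowShift_eq_smul_gaussExp (X : R2d d) :
    windowShift X.fst X.snd = (shiftFactor X.fst : ℂ) • gaussExp (phaseParam X) := by
  set x := X.fst with hx
  set ξ := X.snd with hξ
  funext y
  simp only [windowShift, gaussWindow, Complex.conj_ofReal, Pi.smul_apply, smul_eq_mul, prodFun,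
    gaussR, gauss1, ← Complex.exp_sum, shiftFactor, gaussExp, phaseParam, ← hx, ← hξ]
  push_cast
  rw [mul_assoc, mul_assoc, ← Complex.exp_add, ← Complex.exp_add]
  congr 2
  have h1 : ((‖y - x‖ : ℝ) : ℂ) ^ 2 = ∑ i, ((y i : ℂ) - x i) ^ 2 := by
    rw [← Complex.ofReal_pow, EuclideanSpace.real_norm_sq_eq]
    push_cast
    refine Finset.sum_congr rfl fun i _ => ?_
    simp
  have h2 : ((‖x‖ : ℝ) : ℂ) ^ 2 = ∑ i, (x i : ℂ) ^ 2 := by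
    rw [← Complex.ofReal_pow, EuclideanSpace.real_norm_sq_eq]
    push_cast
    rfl
  have h3 : ((inner ℝ y ξ : ℝ) : ℂ) = ∑ i, (y i : ℂ) * ξ i := by
    rw [PiLp.inner_apply]
    push_cast
    refine Finset.sum_congr rfl fun i _ => ?_
    simp [mul_comm]
  rw [h1, h2, h3, Finset.mul_sum, ← Finset.sum_neg_distrib, ← Finset.sum_neg_distrib,
    Finset.sum_div, Finset.sum_div, ← Finset.sum_add_distrib, ← Finset.sum_add_distrib]
  refine Finset.sum_congr rfl fun i _ => ?_
  ring

/-- Completing the square moves the parameter into the argument of one fixed entire function, so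
that every derivative in t is visibly entire in a. -/
theorem iteratedDeriv_gaussR_eq (a : ℂ) (n : ℕ) (t : ℝ) :
    iteratedDeriv n (gaussR a) t =
      Complex.exp (a ^ 2 / 2) * iteratedDeriv n (gauss1 0) ((t : ℂ) - a) := by
  have h : gauss1 a = fun z => Complex.exp (a ^ 2 / 2) * gauss1 0 (z - a) := by
    funext z
    rw [gauss1, gauss1, ← Complex.exp_add]
    congr 1; ring
  rw [iteratedDeriv_gaussR, h, iteratedDeriv_const_mul_field]
  congr 1
  exact congrFun (iteratedDeriv_comp_sub_const n (gauss1 0) a) (t : ℂ)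

theorem differentiable_iteratedDeriv_gaussR (n : ℕ) (t : ℝ) :
    Differentiable ℂ fun a : ℂ => iteratedDeriv n (gaussR a) t := by
  simp_rw [iteratedDeriv_gaussR_eq]
  have h : Differentiable ℂ (iteratedDeriv n (gauss1 0)) :=
    ((differentiable_gauss1 0).contDiff (n := ⊤)).differentiable_iteratedDeriv n
      (WithTop.coe_lt_top _)
  have h2 : Differentiable ℂ fun a : ℂ => iteratedDeriv n (gauss1 0) ((t : ℂ) - a) :=
    h.comp (differentiable_id.const_sub _)
  exact Differentiable.mul (by fun_prop) h2

theorem contDiff_gaussExp (a : Fin d → ℂ) : ContDiff ℝ (⊤ : ℕ∞) (gaussExp a) :=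
  contDiff_prodFun fun _ => contDiff_gaussR _

theorem iterPartial_gaussExp (a : Fin d → ℂ) (α : Fin d → ℕ) :
    iterPartial α (gaussExp a) = prodFun fun i => iteratedDeriv (α i) (gaussR (a i)) :=
  iterPartial_prodFun (fun i => contDiff_gaussR (a i)) α

theorem differentiable_iterPartial_gaussExp (α : Fin d → ℕ) (y : Rd d) :
    Differentiable ℂ fun a : Fin d → ℂ => iterPartial α (gaussExp a) y := by
  simp_rw [iterPartial_gaussExp, prodFun]
  have h : ∀ i : Fin d, Differentiable ℂ fun a : Fin d → ℂ =>
      iteratedDeriv (α i) (gaussR (a i)) (y i) := fun i =>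
    (differentiable_iteratedDeriv_gaussR (α i) (y i)).comp (differentiable_apply i)
  fun_prop

theorem continuous_phaseParam : Continuous (phaseParam : R2d d → Fin d → ℂ) := by
  have h1 : Continuous fun X : R2d d => X.fst := WithLp.continuous_fst 2 _ _
  have h2 : Continuous fun X : R2d d => X.snd := WithLp.continuous_snd 2 _ _
  unfold phaseParam
  fun_prop

theorem continuous_shiftFactor : Continuous (shiftFactor : Rd d → ℝ) := by
  unfold shiftFactor
  fun_prop

theorem iterPartial_windowShift_eq (α : Fin d → ℕ) (X : R2d d) :
    iterPartial α (windowShift X.fst X.snd) =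
      (shiftFactor X.fst : ℂ) • iterPartial α (gaussExp (phaseParam X)) := by
  rw [windowShift_eq_smul_gaussExp, iterPartial,
    listPartial_smul _ (contDiff_gaussExp _)]
  rfl

theorem continuous_iterPartial_windowShift (α : Fin d → ℕ) (y : Rd d) :
    Continuous fun X : R2d d => iterPartial α (windowShift X.fst X.snd) y := by
  simp_rw [iterPartial_windowShift_eq, Pi.smul_apply]
  have h1 : Continuous fun X : R2d d => X.fst := WithLp.continuous_fst 2 _ _
  exact (Complex.continuous_ofReal.comp (continuous_shiftFactor.comp h1)).smul
    ((differentiable_iterPartial_gaussExp α y).continuous.comp continuous_phaseParam)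

/-- The covector `∑ i, c i dx_i`. -/
def covector : (Fin d → ℂ) →L[ℝ] (Rd d →L[ℝ] ℂ) :=
  ∑ i, (ContinuousLinearMap.smulRightL ℝ (Rd d) ℂ (EuclideanSpace.proj i : Rd d →L[ℝ] ℝ)).comp
    (ContinuousLinearMap.proj i)

theorem covector_apply (c : Fin d → ℂ) (v : Rd d) : covector c v = ∑ i, (v i : ℂ) * c i := by
  simp [covector]

theorem covector_single (c : Fin d → ℂ) (i : Fin d) :
    covector c (EuclideanSpace.single i 1) = c i := by
  rw [covector_apply, Finset.sum_eq_single i] <;> simp +contextual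

theorem norm_covector_le (c : Fin d → ℂ) : ‖covector c‖ ≤ ∑ i, ‖c i‖ := by
  refine ContinuousLinearMap.opNorm_le_bound _ (Finset.sum_nonneg fun _ _ => norm_nonneg _)
    fun v => ?_
  rw [covector_apply]
  refine (norm_sum_le _ _).trans ?_
  rw [Finset.sum_mul]
  refine Finset.sum_le_sum fun i _ => ?_
  rw [norm_mul, mul_comm, Complex.norm_real]
  gcongr
  exact PiLp.norm_apply_le v i

theorem hasFDerivAt_covector {f : Rd d → ℂ} {y : Rd d} (hf : DifferentiableAt ℝ f y) :
    HasFDerivAt f (covector fun i => partialD i f y) y := by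
  convert hf.hasFDerivAt using 1
  ext v
  have hv : v = ∑ i, v i • EuclideanSpace.single i (1 : ℝ) := by
    ext j
    simp [Pi.single_apply]
  conv_rhs => rw [hv]
  simp [covector_apply, partialD, map_sum]

theorem partialD_iterPartial_windowShift (x ξ : Rd d) (α : Fin d → ℕ) (i : Fin d) :
    partialD i (iterPartial α (windowShift x ξ)) =
      iterPartial (α + Pi.single i 1) (windowShift x ξ) := by
  have hg : ∀ j, ContDiff ℝ (⊤ : ℕ∞) (iteratedDeriv (α j) (shiftR (x j) (ξ j))) := fun j =>
    contDiff_iteratedDeriv (contDiff_shiftR _ _) _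
  rw [iterPartial_windowShift, iterPartial_windowShift, partialD_smul _ (contDiff_prodFun hg),
    partialD_prodFun hg]
  congr 2
  funext j
  by_cases h : j = i
  · subst h; simp [iteratedDeriv_succ]
  · simp [h]

theorem hasFDerivAt_iterPartial_windowShift (x ξ : Rd d) (α : Fin d → ℕ) (y : Rd d) :
    HasFDerivAt (iterPartial α (windowShift x ξ))
      (covector fun i => iterPartial (α + Pi.single i 1) (windowShift x ξ) y) y := by
  have h : ContDiff ℝ (⊤ : ℕ∞) (iterPartial α (windowShift x ξ)) :=
    contDiff_listPartial (contDiff_windowShift x ξ) α _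
  simpa only [partialD_iterPartial_windowShift] using
    hasFDerivAt_covector (h.differentiable (by simp) y)

/-- Domination is needed only for the partials: the full derivative is a continuous linear image of
the tuple of partials, which supplies both its measurability and its commutation with the integral.
-/
theorem hasFDerivAt_integral_covector {Ω : Type*} [MeasurableSpace Ω] {μ : Measure Ω}
    {G : Ω → Rd d → ℂ} {G' : Fin d → Ω → Rd d → ℂ} {b : Fin d → Ω → ℝ} {y : Rd d}
    (hm : ∀ y, AEStronglyMeasurable (fun X => G X y) μ) (hi : Integrable (fun X => G X y) μ)
    (hi' : ∀ i, Integrable (fun X => G' i X y) μ) (hb : ∀ i X y, ‖G' i X y‖ ≤ b i X)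
    (hbi : ∀ i, Integrable (b i) μ)
    (hd : ∀ X y, HasFDerivAt (G X) (covector fun i => G' i X y) y) :
    HasFDerivAt (fun y => ∫ X, G X y ∂μ) (covector fun i => ∫ X, G' i X y ∂μ) y := by
  have hpi : Integrable (fun X => fun i : Fin d => G' i X y) μ := Integrable.of_eval hi'
  have key := hasFDerivAt_integral_of_dominated_of_fderiv_le (𝕜 := ℝ) (μ := μ)
    (F := fun y X => G X y) (F' := fun y X => covector fun i => G' i X y)
    (bound := fun X => ∑ i : Fin d, b i X) (x₀ := y) (s := Set.univ) Filter.univ_mem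
    (Filter.Eventually.of_forall hm) hi
    (covector.continuous.comp_aestronglyMeasurable hpi.aestronglyMeasurable)
    (ae_of_all _ fun X y _ => (norm_covector_le _).trans
      (Finset.sum_le_sum fun i _ => hb i X y))
    (integrable_finsetSum _ fun i _ => hbi i) (ae_of_all _ fun X y _ => hd X y)
  have e : (fun i => ∫ X, G' i X y ∂μ) = ∫ X, (fun i : Fin d => G' i X y) ∂μ := by
    funext i
    rw [eval_integral hi']
  rw [e, ← ContinuousLinearMap.integral_comp_comm covector hpi]
  exact key

section Families

variable {u : (Fin d → ℕ) → Rd d → ℂ}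

/-- A family indexed by multi-indices and closed under differentiation gains one order of smoothness
at each induction step, simultaneously for all indices. -/
theorem contDiff_of_hasFDerivAt_covector
    (hu : ∀ α y, HasFDerivAt (u α) (covector fun i => u (α + Pi.single i 1) y) y)
    (α : Fin d → ℕ) : ContDiff ℝ (⊤ : ℕ∞) (u α) := by
  refine contDiff_infty.2 fun n => ?_
  induction n generalizing α with
  | zero =>
    exact contDiff_zero.2 (continuous_iff_continuousAt.2 fun y => (hu α y).continuousAt)
  | succ n ih =>
    refine (contDiff_succ_iff_fderiv (n := (n : WithTop ℕ∞))).2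
      ⟨fun y => (hu α y).differentiableAt, fun h => absurd h (by simp), ?_⟩
    have e : fderiv ℝ (u α) = fun y => covector fun i => u (α + Pi.single i 1) y :=
      funext fun y => (hu α y).fderiv
    rw [e]
    exact covector.contDiff.comp (contDiff_pi.2 fun i => ih _)

/-- Differentiation adds to the index, and addition of multi-indices is commutative, so no symmetry
of mixed derivatives has to be invoked. -/
theorem iterPartial_of_hasFDerivAt_covector
    (hu : ∀ α y, HasFDerivAt (u α) (covector fun i => u (α + Pi.single i 1) y) y)
    (α β : Fin d → ℕ) : iterPartial β (u α) = u (α + β) := by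
  have h1 : ∀ α i, partialD i (u α) = u (α + Pi.single i 1) := fun α i => by
    funext y
    rw [partialD, (hu α y).fderiv, covector_single]
  have h2 : ∀ α i k, (partialD i)^[k] (u α) = u (α + Pi.single i k) := by
    intro α i k
    induction k with
    | zero => simp
    | succ k ih => rw [Function.iterate_succ_apply', ih, h1, add_assoc, ← Pi.single_add]
  have h3 : ∀ (l : List (Fin d)), listPartial β l (u α) =
      u (α + (l.map fun i => (Pi.single i (β i) : Fin d → ℕ)).sum) := by
    intro l
    induction l with
    | nil => simp [listPartial]
    | cons i l ih =>
      change (partialD i)^[β i] (listPartial β l (u α)) = _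
      rw [ih, h2, List.map_cons, List.sum_cons, add_assoc, add_comm (List.sum _)]
  rw [iterPartial, h3, ← Fin.sum_univ_def, Finset.univ_sum_single]

end Families

/-- The superposition `∫ K(X) φ_X dX` of time-frequency shifts of the Gaussian window. -/
def synthesis (K : R2d d → ℂ) (y : Rd d) : ℂ := ∫ X, K X * windowShift X.fst X.snd y

/-- The superposition of the partial derivatives of time-frequency shifts of the window. -/
def synthesisDeriv (K : R2d d → ℂ) (α : Fin d → ℕ) (y : Rd d) : ℂ :=
  ∫ X, K X * iterPartial α (windowShift X.fst X.snd) y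

theorem norm_mul_iterPartial_windowShift_le {s κ h C : ℝ}
    (hW : ∀ (X : R2d d) (α β : Fin d → ℕ) (y : Rd d), monoDeriv (windowShift X.fst X.snd) α β y ≤
      C * gsFactor s h α β * Real.exp (κ * phaseRpow (1 / s) X))
    (K : R2d d → ℂ) (α : Fin d → ℕ) (y : Rd d) (X : R2d d) :
    ‖K X * iterPartial α (windowShift X.fst X.snd) y‖ ≤
      C * gsFactor s h α 0 * (‖K X‖ * Real.exp (κ * phaseRpow (1 / s) X)) := by
  have := hW X α 0 y
  simp only [monoDeriv, Pi.zero_apply, pow_zero, Finset.prod_const_one, norm_one, one_mul] at this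
  rw [norm_mul]
  calc _ ≤ ‖K X‖ * (C * gsFactor s h α 0 * Real.exp (κ * phaseRpow (1 / s) X)) := by gcongr
    _ = _ := by ring

theorem integrable_mul_iterPartial_windowShift {s κ : ℝ} (hs : 1 / 2 ≤ s) (hκ : 0 < κ)
    {K : R2d d → ℂ} (hKm : AEStronglyMeasurable K)
    (hK : Integrable fun X => ‖K X‖ * Real.exp (κ * phaseRpow (1 / s) X))
    (α : Fin d → ℕ) (y : Rd d) :
    Integrable fun X : R2d d => K X * iterPartial α (windowShift X.fst X.snd) y := by
  obtain ⟨h, C, -, hh, hC, hW⟩ := exists_monoDeriv_windowShift_le (d := d) hs hκ 0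
  exact (hK.const_mul _).mono'
    (hKm.mul (continuous_iterPartial_windowShift α y).aestronglyMeasurable)
    (ae_of_all _ (norm_mul_iterPartial_windowShift_le hW K α y))

theorem smul_covector (c : ℂ) (v : Fin d → ℂ) : c • covector v = covector fun i => c * v i := by
  ext w
  simp only [smul_apply, covector_apply, smul_eq_mul, Finset.mul_sum]
  exact Finset.sum_congr rfl fun i _ => by ring

theorem hasFDerivAt_synthesisDeriv {s κ : ℝ} (hs : 1 / 2 ≤ s) (hκ : 0 < κ) {K : R2d d → ℂ}
    (hKm : AEStronglyMeasurable K)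
    (hK : Integrable fun X => ‖K X‖ * Real.exp (κ * phaseRpow (1 / s) X))
    (α : Fin d → ℕ) (y : Rd d) :
    HasFDerivAt (synthesisDeriv K α)
      (covector fun i => synthesisDeriv K (α + Pi.single i 1) y) y := by
  obtain ⟨h, C, -, hh, hC, hW⟩ := exists_monoDeriv_windowShift_le (d := d) hs hκ 0
  have hd : ∀ (X : R2d d) (y : Rd d),
      HasFDerivAt (fun y => K X * iterPartial α (windowShift X.fst X.snd) y)
        (covector fun i => K X * iterPartial (α + Pi.single i 1) (windowShift X.fst X.snd) y) y := by
    intro X y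
    rw [← smul_covector]
    exact (hasFDerivAt_iterPartial_windowShift X.fst X.snd α y).const_mul (K X)
  exact hasFDerivAt_integral_covector
    (fun y => hKm.mul (continuous_iterPartial_windowShift α y).aestronglyMeasurable)
    (integrable_mul_iterPartial_windowShift hs hκ hKm hK α y)
    (fun i => integrable_mul_iterPartial_windowShift hs hκ hKm hK (α + Pi.single i 1) y)
    (fun i X y => norm_mul_iterPartial_windowShift_le hW K (α + Pi.single i 1) y X)
    (fun i => hK.const_mul _) hd

/-- For the given rate κ some h makes the seminorms of all the shifted windows O(e^{κ(…)}) uniformly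
in the multi-indices. Integrating this bound against |K| gives the seminorms of the superposition
with the same h, and it also dominates every differentiated integrand. -/
theorem synthesis_mem_GS {s κ : ℝ} (hs : 1 / 2 ≤ s) (hκ : 0 < κ) {K : R2d d → ℂ}
    (hKm : AEStronglyMeasurable K)
    (hK : Integrable fun X => ‖K X‖ * Real.exp (κ * phaseRpow (1 / s) X)) :
    synthesis K ∈ GS d s ∧ ∀ α y, iterPartial α (synthesis K) y =
      ∫ X, K X * iterPartial α (windowShift X.fst X.snd) y := by
  obtain ⟨h, C, -, hh, hC, hW⟩ := exists_monoDeriv_windowShift_le (d := d) hs hκ 0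
  have hderiv := hasFDerivAt_synthesisDeriv hs hκ hKm hK
  have h0 : synthesis K = synthesisDeriv K 0 := by
    funext y
    simp only [synthesis, synthesisDeriv, iterPartial_zero]
  have hiter : ∀ α, iterPartial α (synthesis K) = synthesisDeriv K α := fun α => by
    rw [h0, iterPartial_of_hasFDerivAt_covector hderiv, zero_add]
  have hsmooth : ContDiff ℝ (⊤ : ℕ∞) (synthesis K) := by
    rw [h0]
    exact contDiff_of_hasFDerivAt_covector hderiv 0
  refine ⟨mem_GS_iff.2 ⟨hsmooth, h, hh, (gsNorm_lt_top_iff hh _).2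
    ⟨C * ∫ X, ‖K X‖ * Real.exp (κ * phaseRpow (1 / s) X), fun α β y => ?_⟩⟩,
    fun α y => by rw [hiter]; rfl⟩
  have hint0 : Integrable fun X => C * gsFactor s h α β *
      (‖K X‖ * Real.exp (κ * phaseRpow (1 / s) X)) := hK.const_mul _
  calc monoDeriv (synthesis K) α β y
      = ‖∫ X, (∏ i, (y i : ℂ) ^ β i) * (K X * iterPartial α (windowShift X.fst X.snd) y)‖ := by
        rw [integral_const_mul, norm_mul, monoDeriv, hiter]
        congr 1
        simp [norm_prod]
    _ ≤ ∫ X, C * gsFactor s h α β * (‖K X‖ * Real.exp (κ * phaseRpow (1 / s) X)) := by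
        refine norm_integral_le_of_norm_le hint0 (ae_of_all _ fun X => ?_)
        have := hW X α β y
        rw [monoDeriv] at this
        calc _ = ‖K X‖ * (‖∏ i, y i ^ β i‖ * ‖iterPartial α (windowShift X.fst X.snd) y‖) := by
              rw [norm_mul, norm_mul]
              simp only [norm_prod, norm_pow, Complex.norm_real]
              ring
          _ ≤ ‖K X‖ * (C * gsFactor s h α β * Real.exp (κ * phaseRpow (1 / s) X)) := by gcongr
          _ = _ := by ring
    _ = _ := by rw [integral_const_mul]; ring

end Synthesis

/-! ### Distributions as functionals on bounded families -/

section Embedding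

/-- Bounded families of complex numbers. -/
abbrev BddFamily (I : Type*) : Type _ := lp (fun _ : I => ℂ) ∞

variable {I : Type*}

/-- A locally bounded family of entire functions is continuous for the uniform norm. -/
theorem continuous_of_differentiable_coord {E : Type*} [NormedAddCommGroup E] [NormedSpace ℂ E]
    {u : E → BddFamily I} (hd : ∀ i, Differentiable ℂ fun a => u a i)
    (hb : ∀ a, ∃ M, ∀ b ∈ Metric.ball a 1, ‖u b‖ ≤ M) : Continuous u := by
  refine continuous_iff_continuousAt.2 fun a => ?_
  obtain ⟨M, hM⟩ := hb a
  have hM0 : 0 ≤ M := (norm_nonneg _).trans (hM a (Metric.mem_ball_self one_pos))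
  have key : ∀ b ∈ Metric.ball a 1, ‖u b - u a‖ ≤ 2 * M * dist b a := by
    intro b hb'
    refine lp.norm_le_of_forall_le (by positivity) fun i => ?_
    -- The Schwarz lemma bounds each coordinate by the same Lipschitz constant, which is what makes
    -- the continuity uniform in the index.
    have := Complex.dist_le_div_mul_dist_of_mapsTo_ball (f := fun a => u a i) (c := a) (z := b)
      (R₁ := 1) (R₂ := 2 * M) (hd i).differentiableOn (fun c hc => ?_) hb'
    · rw [div_one, dist_eq_norm] at this
      exact this
    · rw [mem_closedBall_iff_norm]
      have h1 := (lp.norm_apply_le_norm ENNReal.top_ne_zero (u c) i).trans (hM c hc)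
      have h2 := (lp.norm_apply_le_norm ENNReal.top_ne_zero (u a) i).trans
        (hM a (Metric.mem_ball_self one_pos))
      exact (norm_sub_le _ _).trans (by linarith)
  rw [ContinuousAt, tendsto_iff_norm_sub_tendsto_zero]
  have h0 : Filter.Tendsto (fun b => 2 * M * dist b a) (nhds a) (nhds 0) := by
    have : Continuous fun b => 2 * M * dist b a := by fun_prop
    simpa using this.tendsto a
  refine squeeze_zero' (Filter.Eventually.of_forall fun _ => norm_nonneg _) ?_ h0
  filter_upwards [Metric.ball_mem_nhds a one_pos] with b hb' using key b hb'

/-- A locally bounded family of entire functions is holomorphic for the uniform norm. -/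
theorem differentiable_of_differentiable_coord {u : ℂ → BddFamily I}
    (hd : ∀ i, Differentiable ℂ fun τ => u τ i)
    (hb : ∀ a, ∃ M, ∀ b ∈ Metric.ball a 1, ‖u b‖ ≤ M) : Differentiable ℂ u := by
  intro a
  obtain ⟨M, hM⟩ := hb a
  have hM0 : 0 ≤ M := (norm_nonneg _).trans (hM a (Metric.mem_ball_self one_pos))
  have hMi : ∀ i, ∀ b ∈ Metric.ball a 1, ‖u b i‖ ≤ M := fun i b hb' =>
    (lp.norm_apply_le_norm ENNReal.top_ne_zero (u b) i).trans (hM b hb')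
  have hder : ∀ i, ‖deriv (fun τ => u τ i) a‖ ≤ 2 * M := by
    intro i
    have := Complex.norm_deriv_le_div_of_mapsTo_ball (f := fun τ => u τ i) (c := a)
      (R₁ := 1) (R₂ := 2 * M) (hd i).differentiableOn (fun c hc => ?_) one_pos
    · simpa using this
    · rw [mem_closedBall_iff_norm]
      exact (norm_sub_le _ _).trans
        (by linarith [hMi i c hc, hMi i a (Metric.mem_ball_self one_pos)])
  -- The candidate derivative is taken coordinatewise; the Cauchy bound 2M makes it a bounded
  -- family.
  set D : BddFamily I := ⟨fun i => deriv (fun τ => u τ i) a,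
    memℓp_infty ⟨2 * M, by rintro _ ⟨i, rfl⟩; exact hder i⟩⟩ with hD
  have key : ∀ b ∈ Metric.ball a 1, ‖u b - u a - (b - a) • D‖ ≤ 4 * M * ‖b - a‖ ^ 2 := by
    intro b hb'
    refine lp.norm_le_of_forall_le (by positivity) fun i => ?_
    have h1 : HasDerivAt (fun τ => u τ i) (D i) a := ((hd i) a).hasDerivAt
    -- Once the linear part is subtracted, the coordinate vanishes to second order at a while
    -- staying within 4M, so a higher-order Schwarz lemma gives a quadratic remainder independent of
    -- the index.
    have := Complex.dist_le_mul_div_pow_of_mapsTo_ball_of_isLittleO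
      (f := fun τ => u τ i - (τ - a) * D i) (c := a) (z := b) (R₁ := 1) (R₂ := 4 * M) (n := 1)
      ((hd i).sub (by fun_prop)).differentiableOn (fun c hc => ?_) ?_ hb'
    · rw [div_one, dist_eq_norm, dist_eq_norm] at this
      refine le_trans (le_of_eq ?_) this
      congr 1
      change u b i - u a i - (b - a) * D i = _
      ring
    · rw [mem_closedBall_iff_norm]
      have h3 : ‖c - a‖ ≤ 1 := (mem_ball_iff_norm.1 hc).le
      have h4 : ‖(c - a) * D i‖ ≤ 2 * M := by
        rw [norm_mul]
        calc ‖c - a‖ * ‖D i‖ ≤ 1 * (2 * M) := by gcongr; exact hder i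
          _ = _ := one_mul _
      have e : u c i - (c - a) * D i - (u a i - (a - a) * D i) = u c i - u a i - (c - a) * D i := by
        ring
      rw [e]
      refine (norm_sub_le _ _).trans ((add_le_add_left (norm_sub_le _ _) _).trans ?_)
      linarith [hMi i c hc, hMi i a (Metric.mem_ball_self one_pos)]
    · have h2 := hasDerivAt_iff_isLittleO.1 h1
      simp only [pow_one]
      refine (h2.norm_right).congr_left fun τ => ?_
      simp
      ring
  refine HasDerivAt.differentiableAt (f' := D) (hasDerivAt_iff_isLittleO.2 ?_)
  refine Asymptotics.isLittleO_iff.2 fun c hc => ?_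
  have h1 : 0 < c / (4 * M + 1) := by positivity
  filter_upwards [Metric.ball_mem_nhds a one_pos, Metric.ball_mem_nhds a h1] with b hb1 hb2
  refine (key b hb1).trans ?_
  rw [mem_ball_iff_norm, lt_div_iff₀ (by positivity)] at hb2
  nlinarith [norm_nonneg (b - a)]

variable {d : ℕ}

/-- The set of indices `(α, β, y)` of the seminorm family `|y^β ∂^α f(y)|`. -/
abbrev GSIndex (d : ℕ) : Type := (Fin d → ℕ) × (Fin d → ℕ) × Rd d

/-- The normalized value `y^β ∂^α φ(y) / (h^{|α|+|β|} (α! β!)^{1/2})`. -/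
def gsCoord (h : ℝ) (φ : Rd d → ℂ) (i : GSIndex d) : ℂ :=
  (∏ k, (i.2.2 k : ℂ) ^ i.2.1 k) * iterPartial i.1 φ i.2.2 /
    (gsFactor (1 / 2) h i.1 i.2.1 : ℝ)

theorem norm_gsCoord {h : ℝ} (hh : 0 < h) (φ : Rd d → ℂ) (i : GSIndex d) :
    ‖gsCoord h φ i‖ = monoDeriv φ i.1 i.2.1 i.2.2 / gsFactor (1 / 2) h i.1 i.2.1 := by
  rw [gsCoord, norm_div, norm_mul, Complex.norm_real,
    Real.norm_of_nonneg (gsFactor_pos hh _ _).le, monoDeriv]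
  simp [norm_prod]

theorem gsCoord_zero_zero (h : ℝ) (φ : Rd d → ℂ) (y : Rd d) : gsCoord h φ (0, 0, y) = φ y := by
  simp [gsCoord, iterPartial_zero, gsFactor]

theorem gsCoord_add (h : ℝ) {φ ψ : Rd d → ℂ} (hφ : ContDiff ℝ (⊤ : ℕ∞) φ)
    (hψ : ContDiff ℝ (⊤ : ℕ∞) ψ) (i : GSIndex d) :
    gsCoord h (φ + ψ) i = gsCoord h φ i + gsCoord h ψ i := by
  rw [gsCoord, iterPartial, listPartial_add hφ hψ]
  simp only [gsCoord, iterPartial, Pi.add_apply]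
  ring

theorem gsCoord_smul (h : ℝ) (c : ℂ) {φ : Rd d → ℂ} (hφ : ContDiff ℝ (⊤ : ℕ∞) φ) (i : GSIndex d) :
    gsCoord h (c • φ) i = c * gsCoord h φ i := by
  rw [gsCoord, iterPartial, listPartial_smul c hφ]
  simp only [gsCoord, iterPartial, Pi.smul_apply, smul_eq_mul]
  ring

/-- A Gelfand-Shilov distribution extends to a bounded functional of the families of normalized
values of derivatives. -/
theorem GSDual.exists_extension (f : GSDual d (1 / 2)) {h : ℝ} (hh : 0 < h) :
    ∃ g : BddFamily (GSIndex d) →L[ℂ] ℂ, ∀ (φ : GS d (1 / 2)) (L : BddFamily (GSIndex d)),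
      (∀ i, L i = gsCoord h φ i) → f.toLin φ = g L := by
  obtain ⟨C, hC⟩ := f.bound h hh
  let p : Submodule ℂ (BddFamily (GSIndex d)) :=
    { carrier := {L | ∃ φ : GS d (1 / 2), ∀ i, L i = gsCoord h φ i}
      zero_mem' := ⟨0, fun i => by
        have := gsCoord_smul h 0 (0 : GS d (1 / 2)).2.1 i
        simpa using this.symm⟩
      add_mem' := by
        rintro L L' ⟨φ, hφ⟩ ⟨ψ, hψ⟩
        exact ⟨φ + ψ, fun i => by
          rw [lp.coeFn_add, Pi.add_apply, hφ, hψ]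
          exact (gsCoord_add h φ.2.1 ψ.2.1 i).symm⟩
      smul_mem' := by
        rintro c L ⟨φ, hφ⟩
        exact ⟨c • φ, fun i => by
          rw [lp.coeFn_smul, Pi.smul_apply, hφ, smul_eq_mul]
          exact (gsCoord_smul h c φ.2.1 i).symm⟩ }
  -- The coordinates with α = β = 0 are the values of φ, so the family determines the function and
  -- the functional on `p` is well defined.
  have huniq : ∀ (φ ψ : GS d (1 / 2)) (L : BddFamily (GSIndex d)),
      (∀ i, L i = gsCoord h φ i) → (∀ i, L i = gsCoord h ψ i) → φ = ψ := by
    intro φ ψ L h1 h2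
    apply Subtype.ext
    funext y
    rw [← gsCoord_zero_zero h φ y, ← gsCoord_zero_zero h ψ y, ← h1, ← h2]
  choose r hr using fun L : p => L.2
  let g₀ : p →ₗ[ℂ] ℂ :=
    { toFun := fun L => f.toLin (r L)
      map_add' := fun L L' => by
        rw [← map_add]
        congr 1
        refine huniq _ _ _ (hr (L + L')) fun i => ?_
        rw [Submodule.coe_add, lp.coeFn_add, Pi.add_apply, hr, hr]
        exact (gsCoord_add h (r L).2.1 (r L').2.1 i).symm
      map_smul' := fun c L => by
        rw [RingHom.id_apply, ← map_smul]
        congr 1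
        refine huniq _ _ _ (hr (c • L)) fun i => ?_
        rw [Submodule.coe_smul, lp.coeFn_smul, Pi.smul_apply, hr, smul_eq_mul]
        exact (gsCoord_smul h c (r L).2.1 i).symm }
  have hbound : ∀ L : p, ‖g₀ L‖ ≤ |C| * ‖L‖ := by
    intro L
    have hle : gsNorm (1 / 2) h (r L : Rd d → ℂ) ≤ ENNReal.ofReal ‖L‖ := by
      refine iSup_le fun α => iSup_le fun β => iSup_le fun y => ENNReal.ofReal_le_ofReal ?_
      have h1 := lp.norm_apply_le_norm ENNReal.top_ne_zero (L : BddFamily (GSIndex d)) (α, β, y)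
      rw [hr L, norm_gsCoord hh] at h1
      exact h1
    refine (hC (r L) (hle.trans_lt ENNReal.ofReal_lt_top)).trans ?_
    have h2 : (gsNorm (1 / 2) h (r L : Rd d → ℂ)).toReal ≤ ‖L‖ :=
      ENNReal.toReal_le_of_le_ofReal (norm_nonneg _) hle
    exact mul_le_mul (le_abs_self C) h2 ENNReal.toReal_nonneg (abs_nonneg C)
  -- Hahn-Banach. In the ambient Banach space, Bochner integrals and holomorphic maps are available
  -- without any topology on S_{1/2} itself.
  obtain ⟨g, hg, -⟩ := exists_extension_norm_eq p (g₀.mkContinuous |C| hbound)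
  refine ⟨g, fun φ L hL => ?_⟩
  have h1 := hg ⟨L, φ, hL⟩
  rw [h1]
  change _ = f.toLin (r ⟨L, φ, hL⟩)
  exact congrArg f.toLin (huniq φ (r ⟨L, φ, hL⟩) L hL (hr ⟨L, φ, hL⟩))

theorem gaussExp_mem (a : Fin d → ℂ) : gaussExp a ∈ GS d (1 / 2) := prodFun_gaussR_mem a

theorem monoDeriv_gaussExp_le (a : Fin d → ℂ) (α β : Fin d → ℕ) (y : Rd d) :
    monoDeriv (gaussExp a) α β y ≤
      (∏ i, Real.exp (3 + 3 * ‖a i‖ ^ 2)) * gsFactor (1 / 2) (Real.exp 3) α β := by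
  rw [monoDeriv, iterPartial_gaussExp, prodFun, gsFactor_eq_prod, ← Finset.prod_mul_distrib,
    norm_prod, norm_prod, ← Finset.prod_mul_distrib]
  refine Finset.prod_le_prod (fun i _ => by positivity) fun i _ => ?_
  have := gaussR_bound (a i) (α i) (β i) (y i)
  simpa [norm_pow] using this

theorem norm_gsCoord_gaussExp_le {h : ℝ} (hh : Real.exp 3 ≤ h) (a : Fin d → ℂ) (i : GSIndex d) :
    ‖gsCoord h (gaussExp a) i‖ ≤ ∏ i, Real.exp (3 + 3 * ‖a i‖ ^ 2) := by
  have hh0 : 0 < h := (Real.exp_pos 3).trans_le hh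
  rw [norm_gsCoord hh0, div_le_iff₀ (gsFactor_pos hh0 _ _)]
  refine (monoDeriv_gaussExp_le a _ _ _).trans ?_
  gcongr
  exact gsFactor_mono (Real.exp_pos 3) hh le_rfl _ _

/-- The Gaussian `gaussExp a` as a bounded family of normalized values of derivatives. -/
def gaussFamily {h : ℝ} (hh : Real.exp 3 ≤ h) (a : Fin d → ℂ) : BddFamily (GSIndex d) :=
  ⟨gsCoord h (gaussExp a), memℓp_infty ⟨_, by
    rintro _ ⟨i, rfl⟩; exact norm_gsCoord_gaussExp_le hh a i⟩⟩

theorem gaussFamily_apply {h : ℝ} (hh : Real.exp 3 ≤ h) (a : Fin d → ℂ) (i : GSIndex d) :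
    gaussFamily hh a i = gsCoord h (gaussExp a) i := rfl

theorem norm_gaussFamily_le {h : ℝ} (hh : Real.exp 3 ≤ h) (a : Fin d → ℂ) :
    ‖gaussFamily hh a‖ ≤ ∏ i, Real.exp (3 + 3 * ‖a i‖ ^ 2) :=
  lp.norm_le_of_forall_le (Finset.prod_nonneg fun _ _ => (Real.exp_pos _).le)
    (norm_gsCoord_gaussExp_le hh a)

theorem exists_norm_gaussFamily_le {h : ℝ} (hh : Real.exp 3 ≤ h) (R : ℝ) :
    ∃ M, ∀ a : Fin d → ℂ, ‖a‖ ≤ R → ‖gaussFamily hh a‖ ≤ M := by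
  refine ⟨∏ _i : Fin d, Real.exp (3 + 3 * R ^ 2), fun a ha => (norm_gaussFamily_le hh a).trans ?_⟩
  gcongr with i
  exact (norm_le_pi_norm a i).trans ha

theorem differentiable_gaussFamily_coord {h : ℝ} (hh : Real.exp 3 ≤ h) (i : GSIndex d) :
    Differentiable ℂ fun a : Fin d → ℂ => gaussFamily hh a i := by
  simp_rw [gaussFamily_apply, gsCoord, div_eq_mul_inv]
  exact ((differentiable_iterPartial_gaussExp i.1 i.2.2).const_mul _).mul_const _

theorem continuous_gaussFamily {h : ℝ} (hh : Real.exp 3 ≤ h) :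
    Continuous (gaussFamily hh : (Fin d → ℂ) → BddFamily (GSIndex d)) := by
  refine continuous_of_differentiable_coord (differentiable_gaussFamily_coord hh) fun a => ?_
  obtain ⟨M, hM⟩ := exists_norm_gaussFamily_le (d := d) hh (‖a‖ + 1)
  refine ⟨M, fun b hb => hM b ?_⟩
  have := norm_sub_norm_le b a
  linarith [mem_ball_iff_norm.1 hb]

theorem differentiable_gaussFamily_line {h : ℝ} (hh : Real.exp 3 ≤ h) (a b : Fin d → ℂ) :
    Differentiable ℂ fun τ : ℂ => gaussFamily hh (a + τ • b) := by
  refine differentiable_of_differentiable_coord (fun i => ?_) fun τ => ?_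
  · exact (differentiable_gaussFamily_coord hh i).comp (by fun_prop)
  · obtain ⟨M, hM⟩ := exists_norm_gaussFamily_le (d := d) hh (‖a‖ + (‖τ‖ + 1) * ‖b‖)
    refine ⟨M, fun σ hσ => hM _ ?_⟩
    refine (norm_add_le _ _).trans ?_
    rw [norm_smul]
    gcongr
    have := norm_sub_norm_le σ τ
    linarith [mem_ball_iff_norm.1 hσ]

/-- The values of a distribution at Gaussians form an entire function along complex lines. -/
theorem GSDual.differentiable_apply_gaussExp (f : GSDual d (1 / 2)) (a b : Fin d → ℂ) :
    Differentiable ℂ fun τ : ℂ => f.toLin ⟨gaussExp (a + τ • b), gaussExp_mem _⟩ := by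
  obtain ⟨g, hg⟩ := f.exists_extension (Real.exp_pos 3)
  have : (fun τ : ℂ => f.toLin ⟨gaussExp (a + τ • b), gaussExp_mem _⟩) =
      fun τ => g (gaussFamily le_rfl (a + τ • b)) :=
    funext fun τ => hg _ _ fun i => rfl
  rw [this]
  exact g.differentiable.comp (differentiable_gaussFamily_line le_rfl a b)

theorem GSDual.continuous_apply_gaussExp (f : GSDual d (1 / 2)) :
    Continuous fun a : Fin d → ℂ => f.toLin ⟨gaussExp a, gaussExp_mem a⟩ := by
  obtain ⟨g, hg⟩ := f.exists_extension (Real.exp_pos 3)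
  have : (fun a : Fin d → ℂ => f.toLin ⟨gaussExp a, gaussExp_mem a⟩) =
      fun a => g (gaussFamily le_rfl a) := funext fun a => hg _ _ fun i => rfl
  rw [this]
  exact g.continuous.comp (continuous_gaussFamily le_rfl)

theorem GSDual.apply_windowShift (f : GSDual d (1 / 2)) (X : R2d d) :
    f.toLin ⟨windowShift X.fst X.snd, windowShift_mem X.fst X.snd⟩ =
      (shiftFactor X.fst : ℂ) * f.toLin ⟨gaussExp (phaseParam X), gaussExp_mem _⟩ := by
  rw [← smul_eq_mul, ← map_smul]
  congr 1
  exact Subtype.ext (windowShift_eq_smul_gaussExp X)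

theorem GSDual.continuous_apply_windowShift (f : GSDual d (1 / 2)) :
    Continuous fun X : R2d d =>
      f.toLin ⟨windowShift X.fst X.snd, windowShift_mem X.fst X.snd⟩ := by
  simp_rw [f.apply_windowShift]
  have h1 : Continuous fun X : R2d d => X.fst := WithLp.continuous_fst 2 _ _
  exact (Complex.continuous_ofReal.comp (continuous_shiftFactor.comp h1)).mul
    (f.continuous_apply_gaussExp.comp continuous_phaseParam)

/-- A distribution can be applied under the integral sign of a superposition of time-frequency
shifts. -/
theorem GSDual.apply_synthesis (f : GSDual d (1 / 2)) {κ : ℝ} (hκ : 0 < κ) {K : R2d d → ℂ}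
    (hKm : AEStronglyMeasurable K)
    (hK : Integrable fun X => ‖K X‖ * Real.exp (κ * phaseRpow (1 / (1 / 2)) X))
    (hmem : synthesis K ∈ GS d (1 / 2)) :
    f.toLin ⟨synthesis K, hmem⟩ =
      ∫ X, K X * f.toLin ⟨windowShift X.fst X.snd, windowShift_mem X.fst X.snd⟩ := by
  -- This h is large in two respects: at least e³, so that the Gaussians form bounded families, and
  -- adapted to κ, so that the shifted windows grow no faster than `hK` permits.
  obtain ⟨h, C, hh, hh0, hC, hW⟩ := exists_monoDeriv_windowShift_le (d := d) le_rfl hκ (Real.exp 3)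
  obtain ⟨g, hg⟩ := f.exists_extension hh0
  set Ψ : R2d d → BddFamily (GSIndex d) := fun X =>
    (shiftFactor X.fst : ℂ) • gaussFamily hh (phaseParam X) with hΨ
  have hΨcoord : ∀ X i, Ψ X i = gsCoord h (windowShift X.fst X.snd) i := by
    intro X i
    rw [windowShift_eq_smul_gaussExp, gsCoord_smul h _ (contDiff_gaussExp _)]
    rfl
  have hΨc : Continuous Ψ := by
    have h1 : Continuous fun X : R2d d => X.fst := WithLp.continuous_fst 2 _ _
    exact (Complex.continuous_ofReal.comp (continuous_shiftFactor.comp h1)).smul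
      ((continuous_gaussFamily hh).comp continuous_phaseParam)
  have hΨb : ∀ X, ‖Ψ X‖ ≤ C * Real.exp (κ * phaseRpow (1 / (1 / 2)) X) := by
    intro X
    refine lp.norm_le_of_forall_le (by positivity) fun i => ?_
    rw [hΨcoord, norm_gsCoord hh0, div_le_iff₀ (gsFactor_pos hh0 _ _)]
    refine (hW X _ _ _).trans_eq ?_
    ring
  have hint : Integrable fun X => K X • Ψ X := by
    refine (hK.const_mul C).mono' (hKm.smul hΨc.aestronglyMeasurable) (ae_of_all _ fun X => ?_)
    rw [norm_smul]
    calc ‖K X‖ * ‖Ψ X‖ ≤ ‖K X‖ * (C * Real.exp (κ * phaseRpow (1 / (1 / 2)) X)) := by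
          gcongr; exact hΨb X
      _ = _ := by ring
  have hderiv := (synthesis_mem_GS le_rfl hκ hKm hK).2
  -- Coordinate evaluations are continuous and commute with the Bochner integral, which is thereby
  -- identified with the family of the superposition.
  have hcoord : ∀ i, (∫ X, K X • Ψ X) i = gsCoord h (synthesis K) i := by
    intro i
    have h1 := ContinuousLinearMap.integral_comp_comm
      (lp.evalCLM ℂ (fun _ : GSIndex d => ℂ) ∞ i) hint
    refine Eq.trans (Eq.symm h1) ?_
    rw [gsCoord, hderiv, ← integral_const_mul, ← integral_div]
    refine integral_congr_ae (ae_of_all _ fun X => ?_)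
    change (K X • Ψ X) i = _
    rw [lp.coeFn_smul, Pi.smul_apply, hΨcoord, gsCoord, smul_eq_mul]
    ring
  rw [hg ⟨synthesis K, hmem⟩ _ hcoord, ← ContinuousLinearMap.integral_comp_comm g hint]
  refine integral_congr_ae (ae_of_all _ fun X => ?_)
  simp only [map_smul, smul_eq_mul]
  rw [hg ⟨windowShift X.fst X.snd, windowShift_mem _ _⟩ (Ψ X) (hΨcoord X)]

end Embedding

/-! ### Fourier inversion and recovery from the transform -/

section Inversion

variable {d : ℕ}

theorem fourierInv_two_pi_inv_smul (g : Rd d → ℂ) (ξ : Rd d) :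
    FourierTransformInv.fourierInv g ((2 * Real.pi)⁻¹ • ξ) =
      ∫ y, g y * Complex.exp (Complex.I * ((inner ℝ y ξ : ℝ) : ℂ)) := by
  rw [Real.fourierInv_eq]
  refine integral_congr_ae (ae_of_all _ fun y => ?_)
  simp only [Circle.smul_def, Real.fourierChar_apply, smul_eq_mul, inner_smul_right]
  rw [mul_comm]
  congr 2
  push_cast
  have : (Real.pi : ℂ) ≠ 0 := by exact_mod_cast Real.pi_ne_zero
  field_simp

/-- Fourier inversion without the factor `2π` in the exponent. -/
theorem integral_fourier_mul_exp {g : Rd d → ℂ} (hg : Continuous g) (hgi : Integrable g)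
    (hA : Integrable fun ξ : Rd d => ∫ y, g y * Complex.exp (Complex.I * ((inner ℝ y ξ : ℝ) : ℂ)))
    (y : Rd d) :
    ∫ ξ : Rd d, (∫ z, g z * Complex.exp (Complex.I * ((inner ℝ z ξ : ℝ) : ℂ))) *
      Complex.exp (-Complex.I * ((inner ℝ y ξ : ℝ) : ℂ)) = ((2 * Real.pi) ^ d : ℝ) * g y := by
  have hpi : (0 : ℝ) < 2 * Real.pi := by positivity
  simp_rw [← fourierInv_two_pi_inv_smul] at hA ⊢
  have h1 : Integrable (FourierTransformInv.fourierInv g) :=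
    (integrable_comp_smul_iff volume (FourierTransformInv.fourierInv g)
      (inv_ne_zero hpi.ne')).1 hA
  have h2 : Integrable (FourierTransform.fourier g) := by
    have h3 := h1.comp_neg
    refine h3.congr (ae_of_all _ fun w => ?_)
    simp only [Real.fourierInv_eq_fourier_neg, neg_neg]
  have key := congrFun (hg.fourier_fourierInv_eq hgi h2) y
  rw [Real.fourier_eq] at key
  -- Rescaling the frequency by 2π passes between the two conventions for the Fourier transform and
  -- produces the factor (2π)^d.
  have h4 := Measure.integral_comp_inv_smul_of_nonneg (volume : Measure (Rd d))
    (fun w => Real.fourierChar (-inner ℝ w y) • FourierTransformInv.fourierInv g w) hpi.le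
  rw [key, finrank_euclideanSpace_fin] at h4
  rw [← Complex.real_smul, ← h4]
  refine integral_congr_ae (ae_of_all _ fun ξ => ?_)
  simp only [Circle.smul_def, Real.fourierChar_apply, smul_eq_mul, inner_smul_left]
  rw [mul_comm, real_inner_comm]
  congr 2
  simp only [map_inv₀]
  push_cast
  have : (Real.pi : ℂ) ≠ 0 := by exact_mod_cast Real.pi_ne_zero
  simp
  field_simp

theorem integral_windowShift_mul_self (y : Rd d) :
    ∫ x : Rd d, windowShift x 0 y * windowShift x 0 y = 1 := by
  have e : ∀ x : Rd d, windowShift x 0 y * windowShift x 0 y =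
      ((Real.pi ^ (-(d : ℝ) / 2) * Real.exp (-1 * ‖y - x‖ ^ 2) : ℝ) : ℂ) := by
    intro x
    simp only [windowShift, gaussWindow, Complex.conj_ofReal, inner_zero_right,
      Complex.ofReal_zero, mul_zero, Complex.exp_zero, mul_one]
    rw [← Complex.ofReal_mul]
    congr 1
    rw [mul_mul_mul_comm, ← Real.exp_add, ← Real.rpow_add Real.pi_pos]
    congr 2 <;> ring
  simp_rw [e]
  rw [integral_complex_ofReal, integral_const_mul,
    integral_sub_left_eq_self (fun u : Rd d => Real.exp (-1 * ‖u‖ ^ 2)),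
    GaussianFourier.integral_rexp_neg_mul_sq_norm one_pos, finrank_euclideanSpace_fin, div_one,
    ← Real.rpow_add Real.pi_pos]
  simp [neg_div]

theorem continuous_windowShift_param (y : Rd d) :
    Continuous fun X : R2d d => windowShift X.fst (-X.snd) y := by
  have h1 : Continuous fun X : R2d d => X.fst := WithLp.continuous_fst 2 _ _
  have h2 : Continuous fun X : R2d d => X.snd := WithLp.continuous_snd 2 _ _
  simp only [windowShift, gaussWindow, Complex.conj_ofReal]
  fun_prop

theorem norm_windowShift_le (x ξ y : Rd d) : ‖windowShift x ξ y‖ ≤ Real.pi ^ (-(d : ℝ) / 4) := by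
  rw [norm_windowShift, windowShift_zero_right, norm_windowShift_zero]
  refine mul_le_of_le_one_right (by positivity) (Real.exp_le_one_iff.2 ?_)
  have := sq_nonneg ‖y - x‖
  linarith

theorem continuous_analysis {φ : Rd d → ℂ} (hφ : Integrable φ) : Continuous (analysis φ) := by
  refine continuous_of_dominated (bound := fun y => ‖φ y‖ * Real.pi ^ (-(d : ℝ) / 4))
    (fun X => hφ.1.mul (continuous_windowShift _ _).aestronglyMeasurable)
    (fun X => ae_of_all _ fun y => ?_) (hφ.norm.mul_const _)
    (ae_of_all _ fun y => (continuous_windowShift_param y).const_mul _)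
  rw [norm_mul]
  gcongr
  exact norm_windowShift_le _ _ _

theorem exists_norm_analysis_le_of_mem {s : ℝ} (hs : 1 / 2 ≤ s) {φ : Rd d → ℂ} (hφ : φ ∈ GS d s) :
    ∃ C r : ℝ, 0 < r ∧ ∀ X, ‖analysis φ X‖ ≤ C * Real.exp (-(r * phaseRpow (1 / s) X)) := by
  obtain ⟨hc, h, hh, hn⟩ := hφ
  obtain ⟨B, hB⟩ := (gsNorm_lt_top_iff hh φ).1 hn
  obtain ⟨C, r, -, hr, H⟩ := exists_norm_analysis_le (d := d) hs hh
  exact ⟨C * B, r, hr, H φ hc B hB⟩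

theorem exists_integrable_analysis {s : ℝ} (hs : 1 / 2 ≤ s) {φ : Rd d → ℂ} (hφ : φ ∈ GS d s) :
    ∃ κ : ℝ, 0 < κ ∧
      Integrable fun X => ‖analysis φ X‖ * Real.exp (κ * phaseRpow (1 / s) X) := by
  obtain ⟨C, r, hr, H⟩ := exists_norm_analysis_le_of_mem hs hφ
  have hq : 0 < 1 / s := by
    have : 0 < s := by linarith
    positivity
  refine ⟨r / 2, by positivity, ?_⟩
  refine ((integrable_exp_neg_phaseRpow (d := d) (half_pos hr) hq).const_mul C).mono'
    (((continuous_analysis (integrable_of_mem_GS hφ)).norm.mul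
      ((continuous_phaseRpow hq).const_mul _).rexp).aestronglyMeasurable)
    (ae_of_all _ fun X => ?_)
  rw [Real.norm_of_nonneg (by positivity)]
  calc _ ≤ C * Real.exp (-(r * phaseRpow (1 / s) X)) * Real.exp (r / 2 * phaseRpow (1 / s) X) := by
        gcongr; exact H X
    _ = _ := by rw [mul_assoc, ← Real.exp_add]; congr 2; ring

theorem integrable_analysis {s : ℝ} (hs : 1 / 2 ≤ s) {φ : Rd d → ℂ} (hφ : φ ∈ GS d s) :
    Integrable (analysis φ) := by
  obtain ⟨κ, hκ, h⟩ := exists_integrable_analysis hs hφ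
  refine h.mono (continuous_analysis (integrable_of_mem_GS hφ)).aestronglyMeasurable
    (ae_of_all _ fun X => ?_)
  rw [norm_mul, norm_norm]
  refine le_mul_of_one_le_right (norm_nonneg _) ?_
  rw [Real.norm_of_nonneg (Real.exp_pos _).le]
  exact Real.one_le_exp (mul_nonneg hκ.le (phaseRpow_nonneg _ _))

/-- The inversion formula for the short-time Fourier transform of Gelfand-Shilov functions. -/
theorem synthesis_analysis {s : ℝ} (hs : 1 / 2 ≤ s) {φ : Rd d → ℂ} (hφ : φ ∈ GS d s) :
    synthesis (analysis φ) = (((2 * Real.pi) ^ d : ℝ) : ℂ) • φ := by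
  funext y
  have hi := integrable_analysis hs hφ
  have hmp := WithLp.volume_preserving_toLp (Rd d) (Rd d)
  have hemb : MeasurableEmbedding (WithLp.toLp 2 : Rd d × Rd d → R2d d) :=
    (MeasurableEquiv.toLp 2 (Rd d × Rd d)).measurableEmbedding
  have hi2 : Integrable fun p : Rd d × Rd d => analysis φ (WithLp.toLp 2 p) :=
    (hmp.integrable_comp_emb hemb).2 hi
  have hw : Continuous fun X : R2d d => windowShift X.fst X.snd y := by
    simpa [iterPartial_zero] using continuous_iterPartial_windowShift 0 y
  have hi3 : Integrable fun X : R2d d => analysis φ X * windowShift X.fst X.snd y := by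
    refine (hi.norm.mul_const (Real.pi ^ (-(d : ℝ) / 4))).mono'
      (hi.1.mul hw.aestronglyMeasurable) (ae_of_all _ fun X => ?_)
    rw [norm_mul]
    gcongr
    exact norm_windowShift_le _ _ _
  have hi4 : Integrable fun p : Rd d × Rd d =>
      analysis φ (WithLp.toLp 2 p) * windowShift p.1 p.2 y :=
    (hmp.integrable_comp_emb hemb).2 hi3
  have hg : ∀ x, Integrable fun y => φ y * windowShift x 0 y := fun x =>
    (integrable_of_mem_GS hφ).mul_bdd (c := Real.pi ^ (-(d : ℝ) / 4))
      (continuous_windowShift _ _).aestronglyMeasurable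
      (ae_of_all _ fun y => norm_windowShift_le _ _ _)
  rw [synthesis, ← hmp.integral_comp hemb]
  change ∫ p : Rd d × Rd d, analysis φ (WithLp.toLp 2 p) * windowShift p.1 p.2 y = _
  rw [Measure.volume_eq_prod, integral_prod _ hi4]
  -- For fixed x this is Fourier inversion for y ↦ φ(y)w(y - x). The integrability in ξ that it
  -- requires comes from Fubini, hence only for almost every x. The remaining integral in x is the
  -- squared L² norm of the window, which is one.
  have hinner : ∀ᵐ x : Rd d, ∫ ξ : Rd d, analysis φ (WithLp.toLp 2 (x, ξ)) * windowShift x ξ y =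
      ((2 * Real.pi) ^ d : ℝ) * φ y * (windowShift x 0 y * windowShift x 0 y) := by
    rw [Measure.volume_eq_prod] at hi2
    filter_upwards [hi2.prod_right_ae] with x hx
    have e : ∀ ξ : Rd d, analysis φ (WithLp.toLp 2 (x, ξ)) = ∫ z, φ z * windowShift x 0 z *
        Complex.exp (Complex.I * ((inner ℝ z ξ : ℝ) : ℂ)) := fun ξ => by
      simp only [analysis, windowShift_neg_right, mul_assoc]
      rfl
    simp_rw [e] at hx ⊢
    have e2 : ∀ ξ : Rd d, windowShift x ξ y = windowShift x 0 y *
        Complex.exp (-Complex.I * ((inner ℝ y ξ : ℝ) : ℂ)) := fun ξ => by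
      simp [windowShift]
    have := integral_fourier_mul_exp (hφ.1.continuous.mul (continuous_windowShift x 0)) (hg x) hx y
    calc _ = ∫ ξ : Rd d, windowShift x 0 y * ((∫ z, φ z * windowShift x 0 z *
          Complex.exp (Complex.I * ((inner ℝ z ξ : ℝ) : ℂ))) *
          Complex.exp (-Complex.I * ((inner ℝ y ξ : ℝ) : ℂ))) :=
          integral_congr_ae (ae_of_all _ fun ξ => by simp only; rw [e2]; ring)
      _ = windowShift x 0 y * (((2 * Real.pi) ^ d : ℝ) * (φ y * windowShift x 0 y)) := by
          rw [integral_const_mul]; exact congrArg _ this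
      _ = _ := by ring
  rw [integral_congr_ae hinner, integral_const_mul, integral_windowShift_mul_self, mul_one]
  rfl

/-- A distribution is recovered from its values at the shifted windows. -/
theorem GSDual.integral_analysis_mul_apply (f : GSDual d (1 / 2)) (φ : GS d (1 / 2)) :
    ∫ X, analysis (φ : Rd d → ℂ) X *
      f.toLin ⟨windowShift X.fst X.snd, windowShift_mem X.fst X.snd⟩ =
      ((2 * Real.pi) ^ d : ℝ) * f.toLin φ := by
  obtain ⟨κ, hκ, hi⟩ := exists_integrable_analysis le_rfl φ.2
  have hm : AEStronglyMeasurable (analysis (φ : Rd d → ℂ)) :=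
    (continuous_analysis (integrable_of_mem_GS φ.2)).aestronglyMeasurable
  rw [← f.apply_synthesis hκ hm hi (synthesis_mem_GS le_rfl hκ hm hi).1, ← smul_eq_mul, ← map_smul]
  congr 1
  exact Subtype.ext (synthesis_analysis le_rfl φ.2)

end Inversion

/-! ### Pointwise control by the mixed quasi-norm through holomorphy -/

section Pointwise

/-- A function which is the modulus of a holomorphic function on each complex line is comparable,
on some small ball in the unit ball, to a large constant in terms of its value at the origin. -/
theorem exists_ball_le_of_line_holomorphic {E : Type*} [NormedAddCommGroup E] [NormedSpace ℝ E]
    [ProperSpace E] {J : E → E} (hJ : ∀ U, ‖J U‖ = ‖U‖) {v : E → ℝ} (hv : Continuous v)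
    (hl : ∀ Z U, ∃ g : ℂ → ℂ, Differentiable ℂ g ∧
      ∀ τ : ℂ, v (Z + τ.re • U + τ.im • J U) = ‖g τ‖) (N : ℕ) :
    ∃ (Z₀ : E) (ρ : ℝ), 0 < ρ ∧ ρ ≤ 1 ∧ (∀ Z ∈ Metric.ball Z₀ ρ, ‖Z‖ < 1 ∧ v Z₀ / 2 ≤ v Z) ∧
      ((2 ^ (N + 5))⁻¹) ^ (N + 1) * v 0 ≤ v Z₀ * ρ ^ N := by
  have hv0 : ∀ Z, 0 ≤ v Z := fun Z => by
    obtain ⟨g, -, hg⟩ := hl Z 0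
    have := hg 0
    simp only [Complex.zero_re, Complex.zero_im, zero_smul, add_zero] at this
    rw [this]
    exact norm_nonneg _
  rcases (hv0 0).eq_or_lt with h0 | h0
  · refine ⟨0, 1, one_pos, le_rfl, fun Z hZ => ⟨by simpa using hZ, ?_⟩, ?_⟩
    · rw [← h0, zero_div]; exact hv0 Z
    · simp [← h0]
  -- Maximizing `v` against a power of the distance to the unit sphere gives a point where `v` at
  -- most grows by a factor 2^{N+1} on the ball of radius R/2. The exponent N + 1 is positive even
  -- for N = 0, so the maximum cannot sit on the sphere when v(0) > 0.
  obtain ⟨Z₀, hZ₀, hmax⟩ := (isCompact_closedBall (0 : E) 1).exists_isMaxOn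
    ⟨0, Metric.mem_closedBall_self zero_le_one⟩
    (f := fun Z => (1 - ‖Z‖) ^ (N + 1) * v Z) (by fun_prop)
  have hmax' : ∀ Z, ‖Z‖ ≤ 1 → (1 - ‖Z‖) ^ (N + 1) * v Z ≤ (1 - ‖Z₀‖) ^ (N + 1) * v Z₀ :=
    fun Z hZ => hmax (by simpa using hZ)
  have hZ₀1 : ‖Z₀‖ ≤ 1 := by simpa using hZ₀
  have hm0 : v 0 ≤ (1 - ‖Z₀‖) ^ (N + 1) * v Z₀ := by simpa using hmax' 0 (by simp)
  set R := 1 - ‖Z₀‖ with hR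
  have hR0 : 0 < R := by
    rcases (sub_nonneg.2 hZ₀1).eq_or_lt with h | h
    · rw [hR, ← h] at hm0
      simp at hm0
      linarith
    · exact h
  have hR1 : R ≤ 1 := by have := norm_nonneg Z₀; linarith
  set m := v Z₀ with hm
  -- With |U| < κR, complex multiples τU with |τ| ≤ 2^{N+3} have norm at most 2·2^{N+3}κR = R/2, so
  -- they stay where `v` is controlled.
  set κ : ℝ := (2 ^ (N + 5))⁻¹ with hκ
  have hκ0 : 0 < κ := by positivity
  have hκ1 : κ ≤ 1 / 2 := by
    rw [hκ, pow_succ, mul_inv]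
    have : ((2 : ℝ) ^ (N + 4))⁻¹ ≤ 1 := inv_le_one_of_one_le₀ (one_le_pow₀ (by norm_num))
    linarith
  have hκR : κ * R ≤ R / 2 := by nlinarith
  have hbig : ∀ Z, ‖Z - Z₀‖ ≤ R / 2 → v Z ≤ 2 ^ (N + 1) * m := by
    intro Z hZ
    have h1 : ‖Z‖ ≤ ‖Z₀‖ + R / 2 := by
      have := norm_sub_norm_le Z Z₀
      linarith
    have h2 : R / 2 ≤ 1 - ‖Z‖ := by linarith
    have h3 : (R / 2) ^ (N + 1) * v Z ≤ R ^ (N + 1) * m :=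
      le_trans (mul_le_mul_of_nonneg_right (pow_le_pow_left₀ (by positivity) h2 _) (hv0 Z))
        (hmax' Z (by linarith))
    rw [div_pow, div_mul_eq_mul_div, div_le_iff₀ (by positivity)] at h3
    have h4 : 0 < R ^ (N + 1) := by positivity
    refine le_of_mul_le_mul_left ?_ h4
    linarith
  refine ⟨Z₀, κ * R, by positivity, by nlinarith, fun Z hZ => ?_, ?_⟩
  · have hU : ‖Z - Z₀‖ < κ * R := mem_ball_iff_norm.1 hZ
    refine ⟨?_, ?_⟩
    · have := norm_sub_norm_le Z Z₀
      linarith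
    obtain ⟨g, hg, hgv⟩ := hl Z₀ (Z - Z₀)
    have hg0 : ‖g 0‖ = m := by rw [← hgv]; simp [hm]
    have hg1 : ‖g 1‖ = v Z := by rw [← hgv]; simp
    have hT : (1 : ℝ) < 2 ^ (N + 3) := one_lt_pow₀ (by norm_num) (by omega)
    -- On the disc of radius 2^{N+3}, g varies by at most 2^{N+2}m. The Schwarz lemma then gives
    -- |g(1) - g(0)| ≤ m/2, so at least half of the modulus survives.
    have key := Complex.dist_le_div_mul_dist_of_mapsTo_ball (f := g) (c := 0) (z := 1)
      (R₁ := 2 ^ (N + 3)) (R₂ := 2 ^ (N + 2) * m) hg.differentiableOn (fun τ hτ => ?_)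
      (by simpa using hT)
    · rw [dist_eq_norm, dist_eq_norm, sub_zero, norm_one, mul_one] at key
      have e : (2 : ℝ) ^ (N + 2) * m / 2 ^ (N + 3) = m / 2 := by
        rw [pow_succ (2 : ℝ) (N + 2)]
        field_simp
      rw [e] at key
      have := norm_sub_norm_le (g 0) (g 1)
      rw [norm_sub_rev] at this
      linarith
    · have hτ' : ‖τ‖ ≤ 2 ^ (N + 3) := by simpa using (Metric.mem_ball.1 hτ).le
      have h1 : ‖g τ‖ ≤ 2 ^ (N + 1) * m := by
        rw [← hgv]
        refine hbig _ ?_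
        have e : Z₀ + τ.re • (Z - Z₀) + τ.im • J (Z - Z₀) - Z₀ =
            τ.re • (Z - Z₀) + τ.im • J (Z - Z₀) := by abel
        rw [e]
        refine (norm_add_le _ _).trans ?_
        rw [norm_smul, norm_smul, hJ, Real.norm_eq_abs, Real.norm_eq_abs]
        calc |τ.re| * ‖Z - Z₀‖ + |τ.im| * ‖Z - Z₀‖ ≤
              2 ^ (N + 3) * (κ * R) + 2 ^ (N + 3) * (κ * R) := by
              gcongr
              · exact (Complex.abs_re_le_norm τ).trans hτ'
              · exact (Complex.abs_im_le_norm τ).trans hτ'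
          _ = R / 2 := by
              rw [hκ, show N + 5 = N + 3 + 2 from rfl, pow_add (2 : ℝ) (N + 3) 2]
              field_simp
              norm_num
      rw [mem_closedBall_iff_norm]
      refine (norm_sub_le _ _).trans ?_
      have h2 : m ≤ 2 ^ (N + 1) * m :=
        le_mul_of_one_le_left (hv0 _) (one_le_pow₀ (by norm_num))
      rw [hg0, pow_succ (2 : ℝ) (N + 1)]
      linarith
  · have h1 : (κ * R) ^ (N + 1) ≤ (κ * R) ^ N :=
      pow_le_pow_of_le_one (by positivity) (by nlinarith) (Nat.le_succ N)
    calc κ ^ (N + 1) * v 0 ≤ κ ^ (N + 1) * (R ^ (N + 1) * m) := by gcongr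
      _ = m * (κ * R) ^ (N + 1) := by rw [mul_pow]; ring
      _ ≤ _ := mul_le_mul_of_nonneg_left h1 (hv0 _)

variable {d : ℕ}

/-- Multiplication by the imaginary unit, in the complex coordinate `x - iξ` of phase space. -/
def phaseRotate (U : R2d d) : R2d d := WithLp.toLp 2 (U.snd, -U.fst)

theorem norm_phaseRotate (U : R2d d) : ‖phaseRotate U‖ = ‖U‖ := by
  rw [WithLp.prod_norm_eq_of_L2, WithLp.prod_norm_eq_of_L2]
  simp [phaseRotate, add_comm]

/-- Since i(x - iξ) = ξ - i(-x), the real planes spanned by U and its rotation are complex lines in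
the parameter of the Gaussians, along which a distribution acts holomorphically. -/
theorem phaseParam_line (Z U : R2d d) (τ : ℂ) :
    phaseParam (Z + τ.re • U + τ.im • phaseRotate U) = phaseParam Z + τ • phaseParam U := by
  funext i
  conv_rhs => rw [← Complex.re_add_im τ]
  have h1 : (phaseRotate U).fst = U.snd := rfl
  have h2 : (phaseRotate U).snd = -U.fst := rfl
  simp only [phaseParam, WithLp.add_fst, WithLp.smul_fst, WithLp.add_snd, WithLp.smul_snd, h1, h2,
    Pi.add_apply, Pi.smul_apply, PiLp.add_apply, PiLp.smul_apply, smul_eq_mul, PiLp.neg_apply]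
  push_cast
  linear_combination ((τ.im : ℂ) * (U.snd i : ℂ)) * Complex.I_sq

theorem phaseParam_add (X Z : R2d d) : phaseParam (X + Z) = phaseParam X + phaseParam Z := by
  funext i
  simp only [phaseParam, WithLp.add_fst, WithLp.add_snd, Pi.add_apply, PiLp.add_apply]
  push_cast
  ring

theorem sum_mul_phaseParam_re (x : Rd d) (Z : R2d d) :
    (∑ i, (x i : ℂ) * phaseParam Z i).re = inner ℝ x Z.fst := by
  rw [Complex.re_sum, PiLp.inner_apply]
  refine Finset.sum_congr rfl fun i _ => ?_
  simp [phaseParam, mul_comm]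

theorem norm_stft (f : GSDual d (1 / 2)) (X : R2d d) :
    ‖stft f X‖ = (2 * Real.pi) ^ (-(d : ℝ) / 2) *
      (shiftFactor X.fst * ‖f.toLin ⟨gaussExp (phaseParam X), gaussExp_mem _⟩‖) := by
  rw [stft, f.apply_windowShift, norm_mul, norm_mul, Complex.norm_real, Complex.norm_real,
    Real.norm_of_nonneg (by positivity), Real.norm_of_nonneg (by unfold shiftFactor; positivity)]

theorem continuous_stft (f : GSDual d (1 / 2)) : Continuous (stft f) :=
  f.continuous_apply_windowShift.const_mul _

/-- Up to a Gaussian factor in a neighbourhood of a point, the modulus of the short-time Fourier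
transform is the modulus of a holomorphic function on complex lines. -/
theorem exists_holomorphic_norm_stft (f : GSDual d (1 / 2)) (X Z U : R2d d) :
    ∃ g : ℂ → ℂ, Differentiable ℂ g ∧ ∀ τ : ℂ,
      ‖stft f (X + (Z + τ.re • U + τ.im • phaseRotate U))‖ *
        Real.exp (‖(Z + τ.re • U + τ.im • phaseRotate U).fst‖ ^ 2 / 2) = ‖g τ‖ := by
  set K : ℝ := (2 * Real.pi) ^ (-(d : ℝ) / 2) * shiftFactor X.fst with hK
  have hK0 : 0 ≤ K := by rw [hK]; unfold shiftFactor; positivity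
  refine ⟨fun τ => K * Complex.exp (-(∑ i, (X.fst i : ℂ) * (phaseParam Z + τ • phaseParam U) i)) *
    f.toLin ⟨gaussExp (phaseParam X + phaseParam Z + τ • phaseParam U), gaussExp_mem _⟩, ?_, ?_⟩
  · refine Differentiable.mul ?_ (f.differentiable_apply_gaussExp _ _)
    simp only [Pi.add_apply, Pi.smul_apply, smul_eq_mul]
    fun_prop
  · intro τ
    have e1 := phaseParam_add X (Z + τ.re • U + τ.im • phaseRotate U)
    have e2 := phaseParam_line Z U τ
    set Y := Z + τ.re • U + τ.im • phaseRotate U with hY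
    rw [norm_stft, norm_mul, norm_mul, Complex.norm_real, Real.norm_of_nonneg hK0, ← e2,
      Complex.norm_exp, Complex.neg_re, sum_mul_phaseParam_re, hK]
    have e3 : phaseParam X + phaseParam Z + τ • phaseParam U = phaseParam (X + Y) := by
      rw [e1, e2, add_assoc]
    have e4 : f.toLin ⟨gaussExp (phaseParam X + phaseParam Z + τ • phaseParam U), gaussExp_mem _⟩ =
        f.toLin ⟨gaussExp (phaseParam (X + Y)), gaussExp_mem _⟩ := by
      congr 1
      exact Subtype.ext (congrArg gaussExp e3)
    rw [e4]
    -- Expanding |x + y|² leaves only the cross term, and e^{-⟨x,y⟩} is the modulus of a holomorphic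
    -- exponential. This is why the local Gaussian factor makes the transform a holomorphic modulus.
    have e5 : shiftFactor (X + Y).fst * Real.exp (‖Y.fst‖ ^ 2 / 2) =
        shiftFactor X.fst * Real.exp (-inner ℝ X.fst Y.fst) := by
      rw [shiftFactor, shiftFactor, mul_assoc, mul_assoc, ← Real.exp_add, ← Real.exp_add]
      congr 2
      rw [WithLp.add_fst, norm_add_sq_real]
      ring
    linear_combination ((2 * Real.pi) ^ (-(d : ℝ) / 2) *
      ‖f.toLin ⟨gaussExp (phaseParam (X + Y)), gaussExp_mem _⟩‖) * e5

/-- A weighted mixed quasi-norm of a short-time Fourier transform controls its values. -/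
theorem exists_norm_stft_mul_le_mixedNorm {n : ℕ} {V : Fin n → Submodule ℝ (R2d d)}
    (hV : DirectSum.IsInternal V) {p : Fin n → ℝ≥0∞} (hp : ∀ j, 0 < p j) :
    ∃ c : ℝ, 0 < c ∧ ∀ (f : GSDual d (1 / 2)) (ω : R2d d → ℝ) (X : R2d d) (b : ℝ), 0 ≤ b →
      (∀ Y, ‖Y - X‖ < 1 → b ≤ ω Y) →
      ENNReal.ofReal (c * (‖stft f X‖ * b)) ≤
        mixedNorm V p (fun Y => ‖stft f Y * (ω Y : ℂ)‖ₑ) := by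
  obtain ⟨N, c, hc, hmix⟩ := exists_le_mixedNorm_indicator_ball hV hp
  -- The factor e^{-1/2} removes the local Gaussian on the unit ball, 1/2 comes from v ≥ v(Z₀)/2,
  -- and the power of two from comparing v(Z₀)ρ^N with v(0). Nothing depends on f, ω or X.
  refine ⟨Real.exp (-(1 / 2)) / 2 * c * ((2 ^ (N + 5))⁻¹) ^ (N + 1), by positivity,
    fun f ω X b hb hω => ?_⟩
  set v : R2d d → ℝ := fun Z => ‖stft f (X + Z)‖ * Real.exp (‖Z.fst‖ ^ 2 / 2) with hvdef
  have hfst : Continuous fun Z : R2d d => Z.fst := WithLp.continuous_fst 2 _ _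
  have hvc : Continuous v :=
    ((continuous_stft f).comp (by fun_prop)).norm.mul (by fun_prop)
  obtain ⟨Z₀, ρ, hρ, hρ1, hball, hval⟩ := exists_ball_le_of_line_holomorphic norm_phaseRotate hvc
    (fun Z U => exists_holomorphic_norm_stft f X Z U) N
  have hv0 : v 0 = ‖stft f X‖ := by simp [hvdef]
  have hm0 : 0 ≤ v Z₀ := by positivity
  set a : ℝ := Real.exp (-(1 / 2)) * (v Z₀ / 2) * b with ha
  refine le_trans (ENNReal.ofReal_le_ofReal ?_) ((hmix (X + Z₀) ρ a hρ hρ1 (by positivity)).trans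
    (mixedNorm_mono V p fun Y => ?_))
  · rw [ha, ← hv0]
    calc _ = Real.exp (-(1 / 2)) / 2 * c * b * (((2 ^ (N + 5))⁻¹) ^ (N + 1) * v 0) := by ring
      _ ≤ Real.exp (-(1 / 2)) / 2 * c * b * (v Z₀ * ρ ^ N) := by gcongr
      _ = _ := by ring
  · by_cases hY : Y ∈ Metric.ball (X + Z₀) ρ
    · rw [Set.indicator_of_mem hY, ← ofReal_norm]
      refine ENNReal.ofReal_le_ofReal ?_
      have hZ : Y - X ∈ Metric.ball Z₀ ρ := by
        rw [mem_ball_iff_norm] at hY ⊢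
        rwa [sub_sub]
      obtain ⟨h1, h2⟩ := hball _ hZ
      have h3 := hω Y h1
      rw [norm_mul, Complex.norm_real, Real.norm_of_nonneg (hb.trans h3)]
      have h4 : ‖(Y - X).fst‖ ^ 2 ≤ 1 := by
        have h5 : ‖(Y - X).fst‖ ^ 2 ≤ ‖Y - X‖ ^ 2 := by
          rw [WithLp.prod_norm_sq_eq_of_L2]
          exact le_add_of_nonneg_right (sq_nonneg _)
        refine h5.trans (pow_le_one₀ (norm_nonneg _) h1.le)
      have h6 : v (Y - X) ≤ ‖stft f Y‖ * Real.exp (1 / 2) := by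
        simp only [hvdef, add_sub_cancel]
        gcongr
      have h7 : Real.exp (-(1 / 2)) * (v Z₀ / 2) ≤ ‖stft f Y‖ := by
        rw [Real.exp_neg, inv_mul_le_iff₀ (Real.exp_pos _), mul_comm]
        exact h2.trans h6
      exact mul_le_mul h7 h3 hb (norm_nonneg _)
    · rw [Set.indicator_of_notMem hY]
      exact zero_le

end Pointwise

/-! ### Growth of transforms of distributions -/

section Growth

variable {d : ℕ}

theorem monoDeriv_le_toReal_gsNorm {s h : ℝ} (hh : 0 < h) {φ : Rd d → ℂ} (hφ : gsNorm s h φ < ∞)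
    (α β : Fin d → ℕ) (y : Rd d) :
    monoDeriv φ α β y ≤ (gsNorm s h φ).toReal * gsFactor s h α β := by
  have h1 : ENNReal.ofReal (monoDeriv φ α β y / gsFactor s h α β) ≤ gsNorm s h φ :=
    le_iSup_of_le α (le_iSup_of_le β (le_iSup_of_le y le_rfl))
  exact (div_le_iff₀ (gsFactor_pos hh α β)).1 ((ENNReal.ofReal_le_iff_le_toReal hφ.ne).1 h1)

theorem toReal_gsNorm_le {s h : ℝ} (hh : 0 < h) {φ : Rd d → ℂ} {B : ℝ} (hB : 0 ≤ B)
    (hφ : ∀ α β y, monoDeriv φ α β y ≤ B * gsFactor s h α β) : (gsNorm s h φ).toReal ≤ B := by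
  refine ENNReal.toReal_le_of_le_ofReal hB ?_
  refine iSup_le fun α => iSup_le fun β => iSup_le fun y => ENNReal.ofReal_le_ofReal ?_
  exact (div_le_iff₀ (gsFactor_pos hh α β)).2 (hφ α β y)

/-- The rate κ is prescribed first and h is chosen accordingly; this is legitimate because the form
is continuous on S_{s,h} for every h. -/
theorem GSDual.exists_norm_apply_windowShift_le {s κ : ℝ} (hs : 1 / 2 ≤ s) (hκ : 0 < κ)
    (v : GSDual d s) : ∃ C : ℝ, 0 ≤ C ∧ ∀ (X : R2d d) (hX : windowShift X.fst X.snd ∈ GS d s),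
      ‖v.toLin ⟨windowShift X.fst X.snd, hX⟩‖ ≤ C * Real.exp (κ * phaseRpow (1 / s) X) := by
  obtain ⟨h, C, -, hh, hC, hW⟩ := exists_monoDeriv_windowShift_le (d := d) hs hκ 0
  obtain ⟨A, hA⟩ := v.bound h hh
  refine ⟨|A| * C, by positivity, fun X hX => ?_⟩
  have hb : ∀ α β y, monoDeriv (windowShift X.fst X.snd) α β y ≤
      C * Real.exp (κ * phaseRpow (1 / s) X) * gsFactor s h α β := fun α β y =>
    (hW X α β y).trans_eq (by ring)
  have h1 : gsNorm s h (windowShift X.fst X.snd) < ∞ := (gsNorm_lt_top_iff hh _).2 ⟨_, hb⟩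
  refine (hA ⟨_, hX⟩ h1).trans ?_
  calc _ ≤ |A| * (C * Real.exp (κ * phaseRpow (1 / s) X)) :=
        mul_le_mul (le_abs_self A) (toReal_gsNorm_le hh (by positivity) hb)
          ENNReal.toReal_nonneg (abs_nonneg A)
    _ = _ := by ring

theorem phaseRpow_two (X : R2d d) : phaseRpow (1 / (1 / 2)) X = ‖X.fst‖ ^ 2 + ‖X.snd‖ ^ 2 := by
  rw [phaseRpow, one_div_one_div, Real.rpow_two, Real.rpow_two]

/-- The factor between a short-time Fourier transform and the values at the shifted windows. -/
theorem norm_stft_eq (f : GSDual d (1 / 2)) (X : R2d d) :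
    ‖stft f X‖ = (2 * Real.pi) ^ (-(d : ℝ) / 2) *
      ‖f.toLin ⟨windowShift X.fst X.snd, windowShift_mem X.fst X.snd⟩‖ := by
  rw [stft, norm_mul, Complex.norm_real, Real.norm_of_nonneg (by positivity)]

/-- The short-time Fourier transform of every distribution has subgaussian growth. -/
theorem exists_norm_stft_le (f : GSDual d (1 / 2)) {ε : ℝ} (hε : 0 < ε) :
    ∃ C : ℝ, ∀ X : R2d d, ‖stft f X‖ ≤ C * Real.exp (ε * (‖X.fst‖ ^ 2 + ‖X.snd‖ ^ 2)) := by
  obtain ⟨C, -, hC⟩ := f.exists_norm_apply_windowShift_le le_rfl hε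
  refine ⟨(2 * Real.pi) ^ (-(d : ℝ) / 2) * C, fun X => ?_⟩
  rw [norm_stft_eq, mul_assoc, ← phaseRpow_two]
  gcongr
  exact hC X _

theorem Upsilon_eq_univ : Upsilon d = Set.univ :=
  Set.eq_univ_of_forall fun f _ hε => exists_norm_stft_le f hε

end Growth

/-! ### A weakly subgaussian weight adapted to one distribution -/

section SubgaussianWeight

variable {E : Type*} [NormedAddCommGroup E]

/-- The greatest lower bound of the lines `t ↦ A k + t / (k + 1)`. -/
def slopeEnvelope (A : ℕ → ℝ) (t : ℝ) : ℝ := ⨅ k : ℕ, (A k + t / (k + 1))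

theorem slopeEnvelope_bddBelow {A : ℕ → ℝ} (hA : ∀ k, 0 ≤ A k) {t : ℝ} (ht : 0 ≤ t) :
    BddBelow (Set.range fun k : ℕ => A k + t / (k + 1)) :=
  ⟨0, by rintro _ ⟨k, rfl⟩; have := hA k; positivity⟩

theorem slopeEnvelope_le {A : ℕ → ℝ} (hA : ∀ k, 0 ≤ A k) {t : ℝ} (ht : 0 ≤ t) (k : ℕ) :
    slopeEnvelope A t ≤ A k + t / (k + 1) :=
  ciInf_le (slopeEnvelope_bddBelow hA ht) k

theorem slopeEnvelope_nonneg {A : ℕ → ℝ} (hA : ∀ k, 0 ≤ A k) {t : ℝ} (ht : 0 ≤ t) :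
    0 ≤ slopeEnvelope A t :=
  le_ciInf fun k => by have := hA k; positivity

/-- All slopes 1/(k+1) lie between 0 and 1, so the infimum of the lines is nondecreasing and
1-Lipschitz. -/
theorem slopeEnvelope_le_add {A : ℕ → ℝ} (hA : ∀ k, 0 ≤ A k) {t u δ : ℝ} (ht : 0 ≤ t)
    (hδ : 0 ≤ δ) (h : t ≤ u + δ) : slopeEnvelope A t ≤ slopeEnvelope A u + δ := by
  rw [← sub_le_iff_le_add]
  refine le_ciInf fun k => ?_
  have h1 := slopeEnvelope_le hA ht k
  have h2 : t / ((k : ℝ) + 1) ≤ u / (k + 1) + δ / (k + 1) := by rw [← add_div]; gcongr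
  have h3 : δ / ((k : ℝ) + 1) ≤ δ := div_le_self hδ (by linarith [Nat.cast_nonneg (α := ℝ) k])
  linarith

/-- The weight `exp(-θ(|x|²) - |x|)` with a lower envelope `θ` of lines of small slopes. -/
def envelopeWeight (A : ℕ → ℝ) (x : E) : ℝ := Real.exp (-(slopeEnvelope A (‖x‖ ^ 2) + ‖x‖))

variable {A : ℕ → ℝ}

theorem envelopeWeight_pos (x : E) : 0 < envelopeWeight A x := Real.exp_pos _

theorem envelopeWeight_le_one (hA : ∀ k, 0 ≤ A k) (x : E) : envelopeWeight A x ≤ 1 :=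
  Real.exp_le_one_iff.2 (neg_nonpos.2
    (add_nonneg (slopeEnvelope_nonneg hA (sq_nonneg _)) (norm_nonneg _)))

theorem le_envelopeWeight (hA : ∀ k, 0 ≤ A k) (k : ℕ) (x : E) :
    Real.exp (-(A k + ‖x‖ ^ 2 / (k + 1) + ‖x‖)) ≤ envelopeWeight A x := by
  refine Real.exp_le_exp.2 (neg_le_neg ?_)
  have := slopeEnvelope_le hA (sq_nonneg ‖x‖) k
  linarith

variable [InnerProductSpace ℝ E]

/-- When |x||y| ≤ 1, |x ± y|² differs from |x|² by at most 2 + |y|² ≤ 3, and |x ± y| from |x| by at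
most 1. Hence the exponent changes by at most 4. -/
theorem envelopeWeight_add_le (hA : ∀ k, 0 ≤ A k) {x y : E} (hx : 2 ≤ ‖x‖)
    (hxy : ‖x‖ * ‖y‖ ≤ 1) :
    envelopeWeight A (x + y) ≤ Real.exp 4 * envelopeWeight A x ∧
      envelopeWeight A x ≤ Real.exp 4 * envelopeWeight A (x + y) := by
  have hy0 := norm_nonneg y
  have hy : ‖y‖ ≤ 1 / 2 := by nlinarith
  have h1 := norm_add_sq_real x y
  have h2 := abs_le.1 (abs_real_inner_le_norm x y)
  have h3 := norm_add_le x y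
  have h4 : ‖x‖ ≤ ‖x + y‖ + ‖y‖ := by
    have := norm_sub_le (x + y) y
    rwa [add_sub_cancel_right] at this
  have h5 : ‖y‖ ^ 2 ≤ 1 := by nlinarith
  have h6 := slopeEnvelope_le_add hA (t := ‖x + y‖ ^ 2) (u := ‖x‖ ^ 2) (δ := 3) (sq_nonneg _)
    (by norm_num) (by linarith [h2.2])
  have h7 := slopeEnvelope_le_add hA (t := ‖x‖ ^ 2) (u := ‖x + y‖ ^ 2) (δ := 3) (sq_nonneg _)
    (by norm_num) (by linarith [h2.1, sq_nonneg ‖y‖])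
  constructor <;>
  · rw [envelopeWeight, envelopeWeight, ← Real.exp_add, Real.exp_le_exp]
    linarith

theorem isRotationInvariant_envelopeWeight : IsRotationInvariant (E := E) (envelopeWeight A) :=
  fun T x => by rw [envelopeWeight, envelopeWeight, T.norm_map]

theorem isWeaklySubgaussian_envelopeWeight [FiniteDimensional ℝ E] [MeasurableSpace E]
    [BorelSpace E] (hA : ∀ k, 0 ≤ A k) : IsWeaklySubgaussian (E := E) (envelopeWeight A) where
  pos := envelopeWeight_pos
  aemeasurable := by
    refine Measurable.aemeasurable ?_
    unfold envelopeWeight slopeEnvelope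
    refine (Measurable.add (Measurable.iInf fun k => ?_) measurable_norm).neg.exp
    fun_prop
  locallyBounded K _ := ⟨1, ae_of_all _ fun x => envelopeWeight_le_one hA x⟩
  locallyBelow K hK := by
    obtain ⟨R, hR⟩ := hK.isBounded.exists_norm_le
    refine ⟨Real.exp (-(A 0 + R ^ 2 + R)), Real.exp_pos _, fun x hx => ?_⟩
    refine le_trans (Real.exp_le_exp.2 (neg_le_neg ?_)) (le_envelopeWeight hA 0 x)
    have h1 := hR x hx
    have h2 : ‖x‖ ^ 2 ≤ R ^ 2 := by gcongr
    simp only [Nat.cast_zero, zero_add, div_one]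
    linarith
  secondDifference := by
    -- With c = 1, R ≥ 2 forces |x| ≥ 2. The shifts by y and -y are estimated separately, each
    -- costing e⁴.
    refine ⟨1, Real.exp 8, one_pos, Real.exp_pos _, fun R hR x y hx hxy => ?_⟩
    have hx2 : 2 ≤ ‖x‖ := by linarith
    obtain ⟨h1, h2⟩ := envelopeWeight_add_le hA hx2 hxy
    obtain ⟨h3, h4⟩ := envelopeWeight_add_le hA (y := -y) hx2 (by rwa [norm_neg])
    rw [← sub_eq_add_neg] at h3 h4
    have e8 : Real.exp 8 = Real.exp 4 * Real.exp 4 := by rw [← Real.exp_add]; norm_num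
    have p1 := envelopeWeight_pos (A := A) x
    have p2 := envelopeWeight_pos (A := A) (x + y)
    have p3 := envelopeWeight_pos (A := A) (x - y)
    refine ⟨?_, ?_⟩
    · rw [inv_mul_le_iff₀ (Real.exp_pos _), e8, sq]
      calc _ ≤ (Real.exp 4 * envelopeWeight A (x + y)) * (Real.exp 4 * envelopeWeight A (x - y)) := by
            gcongr
        _ = _ := by ring
    · rw [e8, sq]
      calc _ ≤ (Real.exp 4 * envelopeWeight A x) * (Real.exp 4 * envelopeWeight A x) := by gcongr
        _ = _ := by ring
  subgaussian c hc := by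
    -- Half of c pays for the slope of the k-th line; the other half absorbs |x| by completing the
    -- square, with constant 1/(2c).
    obtain ⟨k, hk⟩ := exists_nat_one_div_lt (half_pos hc)
    have hk0 := hA k
    refine ⟨Real.exp (A k + 1 / (2 * c)), Real.exp_pos _, fun x => ⟨?_, ?_⟩⟩
    · rw [← Real.exp_neg, ← Real.exp_add]
      refine le_trans (Real.exp_le_exp.2 ?_) (le_envelopeWeight hA k x)
      have h1 : ‖x‖ ^ 2 / ((k : ℝ) + 1) ≤ c / 2 * ‖x‖ ^ 2 := by
        rw [div_eq_mul_one_div, mul_comm]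
        gcongr
      have h2 : ‖x‖ ≤ c / 2 * ‖x‖ ^ 2 + 1 / (2 * c) := by
        have h3 : c / 2 * ‖x‖ ^ 2 + 1 / (2 * c) - ‖x‖ = (c * ‖x‖ - 1) ^ 2 / (2 * c) := by
          field_simp
          ring
        have : 0 ≤ (c * ‖x‖ - 1) ^ 2 / (2 * c) := by positivity
        linarith
      linarith
    · refine (envelopeWeight_le_one hA x).trans ?_
      rw [← Real.exp_add]
      exact Real.one_le_exp (by positivity)

variable {d n : ℕ}

/-- Every distribution belongs to a modulation space with a rotation invariant weakly subgaussian
weight. -/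
theorem exists_mem_modulationSpace {V : Fin n → Submodule ℝ (R2d d)}
    (hV : DirectSum.IsInternal V) {p : Fin n → ℝ≥0∞} (hp : ∀ j, 0 < p j) (f : GSDual d (1 / 2)) :
    ∃ ω : R2d d → ℝ, IsWeaklySubgaussian ω ∧ IsRotationInvariant ω ∧
      f ∈ modulationSpace ω V p := by
  have hA : ∀ k : ℕ, ∃ A : ℝ, 0 ≤ A ∧ ∀ X : R2d d, ‖stft f X‖ ≤
      Real.exp (A + ‖X‖ ^ 2 / (k + 1)) := by
    intro k
    obtain ⟨C, hC⟩ := exists_norm_stft_le f (ε := 1 / ((k : ℝ) + 1)) (by positivity)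
    -- The bound C ≤ e^{|C|} replaces a logarithm and gives the nonnegativity required of the
    -- intercepts.
    refine ⟨|C|, abs_nonneg C, fun X => (hC X).trans ?_⟩
    rw [← WithLp.prod_norm_sq_eq_of_L2, one_div_mul_eq_div, Real.exp_add]
    gcongr
    exact (le_abs_self C).trans ((lt_add_one _).le.trans (Real.add_one_le_exp _))
  choose A hA0 hA using hA
  refine ⟨envelopeWeight A, isWeaklySubgaussian_envelopeWeight hA0,
    isRotationInvariant_envelopeWeight, ?_⟩
  obtain ⟨m, hm⟩ := mixedNorm_lt_top_of_decay hV hp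
  obtain ⟨C, hC, hexp⟩ := exists_one_add_pow_le_exp_rpow one_pos one_pos m
  refine hm _ C fun X => ?_
  rw [← ofReal_norm]
  refine ENNReal.ofReal_le_ofReal ?_
  -- Taking logarithms lets the bounds for all k pass to their infimum. The term -|X| in the weight
  -- then leaves e^{-|X|}, enough for any mixed quasi-norm.
  have h1 : ‖stft f X‖ ≤ Real.exp (slopeEnvelope A (‖X‖ ^ 2)) := by
    rcases (norm_nonneg (stft f X)).eq_or_lt with h | h
    · rw [← h]; exact (Real.exp_pos _).le
    · rw [← Real.log_le_iff_le_exp h]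
      exact le_ciInf fun k => (Real.log_le_iff_le_exp h).2 (hA k X)
  have h2 := hexp ‖X‖ (norm_nonneg X)
  rw [Real.rpow_one, one_mul] at h2
  rw [norm_mul, Complex.norm_real, Real.norm_of_nonneg (envelopeWeight_pos X).le]
  calc _ ≤ Real.exp (slopeEnvelope A (‖X‖ ^ 2)) * envelopeWeight A X := by
        gcongr
        exact (envelopeWeight_pos X).le
    _ = (Real.exp ‖X‖)⁻¹ := by
        rw [envelopeWeight, ← Real.exp_add, ← Real.exp_neg]
        congr 1; ring
    _ ≤ _ := by
        rw [← div_eq_mul_inv, inv_eq_one_div, div_le_div_iff₀ (Real.exp_pos _) (by positivity)]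
        linarith

end SubgaussianWeight

/-! ### Reflection in frequency and local comparison of powers -/

section PhaseSpace

variable {d : ℕ}

/-- The isometry `(x, ξ) ↦ (x, -ξ)` of phase space. -/
def phaseFlip : R2d d ≃ₗᵢ[ℝ] R2d d :=
  { LinearEquiv.ofInvolutive
      { toFun := fun X : R2d d => (WithLp.toLp 2 (X.fst, -X.snd) : R2d d)
        map_add' := fun X Y =>
          congrArg (WithLp.toLp 2) (Prod.ext rfl (neg_add X.snd Y.snd))
        map_smul' := fun c X =>
          congrArg (WithLp.toLp 2) (Prod.ext rfl (smul_neg c X.snd).symm) }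
      (fun X => congrArg (WithLp.toLp 2) (Prod.ext rfl (neg_neg X.snd))) with
    norm_map' := fun X => by
      change ‖(WithLp.toLp 2 (X.fst, -X.snd) : R2d d)‖ = ‖X‖
      rw [WithLp.prod_norm_eq_of_L2, WithLp.prod_norm_eq_of_L2]
      simp }

theorem phaseFlip_fst (X : R2d d) : (phaseFlip X).fst = X.fst := rfl

theorem phaseFlip_snd (X : R2d d) : (phaseFlip X).snd = -X.snd := rfl

theorem phaseRpow_phaseFlip (q : ℝ) (X : R2d d) : phaseRpow q (phaseFlip X) = phaseRpow q X := by
  rw [phaseRpow, phaseRpow, phaseFlip_fst, phaseFlip_snd, norm_neg]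

theorem integral_comp_phaseFlip (K : R2d d → ℂ) : ∫ X, K (phaseFlip X) = ∫ X, K X :=
  (phaseFlip (d := d)).measurePreserving.integral_comp
    (phaseFlip (d := d)).toHomeomorph.measurableEmbedding K

theorem rpow_le_two_rpow_mul_add_one {γ t u : ℝ} (hγ : 0 < γ) (ht : 0 ≤ t) (hu : 0 ≤ u)
    (h : t ≤ u + 1) : t ^ γ ≤ 2 ^ γ * (u ^ γ + 1) := by
  have h0 : 0 ≤ u ^ γ := by positivity
  rcases le_total u 1 with h1 | h1
  · calc t ^ γ ≤ 2 ^ γ := by gcongr; linarith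
      _ ≤ _ := le_mul_of_one_le_right (by positivity) (by linarith)
  · calc t ^ γ ≤ (2 * u) ^ γ := by gcongr; linarith
      _ = 2 ^ γ * u ^ γ := Real.mul_rpow (by norm_num) hu
      _ ≤ _ := by gcongr; linarith

/-- A substitute for moderateness of the exponential weight: on unit balls its exponent changes at
most by a factor 2^γ and an additive constant, both harmless because the target exponents differ
from γ. -/
theorem phaseRpow_le_of_norm_sub_le {γ : ℝ} (hγ : 0 < γ) {X Y : R2d d} (h : ‖Y - X‖ ≤ 1) :
    phaseRpow γ Y ≤ 2 ^ γ * (phaseRpow γ X + 2) := by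
  have h1 : ‖(Y - X).fst‖ ≤ 1 := (WithLp.norm_fst_le _ _).trans h
  have h2 : ‖(Y - X).snd‖ ≤ 1 := (WithLp.norm_snd_le _ _).trans h
  rw [WithLp.sub_fst] at h1
  rw [WithLp.sub_snd] at h2
  have h3 := norm_sub_norm_le Y.fst X.fst
  have h4 := norm_sub_norm_le Y.snd X.snd
  have h5 := rpow_le_two_rpow_mul_add_one hγ (norm_nonneg Y.fst) (norm_nonneg X.fst) (by linarith)
  have h6 := rpow_le_two_rpow_mul_add_one hγ (norm_nonneg Y.snd) (norm_nonneg X.snd) (by linarith)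
  calc phaseRpow γ Y = ‖Y.fst‖ ^ γ + ‖Y.snd‖ ^ γ := rfl
    _ ≤ 2 ^ γ * (‖X.fst‖ ^ γ + 1) + 2 ^ γ * (‖X.snd‖ ^ γ + 1) := add_le_add h5 h6
    _ = 2 ^ γ * (phaseRpow γ X + 2) := by rw [phaseRpow]; ring

end PhaseSpace

/-! ### The four inclusions for exponential weights -/

section Modulation

variable {d n : ℕ} {V : Fin n → Submodule ℝ (R2d d)} {p : Fin n → ℝ≥0∞} {ω : R2d d → ℝ}

theorem mem_modulationSpace_of_norm_stft_mul_le (hV : DirectSum.IsInternal V) (hp : ∀ j, 0 < p j)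
    {f : GSDual d (1 / 2)} {D r q : ℝ} (hr : 0 < r) (hq : 0 < q) (hω : ∀ X, 0 ≤ ω X)
    (h : ∀ X, ‖stft f X‖ * ω X ≤ D * Real.exp (-(r * phaseRpow q X))) :
    f ∈ modulationSpace ω V p := by
  obtain ⟨m, hm⟩ := mixedNorm_lt_top_of_decay hV hp
  obtain ⟨C, hC, hexp⟩ := exists_exp_phaseRpow_le (d := d) hr hq m
  refine hm _ (|D| * C) fun X => ?_
  rw [← ofReal_norm, norm_mul, Complex.norm_real, Real.norm_of_nonneg (hω X)]
  refine ENNReal.ofReal_le_ofReal ((h X).trans ?_)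
  rw [mul_assoc]
  exact mul_le_mul (le_abs_self D) (hexp X) (Real.exp_pos _).le (abs_nonneg D)

/-- Pointwise bound of the short-time Fourier transform in terms of a lower bound for the weight. -/
theorem exists_norm_apply_windowShift_le_of_mem_modulationSpace (hV : DirectSum.IsInternal V)
    (hp : ∀ j, 0 < p j) {f : GSDual d (1 / 2)} (hf : f ∈ modulationSpace ω V p) {b : R2d d → ℝ}
    (hb : ∀ X, 0 < b X) (hbω : ∀ X Y, ‖Y - X‖ < 1 → b X ≤ ω Y) :
    ∃ D : ℝ, 0 ≤ D ∧ ∀ X : R2d d,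
      ‖f.toLin ⟨windowShift X.fst X.snd, windowShift_mem X.fst X.snd⟩‖ ≤ D * (b X)⁻¹ := by
  obtain ⟨c, hc, H⟩ := exists_norm_stft_mul_le_mixedNorm hV hp
  set M := mixedNorm V p (fun Y => ‖stft f Y * (ω Y : ℂ)‖ₑ) with hM
  have hfin : M ≠ ∞ := ne_of_lt hf
  set k : ℝ := (2 * Real.pi) ^ (-(d : ℝ) / 2) with hk
  have hk0 : 0 < k := by positivity
  refine ⟨M.toReal / (c * k), by positivity, fun X => ?_⟩
  have h1 := (ENNReal.ofReal_le_iff_le_toReal hfin).1 (H f ω X (b X) (hb X).le (hbω X))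
  rw [norm_stft_eq, ← hk] at h1
  rw [← div_eq_mul_inv, div_div, le_div_iff₀ (mul_pos (by positivity) (hb X))]
  linarith

/-- For a function, the transform is `analysis` up to the frequency sign and a constant. It decays
at some rate in the power q > γ, and half of that rate beats the growing weight whatever c is. -/
theorem functionsInDual_subset_modulationSpace (hV : DirectSum.IsInternal V) (hp : ∀ j, 0 < p j)
    {γ q C c : ℝ} (hγ : 0 < γ) (hγq : γ < q) (hq : q ≤ 2) (hC : 0 < C) (hc : 0 < c)
    (hω : ∀ X, ω X = C * Real.exp (c * phaseRpow γ X)) :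
    functionsInDual d (1 / q) ⊆ modulationSpace ω V p := by
  rintro f ⟨g, hg, hfg⟩
  have hq0 : 0 < q := hγ.trans hγq
  obtain ⟨A, r, hr, hA⟩ := exists_norm_analysis_le_of_mem
    (one_div_le_one_div_of_le hq0 hq) hg
  rw [one_div_one_div] at hA
  obtain ⟨B, hB⟩ := exists_phaseRpow_le (d := d) hγ hγq (half_pos hr) hc.le
  set k : ℝ := (2 * Real.pi) ^ (-(d : ℝ) / 2) with hk
  have hk0 : 0 < k := by positivity
  refine mem_modulationSpace_of_norm_stft_mul_le hV hp (D := k * A * C * Real.exp B) (half_pos hr)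
    hq0 (fun X => by rw [hω]; positivity) fun X => ?_
  have h1 : f.toLin ⟨windowShift X.fst X.snd, windowShift_mem X.fst X.snd⟩ =
      analysis g (phaseFlip X) := by
    rw [hfg, analysis, phaseFlip_fst, phaseFlip_snd, neg_neg]
  have h2 := hA (phaseFlip X)
  rw [phaseRpow_phaseFlip] at h2
  have hA0 : 0 ≤ A := by
    by_contra hneg
    have := (norm_nonneg _).trans h2
    nlinarith [Real.exp_pos (-(r * phaseRpow q X))]
  rw [norm_stft_eq, h1, hω, ← hk]
  calc _ ≤ k * (A * Real.exp (-(r * phaseRpow q X))) *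
        (C * Real.exp (r / 2 * phaseRpow q X + B)) := by
        gcongr
        exact hB X
    _ = k * A * C * Real.exp B * (Real.exp (-(r * phaseRpow q X)) *
        Real.exp (r / 2 * phaseRpow q X)) := by rw [Real.exp_add]; ring
    _ = _ := by rw [← Real.exp_add]; congr 2; ring

/-- The transform grows at most exponentially in the power q < γ, so half of the decay of the weight
compensates it and the other half gives the finite quasi-norm. -/
theorem distributionsInDual_subset_modulationSpace (hV : DirectSum.IsInternal V)
    (hp : ∀ j, 0 < p j) {γ q C c : ℝ} (hq : 0 < q) (hqγ : q < γ) (hγ : γ ≤ 2) (hC : 0 < C)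
    (hc : c < 0) (hω : ∀ X, ω X = C * Real.exp (c * phaseRpow γ X)) :
    distributionsInDual d (1 / q) ⊆ modulationSpace ω V p := by
  rintro f ⟨v, hv⟩
  have hs : 1 / 2 ≤ 1 / q := one_div_le_one_div_of_le hq (hqγ.le.trans hγ)
  obtain ⟨A, hA0, hA⟩ := v.exists_norm_apply_windowShift_le hs one_pos
  rw [one_div_one_div] at hA
  obtain ⟨B, hB⟩ := exists_phaseRpow_le (d := d) hq hqγ (half_pos (neg_pos.2 hc)) zero_le_one
  set k : ℝ := (2 * Real.pi) ^ (-(d : ℝ) / 2) with hk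
  have hk0 : 0 < k := by positivity
  refine mem_modulationSpace_of_norm_stft_mul_le hV hp (D := k * A * C * Real.exp B)
    (half_pos (neg_pos.2 hc)) (hq.trans hqγ) (fun X => by rw [hω]; positivity) fun X => ?_
  rw [norm_stft_eq, hv _ _ (GS_mono hs (windowShift_mem _ _)), hω, ← hk]
  calc _ ≤ k * (A * Real.exp (-c / 2 * phaseRpow γ X + B)) * (C * Real.exp (c * phaseRpow γ X)) := by
        gcongr
        exact (hA X _).trans (by gcongr; exact hB X)
    _ = k * A * C * Real.exp B * (Real.exp (-c / 2 * phaseRpow γ X) *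
        Real.exp (c * phaseRpow γ X)) := by rw [Real.exp_add]; ring
    _ = _ := by rw [← Real.exp_add]; congr 2; ring

/-- The quasi-norm forces pointwise exponential decay of the transform in the power γ, so the
superposition prescribed by the inversion formula converges in S_{1/q}. Fubini against a test
function shows that it represents f. -/
theorem modulationSpace_subset_functionsInDual (hV : DirectSum.IsInternal V) (hp : ∀ j, 0 < p j)
    {γ q C c : ℝ} (hq : 0 < q) (hqγ : q < γ) (hγ : γ ≤ 2) (hC : 0 < C) (hc : 0 < c)
    (hω : ∀ X, ω X = C * Real.exp (c * phaseRpow γ X)) :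
    modulationSpace ω V p ⊆ functionsInDual d (1 / q) := by
  intro f hf
  have hγ0 : 0 < γ := hq.trans hqγ
  have hs : 1 / 2 ≤ 1 / q := one_div_le_one_div_of_le hq (hqγ.le.trans hγ)
  -- The rate at which the weight still grows after passing to its lower bound on the unit ball
  -- around X.
  set a : ℝ := c * (2 ^ γ)⁻¹ with ha
  have ha0 : 0 < a := by positivity
  obtain ⟨D, hD0, hD⟩ := exists_norm_apply_windowShift_le_of_mem_modulationSpace hV hp hf
    (b := fun X => C * Real.exp (a * phaseRpow γ X - 2 * c)) (fun X => by positivity)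
    (fun X Y hXY => by
      rw [hω]
      gcongr
      have h1 := phaseRpow_le_of_norm_sub_le hγ0 (X := Y) (Y := X) (by rw [norm_sub_rev]; exact hXY.le)
      have h2 : (2 ^ γ)⁻¹ * phaseRpow γ X ≤ phaseRpow γ Y + 2 :=
        (inv_mul_le_iff₀ (by positivity)).2 h1
      calc a * phaseRpow γ X - 2 * c = c * ((2 ^ γ)⁻¹ * phaseRpow γ X) - 2 * c := by rw [ha]; ring
        _ ≤ c * (phaseRpow γ Y + 2) - 2 * c := by gcongr
        _ = _ := by ring)
  set k : ℝ := ((2 * Real.pi) ^ d)⁻¹ with hk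
  have hk0 : 0 < k := by positivity
  set F : R2d d → ℂ := fun X =>
    f.toLin ⟨windowShift X.fst X.snd, windowShift_mem X.fst X.snd⟩ with hF
  have hFc : Continuous F := f.continuous_apply_windowShift
  -- Half of the decay dominates the exponential factor with power q; the other half provides
  -- integrability.
  obtain ⟨B, hB⟩ := exists_phaseRpow_le (d := d) hq hqγ (half_pos ha0) zero_le_one
  have hbound : ∀ X, ‖F X‖ * Real.exp (1 * phaseRpow q X) ≤
      D * C⁻¹ * Real.exp (2 * c + B) * Real.exp (-(a / 2 * phaseRpow γ X)) := by
    intro X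
    calc _ ≤ D * (C * Real.exp (a * phaseRpow γ X - 2 * c))⁻¹ *
          Real.exp (a / 2 * phaseRpow γ X + B) := by
          gcongr
          · exact hD X
          · exact hB X
      _ = D * C⁻¹ * (Real.exp (-(a * phaseRpow γ X - 2 * c)) *
          Real.exp (a / 2 * phaseRpow γ X + B)) := by rw [mul_inv, Real.exp_neg]; ring
      _ = _ := by
          rw [mul_assoc (D * C⁻¹), ← Real.exp_add, ← Real.exp_add]
          congr 2; ring
  have hgood : Integrable fun X => ‖F X‖ * Real.exp (1 * phaseRpow q X) := by
    refine ((integrable_exp_neg_phaseRpow (d := d) (half_pos ha0) hγ0).const_mul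
      (D * C⁻¹ * Real.exp (2 * c + B))).mono' (hFc.norm.mul
        ((continuous_phaseRpow hq).const_mul _).rexp).aestronglyMeasurable
      (ae_of_all _ fun X => ?_)
    rw [Real.norm_of_nonneg (by positivity)]
    exact hbound X
  have hFi : Integrable F := by
    refine hgood.mono hFc.aestronglyMeasurable (ae_of_all _ fun X => ?_)
    rw [norm_mul, norm_norm]
    refine le_mul_of_one_le_right (norm_nonneg _) ?_
    rw [Real.norm_of_nonneg (Real.exp_pos _).le, one_mul]
    exact Real.one_le_exp (phaseRpow_nonneg _ _)
  -- The pairing is bilinear, so swapping the integrals leaves windows of frequency -ξ. Reflecting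
  -- the coefficients brings the integral into the form of `synthesis`.
  set K : R2d d → ℂ := fun X => F (phaseFlip X) with hK
  have hKc : Continuous K := hFc.comp (phaseFlip (d := d)).continuous
  have hKi : Integrable fun X => ‖K X‖ * Real.exp (1 * phaseRpow (1 / (1 / q)) X) := by
    rw [one_div_one_div]
    refine (((phaseFlip (d := d)).measurePreserving.integrable_comp_emb
      (phaseFlip (d := d)).toHomeomorph.measurableEmbedding).2 hgood).congr (ae_of_all _ fun X => ?_)
    simp only [Function.comp_apply, phaseRpow_phaseFlip, hK]
  have hmem := (synthesis_mem_GS hs one_pos hKc.aestronglyMeasurable hKi).1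
  refine ⟨(k : ℂ) • synthesis K, Submodule.smul_mem _ _ hmem, fun φ => ?_⟩
  have hsyn : ∀ y, synthesis K y = ∫ X, F X * windowShift X.fst (-X.snd) y := by
    intro y
    rw [← integral_comp_phaseFlip]
    simp only [synthesis, hK, phaseFlip_fst, phaseFlip_snd, neg_neg]
  have hφi := integrable_of_mem_GS φ.2
  have hswap : Integrable (Function.uncurry fun (X : R2d d) (y : Rd d) =>
      (φ : Rd d → ℂ) y * windowShift X.fst (-X.snd) y * F X) (volume.prod volume) := by
    refine ((hFi.mul_prod hφi).mul_bdd (c := Real.pi ^ (-(d : ℝ) / 4))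
      (g := fun z : R2d d × Rd d => windowShift z.1.fst (-z.1.snd) z.2) ?_
      (ae_of_all _ fun z => norm_windowShift_le _ _ _)).congr (ae_of_all _ fun z => ?_)
    · have h1 : Continuous fun z : R2d d × Rd d => z.1.fst :=
        (WithLp.continuous_fst 2 _ _).comp continuous_fst
      have h2 : Continuous fun z : R2d d × Rd d => z.1.snd :=
        (WithLp.continuous_snd 2 _ _).comp continuous_fst
      refine Continuous.aestronglyMeasurable ?_
      simp only [windowShift, gaussWindow, Complex.conj_ofReal]
      fun_prop
    · simp only [Function.uncurry]
      ring
  have hinv := f.integral_analysis_mul_apply φ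
  have h1 : ∫ X, analysis (φ : Rd d → ℂ) X * F X = ∫ y, synthesis K y * (φ : Rd d → ℂ) y := by
    simp_rw [analysis, ← integral_mul_const]
    rw [integral_integral_swap hswap]
    refine integral_congr_ae (ae_of_all _ fun y => ?_)
    simp only
    rw [hsyn, ← integral_mul_const]
    exact integral_congr_ae (ae_of_all _ fun X => by ring)
  have h2 : (k : ℂ) * (((2 * Real.pi) ^ d : ℝ) : ℂ) = 1 := by
    rw [← Complex.ofReal_mul, hk, inv_mul_cancel₀ (by positivity), Complex.ofReal_one]
  calc f.toLin φ = (k : ℂ) * ((((2 * Real.pi) ^ d : ℝ) : ℂ) * f.toLin φ) := by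
        rw [← mul_assoc, h2, one_mul]
    _ = (k : ℂ) * ∫ y, synthesis K y * (φ : Rd d → ℂ) y := by rw [← hinv, ← h1]
    _ = _ := by
        rw [← integral_const_mul]
        simp only [Pi.smul_apply, smul_eq_mul, mul_assoc]

theorem analysis_add {φ ψ : Rd d → ℂ} (hφ : Integrable φ) (hψ : Integrable ψ) (X : R2d d) :
    analysis (φ + ψ) X = analysis φ X + analysis ψ X := by
  have hw : ∀ {φ : Rd d → ℂ}, Integrable φ →
      Integrable fun y => φ y * windowShift X.fst (-X.snd) y := fun hφ =>
    hφ.mul_bdd (c := Real.pi ^ (-(d : ℝ) / 4)) (continuous_windowShift _ _).aestronglyMeasurable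
      (ae_of_all _ fun y => norm_windowShift_le _ _ _)
  rw [analysis, analysis, analysis, ← integral_add (hw hφ) (hw hψ)]
  simp only [Pi.add_apply, add_mul]

theorem analysis_smul (c : ℂ) (φ : Rd d → ℂ) (X : R2d d) :
    analysis (c • φ) X = c * analysis φ X := by
  rw [analysis, analysis, ← integral_const_mul]
  simp only [Pi.smul_apply, smul_eq_mul, mul_assoc]

/-- A function on phase space of subcritical growth defines a distribution by integration against
short-time Fourier transforms. -/
theorem exists_GSDual_integral_analysis_mul {q : ℝ} (hq : 0 < q) (hq2 : q ≤ 2) {F : R2d d → ℂ}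
    (hFc : Continuous F)
    (hF : ∀ r : ℝ, 0 < r → ∃ D : ℝ, ∀ X, ‖F X‖ ≤ D * Real.exp (r * phaseRpow q X)) :
    ∃ v : GSDual d (1 / q), ∀ φ : GS d (1 / q), v.toLin φ =
      ∫ X, analysis (φ : Rd d → ℂ) X * F X := by
  have hs : 1 / 2 ≤ 1 / q := one_div_le_one_div_of_le hq hq2
  -- The majorant depends on h alone and the seminorm bound enters linearly, which is continuity on
  -- each S_{1/q,h}. The decay rate r is known only after h, hence growth of `F` is assumed at every
  -- positive rate.
  have key : ∀ h : ℝ, 0 < h → ∃ A : ℝ, ∃ G : R2d d → ℝ, Integrable G ∧ A = ∫ X, G X ∧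
      ∀ φ ∈ GS d (1 / q), ∀ B : ℝ, (∀ α β y, monoDeriv φ α β y ≤ B * gsFactor (1 / q) h α β) →
      ∀ X, ‖analysis φ X * F X‖ ≤ B * G X := by
    intro h hh
    obtain ⟨C, r, hC, hr, H⟩ := exists_norm_analysis_le (d := d) hs hh
    rw [one_div_one_div] at H
    obtain ⟨D, hD⟩ := hF (r / 2) (half_pos hr)
    refine ⟨_, fun X => C * D * Real.exp (-(r / 2 * phaseRpow q X)),
      (integrable_exp_neg_phaseRpow (half_pos hr) hq).const_mul _, rfl, fun φ hφ B hB X => ?_⟩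
    have h1 := H φ hφ.1 B hB X
    have hB0 := nonneg_of_monoDeriv_le hB
    rw [norm_mul]
    calc _ ≤ (C * B * Real.exp (-(r * phaseRpow q X))) * (D * Real.exp (r / 2 * phaseRpow q X)) :=
          mul_le_mul h1 (hD X) (norm_nonneg _) (by positivity)
      _ = B * (C * D * (Real.exp (-(r * phaseRpow q X)) * Real.exp (r / 2 * phaseRpow q X))) := by
          ring
      _ = _ := by rw [← Real.exp_add]; congr 3; ring
  have hint : ∀ φ ∈ GS d (1 / q), Integrable fun X => analysis φ X * F X := by
    rintro φ hφ
    obtain ⟨-, h, hh, hn⟩ := id hφ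
    obtain ⟨A, G, hG, -, H⟩ := key h hh
    exact (hG.const_mul _).mono' ((continuous_analysis (integrable_of_mem_GS hφ)).mul
      hFc).aestronglyMeasurable (ae_of_all _ (H φ hφ _ (monoDeriv_le_toReal_gsNorm hh hn)))
  refine ⟨{ toLin :=
              { toFun := fun φ => ∫ X, analysis (φ : Rd d → ℂ) X * F X
                map_add' := fun φ ψ => ?_
                map_smul' := fun c φ => ?_ }
            bound := fun h hh => ?_ }, fun φ => rfl⟩
  · rw [← integral_add (hint φ φ.2) (hint ψ ψ.2)]
    refine integral_congr_ae (ae_of_all _ fun X => ?_)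
    simp only [Submodule.coe_add]
    rw [analysis_add (integrable_of_mem_GS φ.2) (integrable_of_mem_GS ψ.2), add_mul]
  · rw [RingHom.id_apply, smul_eq_mul, ← integral_const_mul]
    refine integral_congr_ae (ae_of_all _ fun X => ?_)
    simp only [Submodule.coe_smul]
    rw [analysis_smul, mul_assoc]
  · obtain ⟨A, G, hG, hA, H⟩ := key h hh
    refine ⟨A, fun φ hφ => ?_⟩
    rw [hA, mul_comm, ← integral_const_mul]
    exact norm_integral_le_of_norm_le (hG.const_mul _)
      (ae_of_all _ (H φ φ.2 _ (monoDeriv_le_toReal_gsNorm hh hφ)))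

/-- The inversion formula itself defines the extension: the transform of f grows in the power γ < q,
slowly enough to be integrated against transforms of S_{1/q}, and on S_{1/2} the result is f again.
-/
theorem modulationSpace_subset_distributionsInDual (hV : DirectSum.IsInternal V)
    (hp : ∀ j, 0 < p j) {γ q C c : ℝ} (hγ : 0 < γ) (hγq : γ < q) (hq : q ≤ 2) (hC : 0 < C)
    (hc : c < 0) (hω : ∀ X, ω X = C * Real.exp (c * phaseRpow γ X)) :
    modulationSpace ω V p ⊆ distributionsInDual d (1 / q) := by
  intro f hf
  have hq0 : 0 < q := hγ.trans hγq
  -- The weight decreases here, so its lower bound on a unit ball uses the largest exponent there;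
  -- this multiplies the rate by 2^γ instead of dividing it.
  set a : ℝ := -c * 2 ^ γ with ha
  have ha0 : 0 < a := mul_pos (neg_pos.2 hc) (by positivity)
  obtain ⟨D, hD0, hD⟩ := exists_norm_apply_windowShift_le_of_mem_modulationSpace hV hp hf
    (b := fun X => C * Real.exp (-(a * (phaseRpow γ X + 2)))) (fun X => by positivity)
    (fun X Y hXY => by
      rw [hω]
      gcongr
      have h1 := mul_le_mul_of_nonneg_left (phaseRpow_le_of_norm_sub_le hγ hXY.le)
        (neg_pos.2 hc).le
      rw [← mul_assoc, ← ha] at h1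
      linarith)
  obtain ⟨v, hv⟩ := exists_GSDual_integral_analysis_mul hq0 hq f.continuous_apply_windowShift
    (fun r hr => by
      obtain ⟨B, hB⟩ := exists_phaseRpow_le (d := d) hγ hγq hr ha0.le
      refine ⟨D * C⁻¹ * Real.exp (B + 2 * a), fun X => (hD X).trans ?_⟩
      rw [mul_inv, ← Real.exp_neg, neg_neg, ← mul_assoc, mul_assoc (D * C⁻¹), ← Real.exp_add]
      gcongr
      linarith [hB X])
  set k : ℂ := ((((2 * Real.pi) ^ d)⁻¹ : ℝ) : ℂ) with hk
  have h2 : k * (((2 * Real.pi) ^ d : ℝ) : ℂ) = 1 := by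
    rw [hk, ← Complex.ofReal_mul, inv_mul_cancel₀ (by positivity), Complex.ofReal_one]
  refine ⟨⟨k • v.toLin, fun h hh => ?_⟩, fun φ h₁ h₂ => ?_⟩
  · obtain ⟨A, hA⟩ := v.bound h hh
    refine ⟨‖k‖ * A, fun φ hφ => ?_⟩
    rw [LinearMap.smul_apply, norm_smul, mul_assoc]
    gcongr
    exact hA φ hφ
  · rw [LinearMap.smul_apply, hv, smul_eq_mul]
    have hinv := f.integral_analysis_mul_apply ⟨φ, h₁⟩
    simp only at hinv ⊢
    rw [hinv, ← mul_assoc, h2, one_mul]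

end Modulation

end GelfandShilov

end

/-! ### The proposition -/

theorem mainTheorem10 (d n : ℕ)
    (V : Fin n → Submodule ℝ (GelfandShilov.R2d d)) (hV : DirectSum.IsInternal V)
    (p : Fin n → ℝ≥0∞) (hp : ∀ j, 0 < p j) :
    (⋃ ω ∈ {ω : GelfandShilov.R2d d → ℝ |
        GelfandShilov.IsWeaklySubgaussian ω ∧ GelfandShilov.IsRotationInvariant ω},
      GelfandShilov.modulationSpace ω V p) = GelfandShilov.Upsilon d ∧
    ∀ γ ε C c : ℝ, 0 < γ → γ < 2 → 0 < ε → ε < min γ (2 - γ) → 0 < C →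
      ∀ ω : GelfandShilov.R2d d → ℝ,
        (∀ X, ω X = C * Real.exp (c * (‖X.fst‖ ^ γ + ‖X.snd‖ ^ γ))) →
        (0 < c →
          GelfandShilov.functionsInDual d (1 / (γ + ε)) ⊆ GelfandShilov.modulationSpace ω V p ∧
          GelfandShilov.modulationSpace ω V p ⊆ GelfandShilov.functionsInDual d (1 / (γ - ε))) ∧
        (c < 0 →
          GelfandShilov.distributionsInDual d (1 / (γ - ε)) ⊆
            GelfandShilov.modulationSpace ω V p ∧
          GelfandShilov.modulationSpace ω V p ⊆
            GelfandShilov.distributionsInDual d (1 / (γ + ε))) := by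
  refine ⟨?_, fun γ ε C c hγ hγ2 hε hmin hC ω hω => ?_⟩
  · rw [GelfandShilov.Upsilon_eq_univ]
    refine Set.eq_univ_of_forall fun f => ?_
    obtain ⟨ω, h1, h2, h3⟩ := GelfandShilov.exists_mem_modulationSpace hV hp f
    exact Set.mem_biUnion (x := ω) ⟨h1, h2⟩ h3
  · have h1 : ε < γ := hmin.trans_le (min_le_left _ _)
    have h2 : ε < 2 - γ := hmin.trans_le (min_le_right _ _)
    exact ⟨fun hc => ⟨GelfandShilov.functionsInDual_subset_modulationSpace hV hp hγ (by linarith)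
        (by linarith) hC hc hω,
      GelfandShilov.modulationSpace_subset_functionsInDual hV hp (by linarith) (by linarith)
        hγ2.le hC hc hω⟩,
      fun hc => ⟨GelfandShilov.distributionsInDual_subset_modulationSpace hV hp (by linarith)
        (by linarith) hγ2.le hC hc hω,
      GelfandShilov.modulationSpace_subset_distributionsInDual hV hp hγ (by linarith)
        (by linarith) hC hc hω⟩⟩
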